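/- Let $F_2$ be the free group on $\{a,b\}$, and let automorphisms of $F_2$ be composed as functions, $(\varphi\psi)(x)=\varphi(\psi(x))$. An invertible substitution is an automorphism $\varphi$ of $F_2$ such that $\varphi(a)$ and $\varphi(b)$ lie in the submonoid $\{a,b\}^*$ of positive elements. Let $\mathrm{IS}(F_2)$ be the monoid of invertible substitutions and $\mathrm{IS}(F_2)^{-1}$ the monoid of their inverses. A rational subset of a monoid $M$ is a set obtained from finite subsets of $M$ by finitely many unions, products and stars $L^*=\bigcup_{n\ge 0}L^n$; equivalently, a set recognized by a finite automaton with transitions labelled by elements of $M$. For $w\in F_2$ let $\lambda_w(x)=w^{-1}xw$, and let $\Lambda=\{\lambda_w : w\in F_2\}$. Let $M=\mathrm{IS}(F_2)$ or $M=\mathrm{IS}(F_2)^{-1}$. Then each of the following problems is decidable. The input consists of the listed data among: elements $u,u_1,\dots,u_k\in F_2$ ($k$ arbitrary) given by words over $\{a,b,a^{-1},b^{-1}\}$; finitely generated subgroups $H,K\le F_2$ given by finite lists of generators; and a rational subset $R$ of $M$ given by a finite automaton whose transitions are labelled by elements $\varphi$ of $M$, each written as the pair of words $(\varphi(a),\varphi(b))$.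 - (1) Given $u,H,R$: whether $u\in\mu(H)$ for some $\mu\in R$. - (1') Given $u,H,R$: whether a conjugate of $u$ lies in $\mu(H)$ for some $\mu\in R$; that is, whether $u\in\mu(H)$ for some $\mu\in\Lambda R$. - (2) Given $K,H,R$: whether $K\subseteq\mu(H)$ for some $\mu\in R$. - (2') Given $K,H,R$: whether a conjugate of $K$ is contained in $\mu(H)$ for some $\mu\in R$; that is, whether $K\subseteq\mu(H)$ for some $\mu\in\Lambda R$. - (3) Given $K,H,R$: whether $K=\mu(H)$ for some $\mu\in R$. - (3') Given $K,H,R$: whether a conjugate of $K$ is equal to $\mu(H)$ for some $\mu\in R$; that is, whether $K=\mu(H)$ for some $\mu\in\Lambda R$. - (4) Given $u_1,\dots,u_k,H,R$: whether there exist $\mu\in R$ and $w_1,\dots,w_k\in F_2$ such that $\lambda_{w_1}(u_1),\dots,\lambda_{w_k}(u_k)\in\mu(H)$. - (5) Given $u,H,R$: whether the orbit of $u$ under the action of $R^{-1}$ (respectively, of $\Lambda R^{-1}$) meets $H$. - (6) Given $K,H,R$: whether $H$ contains an element of the orbit of $K$ under the action of $R^{-1}$ (respectively, of $\Lambda R^{-1}$).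 - (7) Given $K,H,R$: whether $H$ is contained in an element of the orbit of $K$ under the action of $R$ (respectively, of $\Lambda R$). - (8) Given $K,H,R$: whether $K$ is an element of the orbit of $H$ under the action of $R$ (respectively, of $R^{-1}$, of $\Lambda R$, of $\Lambda R^{-1}$). - (9) Given a letter $c\in\{a,b\}$, and $H,R$: whether $H$ contains a primitive element (an element of some basis of $F_2$) of the form $\mu(c)$ with $\mu^{-1}\in R$ (respectively, with $\mu^{-1}\in\Lambda R$). -/

import Mathlib

open scoped Pointwise

/-- The free group on two letters `a = FreeGroup.of 0` and `b = FreeGroup.of 1`. -/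
abbrev F2 : Type := FreeGroup (Fin 2)

/-- Words over the letters `a, b` and their formal inverses: `(i, true)` is the letter `i`,
`(i, false)` its inverse.  Such a word `w` names the element `FreeGroup.mk w` of `F2`.
Words need not be reduced. -/
abbrev Word : Type := List (Fin 2 × Bool)

/-- The finitely generated subgroup of `F2` generated by a finite list of words. -/
def fgSubgroup (gens : List Word) : Subgroup F2 :=
  Subgroup.closure {g | ∃ w ∈ gens, g = FreeGroup.mk w}

/-- The submonoid `{a, b}^*` of positive elements of `F2`. -/
def positiveElements : Submonoid F2 := Submonoid.closure (Set.range FreeGroup.of)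

theorem map_positive {φ : MulAut F2} (h : ∀ i, φ (FreeGroup.of i) ∈ positiveElements)
    {x : F2} (hx : x ∈ positiveElements) : φ x ∈ positiveElements := by
  induction hx using Submonoid.closure_induction with
  | mem x hx => obtain ⟨i, rfl⟩ := hx; exact h i
  | one => simp
  | mul x y _ _ hx hy => rw [map_mul]; exact mul_mem hx hy

/-- The monoid of invertible substitutions (positive automorphisms) of `F2`.  Multiplication in
`MulAut F2` is composition: `(φ * ψ) x = φ (ψ x)`.  With the pointwise operations, `IS⁻¹` is the
monoid of inverses of invertible substitutions. -/
def IS : Submonoid (MulAut F2) where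
  carrier := {φ | ∀ i, φ (FreeGroup.of i) ∈ positiveElements}
  one_mem' := fun i => Submonoid.subset_closure ⟨i, rfl⟩
  mul_mem' := fun {φ _} hφ hψ i => map_positive (φ := φ) hφ (hψ i)

/-- The set of inner automorphisms `x ↦ w⁻¹ * x * w`. -/
def innerAuts : Set (MulAut F2) := {φ | ∃ w : F2, ∀ x, φ x = w⁻¹ * x * w}

/-- The orbit of an element of `F2` under the action of a set of automorphisms. -/
def elementOrbit (G : Set (MulAut F2)) (u : F2) : Set F2 := {v | ∃ μ ∈ G, v = μ u}

/-- The orbit of a subgroup of `F2` under the action of a set of automorphisms. -/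
def subgroupOrbit (G : Set (MulAut F2)) (K : Subgroup F2) : Set (Subgroup F2) :=
  {L | ∃ μ ∈ G, L = K.map μ.toMonoidHom}

/-- The subgroup `w⁻¹ K w`. -/
def conjSubgroup (w : F2) (K : Subgroup F2) : Subgroup F2 :=
  K.map (MulAut.conj w⁻¹).toMonoidHom

/-- A subset `B` of `F2` is a basis if the morphism from the free group on `B` to `F2` induced by
the inclusion is an isomorphism. -/
def IsFreeBasis (B : Set F2) : Prop :=
  Function.Bijective (FreeGroup.lift (Subtype.val : B → F2))

/-- Primitive elements of `F2`. -/
def IsPrimitive (x : F2) : Prop := ∃ B : Set F2, IsFreeBasis B ∧ x ∈ B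

/-- Rational subsets of a monoid: the sets obtained from finite subsets by finitely many
applications of union, product and star. -/
inductive IsRational {N : Type*} [Monoid N] : Set N → Prop
  | finite (L : Set N) (h : L.Finite) : IsRational L
  | union (K L : Set N) (hK : IsRational K) (hL : IsRational L) : IsRational (K ∪ L)
  | mul (K L : Set N) (hK : IsRational K) (hL : IsRational L) : IsRational (K * L)
  | star (L : Set N) (h : IsRational L) : IsRational (⋃ n : ℕ, L ^ n)

/-- `AutPath E p m q`: there is a path from `p` to `q` whose edges are in `E` and whose label (the
product, from left to right, of the labels of its edges) is `m`. -/
inductive AutPath {N σ : Type*} [Monoid N] (E : Set (σ × N × σ)) : σ → N → σ → Prop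
  | nil (p : σ) : AutPath E p 1 p
  | cons {p q r : σ} {x m : N} (h : (p, x, q) ∈ E) (t : AutPath E q m r) : AutPath E p (x * m) r

/-- Finite automata, as concrete data: an initial state, a list of terminal states, and a list of
transitions `(p, (x, y), q)` from `p` to `q`, labelled by the endomorphism `a ↦ x`, `b ↦ y`. -/
abbrev AutomatonCode : Type := ℕ × List ℕ × List (ℕ × (Word × Word) × ℕ)

/-- The transitions of the automaton `A` labelled in the monoid `M` of automorphisms.  (A transition
whose label is not an element of `M` is void.) -/
def AutomatonCode.edges (M : Submonoid (MulAut F2)) (A : AutomatonCode) : Set (ℕ × M × ℕ) :=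
  {e | ∃ x y : Word, (e.1, (x, y), e.2.2) ∈ A.2.2 ∧
    (e.2.1 : MulAut F2) (FreeGroup.of 0) = FreeGroup.mk x ∧
    (e.2.1 : MulAut F2) (FreeGroup.of 1) = FreeGroup.mk y}

/-- The subset of `M` recognized by the automaton: the labels of its successful paths. -/
def AutomatonCode.recognized (M : Submonoid (MulAut F2)) (A : AutomatonCode) : Set M :=
  {m | ∃ q ∈ A.2.1, AutPath (A.edges M) A.1 m q}

/-- The recognized subset of `M`, as a set of automorphisms of `F2`. -/
def AutomatonCode.auts (M : Submonoid (MulAut F2)) (A : AutomatonCode) : Set (MulAut F2) :=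
  Subtype.val '' A.recognized M

/-! Kleene's theorem: the subsets of `M` recognized by finite automata are exactly the rational
subsets of the monoid `M`. -/

section Kleene

variable {N σ τ : Type*} [Monoid N]

theorem AutPath.trans {E : Set (σ × N × σ)} {p q r : σ} {x y : N}
    (h : AutPath E p x q) (h' : AutPath E q y r) : AutPath E p (x * y) r := by
  induction h with
  | nil p => simpa using h'
  | cons e _ ih => rw [mul_assoc]; exact .cons e (ih h')

theorem AutPath.single {E : Set (σ × N × σ)} {p q : σ} {x : N} (h : (p, x, q) ∈ E) :
    AutPath E p x q := by
  simpa using AutPath.cons h (.nil q)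

theorem AutPath.map {E : Set (σ × N × σ)} {E' : Set (τ × N × τ)} (f : σ → τ)
    (hf : ∀ p x q, (p, x, q) ∈ E → (f p, x, f q) ∈ E') {p q : σ} {x : N}
    (h : AutPath E p x q) : AutPath E' (f p) x (f q) := by
  induction h with
  | nil p => exact .nil _
  | cons e _ ih => exact .cons (hf _ _ _ e) ih

theorem AutPath.mem {E : Set (σ × N × σ)} {q : σ} (L : σ → Set N) (h1 : (1 : N) ∈ L q)
    (hL : ∀ p x r, (p, x, r) ∈ E → ∀ m ∈ L r, x * m ∈ L p) {p : σ} {x : N}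
    (h : AutPath E p x q) : x ∈ L p := by
  induction h with
  | nil p => exact h1
  | cons e _ ih => exact hL _ _ _ e _ (ih h1)

theorem mul_mem_star {L : Set N} {x y : N} (hx : x ∈ L) (hy : y ∈ ⋃ n : ℕ, L ^ n) :
    x * y ∈ ⋃ n : ℕ, L ^ n := by
  obtain ⟨n, hn⟩ := Set.mem_iUnion.1 hy
  exact Set.mem_iUnion.2 ⟨n + 1, by rw [pow_succ']; exact Set.mul_mem_mul hx hn⟩

theorem one_mem_star (L : Set N) : (1 : N) ∈ ⋃ n : ℕ, L ^ n :=
  Set.mem_iUnion.2 ⟨0, by simp⟩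

theorem isRational_paths {E : Set (σ × N × σ)} (hE : E.Finite) :
    ∀ p q : σ, IsRational {m | AutPath E p m q} := by
  induction E, hE using Set.Finite.induction_on with
  | empty =>
    intro p q
    refine .finite _ ((Set.finite_singleton (1 : N)).subset ?_)
    intro m hm
    cases hm with
    | nil => rfl
    | cons e _ => exact e.elim
  | @insert e E _ _ ih =>
    obtain ⟨s, x, t⟩ := e
    intro p q
    set P : σ → σ → Set N := fun p q => {m | AutPath E p m q} with hP
    set C : Set N := ⋃ n : ℕ, (P t s * {x}) ^ n with hC
    have key : {m | AutPath (insert (s, x, t) E) p m q}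
        = P p q ∪ P p s * ({x} * (C * P t q)) := by
      have mono : ∀ {p q m}, AutPath E p m q → AutPath (insert (s, x, t) E) p m q :=
        fun h => h.map id (fun _ _ _ h => Set.mem_insert_of_mem _ h)
      have edge : AutPath (insert (s, x, t) E) s x t := .single (Set.mem_insert _ _)
      apply Set.Subset.antisymm
      · intro m hm0
        refine AutPath.mem (fun p => P p q ∪ P p s * ({x} * (C * P t q)))
          (Or.inl (.nil q)) ?_ hm0
        clear hm0 m
        rintro p y r h m (hm | ⟨u, hu, v, hv, rfl⟩)
        · rcases h with h | h
          · obtain ⟨e1, e2, e3⟩ : p = s ∧ y = x ∧ r = t := by simpa using h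
            subst e1 e2 e3
            exact Or.inr ⟨1, .nil _, y * m, ⟨y, rfl, m, ⟨1, one_mem_star _, m, hm, by simp⟩, rfl⟩,
              by simp⟩
          · exact Or.inl (.cons h hm)
        · rcases h with h | h
          · obtain ⟨e1, e2, e3⟩ : p = s ∧ y = x ∧ r = t := by simpa using h
            subst e1 e2 e3
            obtain ⟨x', hx', _, ⟨c, hc, z, hz, rfl⟩, rfl⟩ := hv
            rw [show x' = y from hx']
            refine Or.inr ⟨1, .nil _, y * (((u * y) * c) * z), ⟨y, rfl, _,
              ⟨(u * y) * c, mul_mem_star ⟨u, hu, y, rfl, rfl⟩ hc, z, hz, rfl⟩, rfl⟩, ?_⟩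
            simp [mul_assoc]
          · exact Or.inr ⟨y * u, .cons h hu, v, hv, by simp [mul_assoc]⟩
      · rintro m (hm | ⟨u, hu, _, ⟨x', hx', _, ⟨c, hc, z, hz, rfl⟩, rfl⟩, rfl⟩)
        · exact mono hm
        · rw [show x' = x from hx']
          have hloop : ∀ n : ℕ, ∀ c ∈ (P t s * {x}) ^ n,
              AutPath (insert (s, x, t) E) t c t := by
            intro n
            induction n with
            | zero => intro c hc; rw [pow_zero] at hc; rw [Set.mem_one.1 hc]; exact .nil _
            | succ n ihn =>
              intro c hc
              rw [pow_succ] at hc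
              obtain ⟨d, hd, _, ⟨e, he, x'', hx'', rfl⟩, rfl⟩ := hc
              rw [show x'' = x from hx'']
              exact (ihn d hd).trans ((mono he).trans edge)
          obtain ⟨n, hn⟩ := Set.mem_iUnion.1 hc
          exact (mono hu).trans (edge.trans ((hloop n c hn).trans (mono hz)))
    rw [key]
    exact .union _ _ (ih p q) (.mul _ _ (ih p s) (.mul _ _ (.finite _ (Set.finite_singleton x))
      (.mul _ _ (.star _ (.mul _ _ (ih t s) (.finite _ (Set.finite_singleton x)))) (ih t q))))

theorem IsRational.exists_automaton {R : Set N} (hR : IsRational R) :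
    ∃ (σ : Type) (_ : Encodable σ) (E : Set (σ × N × σ)) (p q : σ), E.Finite ∧
      R = {m | AutPath E p m q} := by
  have hunion : ∀ K L : Set N,
      (∃ (σ : Type) (_ : Encodable σ) (E : Set (σ × N × σ)) (p q : σ), E.Finite ∧
        K = {m | AutPath E p m q}) →
      (∃ (σ : Type) (_ : Encodable σ) (E : Set (σ × N × σ)) (p q : σ), E.Finite ∧
        L = {m | AutPath E p m q}) →
      ∃ (σ : Type) (_ : Encodable σ) (E : Set (σ × N × σ)) (p q : σ), E.Finite ∧
        K ∪ L = {m | AutPath E p m q} := by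
    rintro K L ⟨σ, _, E, p, q, hE, rfl⟩ ⟨τ, _, F, s, t, hF, rfl⟩
    let f : σ → (σ ⊕ τ) ⊕ Bool := fun x => .inl (.inl x)
    let g : τ → (σ ⊕ τ) ⊕ Bool := fun x => .inl (.inr x)
    let D : Set (((σ ⊕ τ) ⊕ Bool) × N × ((σ ⊕ τ) ⊕ Bool)) :=
      {(.inr false, 1, f p), (.inr false, 1, g s), (f q, 1, .inr true), (g t, 1, .inr true)}
    let G := (fun e : σ × N × σ => (f e.1, e.2.1, f e.2.2)) '' E ∪
      ((fun e : τ × N × τ => (g e.1, e.2.1, g e.2.2)) '' F ∪ D)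
    refine ⟨(σ ⊕ τ) ⊕ Bool, inferInstance, G, .inr false, .inr true,
      (hE.image _).union ((hF.image _).union (by simp [D])), ?_⟩
    apply Set.Subset.antisymm
    · have hD : ∀ e ∈ D, e ∈ G := fun e he => Or.inr (Or.inr he)
      rintro m (hm | hm)
      · have h2 : AutPath G (f p) m (f q) :=
          AutPath.map f (fun a b c h => Or.inl ⟨(a, b, c), h, rfl⟩) hm
        simpa using (AutPath.single (hD (.inr false, 1, f p) (by simp [D]))).trans
          (h2.trans (.single (hD (f q, 1, .inr true) (by simp [D]))))
      · have h2 : AutPath G (g s) m (g t) :=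
          AutPath.map g (fun a b c h => Or.inr (Or.inl ⟨(a, b, c), h, rfl⟩)) hm
        simpa using (AutPath.single (hD (.inr false, 1, g s) (by simp [D]))).trans
          (h2.trans (.single (hD (g t, 1, .inr true) (by simp [D]))))
    · intro m hm
      let L : ((σ ⊕ τ) ⊕ Bool) → Set N := fun z => match z with
        | .inl (.inl x) => {m | AutPath E x m q}
        | .inl (.inr x) => {m | AutPath F x m t}
        | .inr false => {m | AutPath E p m q} ∪ {m | AutPath F s m t}
        | .inr true => {1}
      refine AutPath.mem (q := Sum.inr true) L rfl ?_ hm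
      rintro a x b (⟨e, he, h⟩ | ⟨e, he, h⟩ | h) m hm
      · cases h; exact .cons he hm
      · cases h; exact .cons he hm
      · rcases h with h | h | h | h
        · cases h; rw [one_mul]; exact Or.inl hm
        · cases h; rw [one_mul]; exact Or.inr hm
        · cases h
          have : m = 1 := hm
          subst this; rw [one_mul]; exact AutPath.nil q
        · cases h
          have : m = 1 := hm
          subst this; rw [one_mul]; exact AutPath.nil t
  induction hR with
  | finite L h =>
    induction L, h using Set.Finite.induction_on with
    | empty =>
      refine ⟨Bool, inferInstance, ∅, false, true, Set.finite_empty, ?_⟩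
      apply Set.Subset.antisymm (Set.empty_subset _)
      intro m hm
      cases hm with
      | cons e _ => exact e.elim
    | @insert a L _ _ ih =>
      rw [Set.insert_eq]
      refine hunion _ _ ⟨Bool, inferInstance, {(false, a, true)}, false, true,
        Set.finite_singleton _, ?_⟩ ih
      apply Set.Subset.antisymm
      · rintro m rfl; exact .single rfl
      · intro m hm
        refine AutPath.mem (fun b => if b then {1} else {a}) (by simp) ?_ hm
        rintro p x r h m hm
        cases h
        have : m = 1 := by simpa using hm
        simp [this]
  | union K L _ _ hK hL => exact hunion K L hK hL
  | mul K L _ _ hK hL =>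
    obtain ⟨σ, _, E, p, q, hE, rfl⟩ := hK
    obtain ⟨τ, _, F, s, t, hF, rfl⟩ := hL
    let D : Set ((σ ⊕ τ) × N × (σ ⊕ τ)) := {(.inl q, 1, .inr s)}
    let G : Set ((σ ⊕ τ) × N × (σ ⊕ τ)) :=
      (fun e : σ × N × σ => (.inl e.1, e.2.1, .inl e.2.2)) '' E ∪
      ((fun e : τ × N × τ => (.inr e.1, e.2.1, .inr e.2.2)) '' F ∪ D)
    refine ⟨σ ⊕ τ, inferInstance, G, .inl p, .inr t,
      (hE.image _).union ((hF.image _).union (by simp [D])), ?_⟩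
    apply Set.Subset.antisymm
    · rintro _ ⟨x, hx, y, hy, rfl⟩
      have h1 : AutPath G (.inl p) x (.inl q) :=
        AutPath.map Sum.inl (fun a b c h => Or.inl ⟨(a, b, c), h, rfl⟩) hx
      have h2 : AutPath G (.inr s) y (.inr t) :=
        AutPath.map Sum.inr (fun a b c h => Or.inr (Or.inl ⟨(a, b, c), h, rfl⟩)) hy
      have h3 : AutPath G (.inl q) 1 (.inr s) := .single (Or.inr (Or.inr rfl))
      simpa using h1.trans (h3.trans h2)
    · intro m hm
      let L : (σ ⊕ τ) → Set N := fun z => match z with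
        | .inl x => {m | AutPath E x m q} * {m | AutPath F s m t}
        | .inr x => {m | AutPath F x m t}
      refine AutPath.mem (q := Sum.inr t) L (.nil t) ?_ hm
      rintro a x b (⟨e, he, h⟩ | ⟨e, he, h⟩ | h) m hm
      · cases h
        obtain ⟨u, hu, v, hv, rfl⟩ := hm
        exact ⟨e.2.1 * u, .cons he hu, v, hv, by simp [mul_assoc]⟩
      · cases h; exact .cons he hm
      · cases h
        exact ⟨1, .nil q, m, hm, rfl⟩
  | star K _ hK =>
    obtain ⟨σ, _, E, p, q, hE, rfl⟩ := hK
    let D : Set ((σ ⊕ Unit) × N × (σ ⊕ Unit)) := {(.inr (), 1, .inl p), (.inl q, 1, .inr ())}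
    let G : Set ((σ ⊕ Unit) × N × (σ ⊕ Unit)) :=
      (fun e : σ × N × σ => (.inl e.1, e.2.1, .inl e.2.2)) '' E ∪ D
    refine ⟨σ ⊕ Unit, inferInstance, G, .inr (), .inr (),
      (hE.image _).union (by simp [D]), ?_⟩
    apply Set.Subset.antisymm
    · intro m hm
      obtain ⟨n, hn⟩ := Set.mem_iUnion.1 hm
      clear hm
      induction n generalizing m with
      | zero => rw [pow_zero] at hn; rw [Set.mem_one.1 hn]; exact .nil _
      | succ n ih =>
        rw [pow_succ] at hn
        obtain ⟨x, hx, y, hy, rfl⟩ := hn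
        have h2 : AutPath G (.inl p) y (.inl q) :=
          AutPath.map Sum.inl (fun a b c h => Or.inl ⟨(a, b, c), h, rfl⟩) hy
        have h1 : AutPath G (.inr ()) 1 (.inl p) := .single (Or.inr (Or.inl rfl))
        have h3 : AutPath G (.inl q) 1 (.inr ()) := .single (Or.inr (Or.inr rfl))
        have h4 : AutPath G (.inr ()) y (.inr ()) := by simpa using h1.trans (h2.trans h3)
        exact AutPath.trans (ih hx) h4
    · intro m hm
      let L : (σ ⊕ Unit) → Set N := fun z => match z with
        | .inl x => {m | AutPath E x m q} * ⋃ n : ℕ, {m | AutPath E p m q} ^ n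
        | .inr _ => ⋃ n : ℕ, {m | AutPath E p m q} ^ n
      refine AutPath.mem (q := Sum.inr ()) L (one_mem_star _) ?_ hm
      rintro a x b (⟨e, he, h⟩ | h) m hm
      · cases h
        obtain ⟨u, hu, v, hv, rfl⟩ := hm
        exact ⟨e.2.1 * u, .cons he hu, v, hv, by simp [mul_assoc]⟩
      · rcases h with h | h
        · cases h
          obtain ⟨u, hu, v, hv, rfl⟩ := hm
          rw [one_mul]; exact mul_mem_star hu hv
        · cases h
          exact ⟨1, .nil q, m, hm, rfl⟩

end Kleene

theorem AutomatonCode.edges_finite (M : Submonoid (MulAut F2)) (A : AutomatonCode) :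
    (A.edges M).Finite := by
  have hfin : {e : ℕ × (Word × Word) × ℕ | e ∈ A.2.2}.Finite := A.2.2.finite_toSet
  let f : ℕ × M × ℕ → ℕ × (F2 × F2) × ℕ := fun e =>
    (e.1, ((e.2.1 : MulAut F2) (FreeGroup.of 0), (e.2.1 : MulAut F2) (FreeGroup.of 1)), e.2.2)
  have hinj : Function.Injective f := by
    rintro ⟨p, φ, q⟩ ⟨p', φ', q'⟩ h
    simp only [f, Prod.mk.injEq] at h
    obtain ⟨rfl, ⟨h0, h1⟩, rfl⟩ := h
    have : (φ : MulAut F2).toMonoidHom = (φ' : MulAut F2).toMonoidHom := by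
      apply FreeGroup.ext_hom
      intro i
      fin_cases i
      · exact h0
      · exact h1
    have h2 : φ = φ' := by
      apply Subtype.ext
      ext1 x
      exact DFunLike.congr_fun this x
    rw [h2]
  refine Set.Finite.of_finite_image ?_ hinj.injOn
  refine (hfin.image (fun e => (e.1, (FreeGroup.mk e.2.1.1, FreeGroup.mk e.2.1.2), e.2.2))).subset ?_
  rintro _ ⟨e, ⟨x, y, h, hx, hy⟩, rfl⟩
  exact ⟨_, h, by simp [f, hx, hy]⟩

theorem isRational_iff_recognized (M : Submonoid (MulAut F2)) (R : Set M) :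
    IsRational R ↔ ∃ A : AutomatonCode, A.recognized M = R := by
  constructor
  · intro hR
    obtain ⟨σ, _, E, p, q, hE, rfl⟩ := hR.exists_automaton
    let c : σ × M × σ → ℕ × (Word × Word) × ℕ := fun e => (Encodable.encode e.1,
      (((e.2.1 : MulAut F2) (FreeGroup.of 0)).toWord,
        ((e.2.1 : MulAut F2) (FreeGroup.of 1)).toWord), Encodable.encode e.2.2)
    let A : AutomatonCode := (Encodable.encode p, [Encodable.encode q],
      (hE.toFinset.toList).map c)
    have hA : A.edges M =
        (fun e : σ × M × σ => (Encodable.encode e.1, e.2.1, Encodable.encode e.2.2)) '' E := by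
      ext ⟨a, φ, b⟩
      constructor
      · rintro ⟨x, y, h, hx, hy⟩
        simp only [A, List.mem_map, Finset.mem_toList, Set.Finite.mem_toFinset] at h
        obtain ⟨⟨s, ψ, t⟩, he, h⟩ := h
        simp only [c, Prod.mk.injEq] at h
        obtain ⟨rfl, ⟨rfl, rfl⟩, rfl⟩ := h
        refine ⟨(s, ψ, t), he, ?_⟩
        rw [FreeGroup.mk_toWord] at hx hy
        have : (φ : MulAut F2).toMonoidHom = (ψ : MulAut F2).toMonoidHom := by
          apply FreeGroup.ext_hom
          intro i
          fin_cases i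
          · exact hx
          · exact hy
        have h2 : φ = ψ := by
          apply Subtype.ext
          ext1 x
          exact DFunLike.congr_fun this x
        rw [h2]
      · rintro ⟨⟨s, ψ, t⟩, he, h⟩
        simp only [Prod.mk.injEq] at h
        obtain ⟨rfl, rfl, rfl⟩ := h
        refine ⟨_, _, List.mem_map.2 ⟨(s, ψ, t), by simpa using he, rfl⟩, ?_, ?_⟩
        · exact FreeGroup.mk_toWord.symm
        · exact FreeGroup.mk_toWord.symm
    refine ⟨A, ?_⟩
    apply Set.Subset.antisymm
    · rintro m ⟨_, hq, hm⟩
      obtain rfl := List.mem_singleton.1 hq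
      rw [hA] at hm
      have := AutPath.mem (fun n => {m | ∀ s : σ, Encodable.encode s = n → AutPath E s m q})
        (by
          intro s hs
          rw [Encodable.encode_injective hs]
          exact .nil q)
        (by
          rintro a x b ⟨⟨s, ψ, t⟩, he, h⟩ m hm s' hs'
          simp only [Prod.mk.injEq] at h
          obtain ⟨rfl, rfl, rfl⟩ := h
          rw [Encodable.encode_injective hs']
          exact .cons he (hm t rfl)) hm
      exact this p rfl
    · intro m hm
      refine ⟨_, List.mem_singleton.2 rfl, ?_⟩
      rw [hA]
      exact AutPath.map (E' := (fun e : σ × M × σ =>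
        (Encodable.encode e.1, e.2.1, Encodable.encode e.2.2)) '' E)
        Encodable.encode (fun a b c h => ⟨(a, b, c), h, rfl⟩) hm
  · rintro ⟨A, rfl⟩
    have : ∀ l : List ℕ, IsRational {m | ∃ q ∈ l, AutPath (A.edges M) A.1 m q} := by
      intro l
      induction l with
      | nil => simpa using IsRational.finite (∅ : Set M) Set.finite_empty
      | cons q l ih =>
        have := IsRational.union _ _ (isRational_paths (A.edges_finite M) A.1 q) ih
        convert this using 1
        ext m
        simp
    exact this A.2.1

/-!
The automorphisms `L : a ↦ ab, b ↦ b`, `E : a ↦ b, b ↦ a` and `I : a ↦ a⁻¹, b ↦ b⁻¹` generate a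
monoid of which a word over `{L, E, I}` names an element (`autW`). The decidability rests on the
fact that, for finitely generated `K, H ≤ F₂`, the words naming an automorphism that maps `K` into
`H`, or into a conjugate of `H`, form a regular language, with a computable bound on the number of
its residuals (`recog_mem`, `recog_conj`). A rational set of automorphisms that contains a
solution then contains one on a short path of the automaton, by pumping (`exists_short_run`), and
the short paths can be tested one by one (`computablePred_search`).

Regularity. A reduced word is cut into positive and negative pieces, the items of a decorated
word. An item is a letter or a positive word of the form `P c c' S` with `{c, c'} = {a, b}`.
Applying a generator maps items to items and cancels at most a letter `b` at each change of sign
from positive to negative; a piece `ab` arising from a letter `a` is again one item, so the number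
of items never grows (`Deco.length_stepL`), and the result is reduced again (`isReduced_wordL`).
Only the holes `P` and `S` become long. Now a reduced word lies in `H` if and only if it labels a
loop at the base point in the finite hull of the coset graph of `H` (`IsHull.loop_iff`), and for
this only the relations matter that the holes induce on the hull. The function assigning to a pair
of relations on `q` points the evaluation of a positive word is determined for the image of the
word by that for the word itself (`cls_substL`); so the decorated words with holes replaced by
such functions, of which there are finitely many of bounded length, are the states of a finite
automaton. For conjugates of `H` the same is done with a tuple of words up to a common
conjugation, chosen so that the first word stays cyclically reduced (`stepConj_spec`); the points
that a cyclically reduced word fixes lie on the hull (`IsHull.mem_of_cycRed`), so only finitely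
many conjugates have to be considered.

Inverses. Conjugation by `iota : a ↦ a, b ↦ b⁻¹` maps the inverses of the generators to words in
the generators (`autW_dual`). Hence inverses are treated by reversing words, which preserves
regularity. This gives equality in place of containment, and reduces `IS` to `IS⁻¹`. Equality up
to conjugacy is mutual containment up to conjugacy, because a finitely generated subgroup of `F₂`
is not conjugate to a proper subgroup of itself (`conjSubgroup_eq_of_le`).

Invertible substitutions. They are generated by `L`, `L' = I L I` and `E` (`IS_le_stdSub`), which
also shows that it is decidable whether a pair of words names one (`primrecPred_valid`).

Tests. By Marshall Hall's theorem in a quantitative form (`exists_perm_of_notMem`), membership in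
a finitely generated subgroup is decided by the permutation representations on few points, and
conjugators may be taken short (`exists_short_conjugator`).

All the problems reduce to five: the two containments, the two equalities, and the independent
conjugation of several elements.
-/

/-! ### Positive words and signed words -/

/-- The substitution `a ↦ ab`, `b ↦ b` on positive words. -/
def substL (p : List (Fin 2)) : List (Fin 2) := p.flatMap fun c => if c = 0 then [0, 1] else [1]

/-- The substitution `a ↦ ba`, `b ↦ b` on positive words. -/
def substL' (p : List (Fin 2)) : List (Fin 2) := p.flatMap fun c => if c = 0 then [1, 0] else [1]

/-- The word of `p` if the sign is `true`, and of its inverse if the sign is `false`. -/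
def signed (s : Bool) (p : List (Fin 2)) : Word :=
  if s then p.map (·, true) else p.reverse.map (·, false)

@[simp] theorem substL_nil : substL [] = [] := rfl
@[simp] theorem substL'_nil : substL' [] = [] := rfl
@[simp] theorem substL_cons (c : Fin 2) (p : List (Fin 2)) :
    substL (c :: p) = (if c = 0 then [0, 1] else [1]) ++ substL p := rfl
@[simp] theorem substL'_cons (c : Fin 2) (p : List (Fin 2)) :
    substL' (c :: p) = (if c = 0 then [1, 0] else [1]) ++ substL' p := rfl
@[simp] theorem substL_append (p q : List (Fin 2)) : substL (p ++ q) = substL p ++ substL q :=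
  List.flatMap_append
@[simp] theorem signed_true (p : List (Fin 2)) : signed true p = p.map (·, true) := rfl
@[simp] theorem signed_false (p : List (Fin 2)) : signed false p = p.reverse.map (·, false) := rfl

theorem signed_ne_nil {s : Bool} {p : List (Fin 2)} (h : p ≠ []) : signed s p ≠ [] := by
  cases s <;> simpa

theorem cons_substL (p : List (Fin 2)) : 1 :: substL p = substL' p ++ [1] := by
  induction p with
  | nil => rfl
  | cons c p ih =>
    fin_cases c <;> simp [← ih]

theorem substL_ne_nil {p : List (Fin 2)} (h : p ≠ []) : substL p ≠ [] := by
  cases p with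
  | nil => exact absurd rfl h
  | cons c p => fin_cases c <;> simp

theorem two_letters (c : Fin 2) : c = 0 ∨ c = 1 := by fin_cases c <;> simp

/-! ### Decorated words -/

/-- Positive words, or classes of positive words, together with the operations on them that the
action of the automorphisms on decorated words uses. -/
class Holes (α : Type*) where
  /-- The empty word. -/
  empty : α
  /-- The substitution `a ↦ ab`, `b ↦ b`. -/
  substL : α → α
  /-- The substitution `a ↦ ba`, `b ↦ b`. -/
  substL' : α → α
  /-- Writing the letter `b` in front. -/
  consB : α → α
  /-- Exchange of the letters `a` and `b`. -/
  swap : α → α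
  /-- Reversal. -/
  rev : α → α

instance : Holes (List (Fin 2)) where
  empty := []
  substL := substL
  substL' := substL'
  consB p := 1 :: p
  swap p := p.map (· + 1)
  rev := List.reverse

/-- A decorated positive word: a single letter `c`, or a triple `(P, c, S)` standing for the word
`P ++ [c, c + 1] ++ S`, which contains both letters. -/
abbrev Item (α : Type*) : Type _ := Fin 2 ⊕ (α × Fin 2 × α)

/-- A decorated word: a product of items and of inverses of items (sign `false`). -/
abbrev Deco (α : Type*) : Type _ := List (Item α × Bool)

section

variable {α : Type*} [Holes α]

/-- The image of an item `x` under `L : a ↦ ab, b ↦ b`; with the final letter `b` cancelled if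
`cancel` is `true`. -/
def Item.stepL (cancel : Bool) : Item α → Option (Item α)
  | .inl c =>
    if c = 0 then some (if cancel then .inl 0 else .inr (Holes.empty, 0, Holes.empty))
    else if cancel then none else some (.inl 1)
  | .inr (P, c, S) => some (.inr (Holes.substL P, c,
      if cancel then Holes.substL' S else Holes.consB (Holes.substL S)))

/-- The exchange of the letters `a` and `b` in an item. -/
def Item.swap : Item α → Item α
  | .inl c => .inl (c + 1)
  | .inr (P, c, S) => .inr (Holes.swap P, c + 1, Holes.swap S)

/-- The reversal of an item. -/
def Item.rev : Item α → Item α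
  | .inl c => .inl c
  | .inr (P, c, S) => .inr (Holes.rev S, c + 1, Holes.rev P)

/-- Whether the first sign is negative. -/
def startsNeg {β : Type*} : List (β × Bool) → Bool
  | [] => false
  | x :: _ => !x.2

/-- Whether the last sign is positive. -/
def endsPos {β : Type*} : List (β × Bool) → Bool
  | [] => false
  | [x] => x.2
  | _ :: D => endsPos D

/-- The action of `L : a ↦ ab, b ↦ b` on decorated words.  Where a positive item is followed by a
negative one, the two final letters `b` of their images cancel.  The argument `prev` says whether
the word is to be read after a positive item. -/
def Deco.stepL (prev : Bool) : Deco α → Deco α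
  | [] => []
  | (x, s) :: D =>
    ((x.stepL (if s then startsNeg D else prev)).map (·, s)).toList ++ Deco.stepL s D

/-- The action of `a ↦ b, b ↦ a` on decorated words. -/
def Deco.stepE (D : Deco α) : Deco α := D.map fun x => (x.1.swap, x.2)

/-- The action of `a ↦ a⁻¹, b ↦ b⁻¹` on decorated words. -/
def Deco.stepI (D : Deco α) : Deco α := D.map fun x => (x.1.rev, !x.2)

/-- A decorated word never gets longer: the image `ab` of the letter `a` is a single item. -/
theorem Deco.length_stepL (prev : Bool) (D : Deco α) : (D.stepL prev).length ≤ D.length := by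
  induction D generalizing prev with
  | nil => simp [Deco.stepL]
  | cons x D ih =>
    obtain ⟨x, s⟩ := x
    have := ih s
    have h2 : ∀ o : Option (Item α × Bool), o.toList.length ≤ 1 := by
      rintro (_ | _) <;> simp
    have := h2 ((x.stepL (if s then startsNeg D else prev)).map (·, s))
    simp only [Deco.stepL, List.length_append, List.length_cons]
    omega

@[simp] theorem Deco.length_stepE (D : Deco α) : D.stepE.length = D.length := by simp [stepE]

@[simp] theorem Deco.length_stepI (D : Deco α) : D.stepI.length = D.length := by simp [stepI]

end

/-! ### Words of decorated words -/

/-- The positive word of an item. -/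
def Item.word : Item (List (Fin 2)) → List (Fin 2)
  | .inl c => [c]
  | .inr (P, c, S) => P ++ c :: (c + 1) :: S

/-- The word of a decorated word. -/
def Deco.flat (D : Deco (List (Fin 2))) : Word := D.flatMap fun x => signed x.2 x.1.word

@[simp] theorem Deco.flat_nil : Deco.flat [] = [] := rfl
@[simp] theorem Deco.flat_cons (x : Item (List (Fin 2)) × Bool) (D : Deco (List (Fin 2))) :
    Deco.flat (x :: D) = signed x.2 x.1.word ++ Deco.flat D := rfl
@[simp] theorem Deco.flat_append (D D' : Deco (List (Fin 2))) :
    Deco.flat (D ++ D') = Deco.flat D ++ Deco.flat D' := List.flatMap_append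

theorem Item.word_ne_nil (x : Item (List (Fin 2))) : x.word ≠ [] := by
  rcases x with c | ⟨P, c, S⟩ <;> simp [Item.word]

theorem startsNeg_signed_append {s : Bool} {p : List (Fin 2)} (h : p ≠ []) (w : Word) :
    startsNeg (signed s p ++ w) = !s := by
  cases s
  · obtain ⟨q, c, rfl⟩ := List.eq_nil_or_concat' p |>.resolve_left h
    simp [startsNeg]
  · cases p with
    | nil => exact absurd rfl h
    | cons c p => simp [startsNeg]

theorem Deco.startsNeg_flat (D : Deco (List (Fin 2))) : startsNeg D.flat = startsNeg D := by
  cases D with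
  | nil => rfl
  | cons x D => rw [flat_cons, startsNeg_signed_append x.1.word_ne_nil]; rfl

theorem endsPos_append {β : Type*} (D : List (β × Bool)) {D' : List (β × Bool)} (h : D' ≠ []) :
    endsPos (D ++ D') = endsPos D' := by
  induction D with
  | nil => rfl
  | cons x D ih =>
    rw [List.cons_append, ← ih]
    cases hD : D ++ D' with
    | nil => simp_all
    | cons y E => rfl

theorem endsPos_signed {s : Bool} {p : List (Fin 2)} (h : p ≠ []) : endsPos (signed s p) = s := by
  cases s
  · cases p with
    | nil => exact absurd rfl h
    | cons c p => simp only [signed_false, List.reverse_cons, List.map_append]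
                  rw [endsPos_append _ (by simp)]; rfl
  · obtain ⟨q, c, rfl⟩ := List.eq_nil_or_concat' p |>.resolve_left h
    simp only [signed_true, List.map_append]
    rw [endsPos_append _ (by simp)]; rfl

theorem Deco.flat_ne_nil {D : Deco (List (Fin 2))} (h : D ≠ []) : D.flat ≠ [] := by
  cases D with
  | nil => exact absurd rfl h
  | cons x D => simp [signed_ne_nil x.1.word_ne_nil]

theorem Deco.endsPos_flat (D : Deco (List (Fin 2))) : endsPos D.flat = endsPos D := by
  induction D with
  | nil => rfl
  | cons x D ih =>
    rcases eq_or_ne D [] with rfl | h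
    · simp [endsPos_signed x.1.word_ne_nil, endsPos]
    · rw [flat_cons, endsPos_append _ (flat_ne_nil h), ih]
      cases D with
      | nil => exact absurd rfl h
      | cons y D => rfl

/-- The action of `L : a ↦ ab, b ↦ b` on reduced words, letter by letter, with cancellation of `b`
at the places where a positive letter is followed by a negative one. -/
def wordL (prev : Bool) : Word → Word
  | [] => []
  | (c, s) :: w =>
    signed s (if (if s then startsNeg w else prev) then (substL [c]).dropLast else substL [c]) ++
      wordL s w

theorem wordL_pos (prev : Bool) {p : List (Fin 2)} (h : p ≠ []) (w : Word) :
    wordL prev (signed true p ++ w) =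
      signed true (if startsNeg w then (substL p).dropLast else substL p) ++ wordL true w := by
  induction p generalizing prev with
  | nil => exact absurd rfl h
  | cons c p ih =>
    rcases p.eq_nil_or_concat' with rfl | hp
    · simp [wordL]
    · have hp : p ≠ [] := by obtain ⟨L, b, rfl⟩ := hp; simp
      have h1 := startsNeg_signed_append (s := true) hp w
      have h2 := ih true hp
      have h3 : (substL (c :: p)).dropLast = substL [c] ++ (substL p).dropLast := by
        rw [show c :: p = [c] ++ p from rfl, substL_append,
          List.dropLast_append_of_ne_nil (substL_ne_nil hp)]
      have h4 : substL (c :: p) = substL [c] ++ substL p := by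
        rw [show c :: p = [c] ++ p from rfl, substL_append]
      have h5 : signed true (c :: p) ++ w = (c, true) :: (signed true p ++ w) := rfl
      rw [h5, wordL, h2, h1, h3, h4]
      split_ifs <;> simp_all

theorem wordL_neg (prev : Bool) {p : List (Fin 2)} (h : p ≠ []) (w : Word) :
    wordL prev (signed false p ++ w) =
      signed false (if prev then (substL p).dropLast else substL p) ++ wordL false w := by
  induction p using List.reverseRecOn generalizing prev with
  | nil => exact absurd rfl h
  | append_singleton p c ih =>
    rcases eq_or_ne p [] with rfl | hp
    · simp [wordL]
    · have h5 : signed false (p ++ [c]) ++ w = (c, false) :: (signed false p ++ w) := by simp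
      have h2 := ih false hp
      have h3 : (substL (p ++ [c])).dropLast = substL p ++ (substL [c]).dropLast := by
        rw [substL_append, List.dropLast_append_of_ne_nil (substL_ne_nil (by simp))]
      rw [h5, wordL, h2, h3, substL_append]
      split_ifs <;> simp_all

theorem Item.word_stepL (x : Item (List (Fin 2))) (cancel : Bool) :
    ((x.stepL cancel).elim [] Item.word) =
      if cancel then (substL x.word).dropLast else substL x.word := by
  rcases x with c | ⟨P, c, S⟩
  · fin_cases c <;> cases cancel <;> simp [Item.stepL, Item.word, Holes.empty]
  · have h := cons_substL S
    have key : substL (P ++ c :: (c + 1) :: S) = substL P ++ c :: (c + 1) :: 1 :: substL S := by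
      fin_cases c <;> simp
    cases cancel
    · simpa [Item.stepL, Item.word, Holes.substL, Holes.consB] using key.symm
    · simp only [Item.stepL, Item.word, Holes.substL, Holes.substL', if_true, Option.elim, key, h]
      rw [show substL P ++ c :: (c + 1) :: (substL' S ++ [1])
        = (substL P ++ c :: (c + 1) :: substL' S) ++ [1] by simp, List.dropLast_concat]

/-- Decorated words follow the action of `L` on words. -/
theorem Deco.flat_stepL (prev : Bool) (D : Deco (List (Fin 2))) :
    (D.stepL prev).flat = wordL prev D.flat := by
  induction D generalizing prev with
  | nil => rfl
  | cons x D ih =>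
    obtain ⟨x, s⟩ := x
    have hx := x.word_stepL (if s then startsNeg D else prev)
    have h1 : ∀ o : Option (Item (List (Fin 2))), Deco.flat ((o.map (·, s)).toList) =
        signed s (o.elim [] Item.word) := by
      rintro (_ | o)
      · cases s <;> simp
      · simp
    rw [stepL, flat_append, h1, hx, ih, flat_cons]
    cases s
    · rw [wordL_neg prev x.word_ne_nil]; simp
    · rw [wordL_pos prev x.word_ne_nil, Deco.startsNeg_flat]; simp

theorem Deco.flat_stepE (D : Deco (List (Fin 2))) :
    D.stepE.flat = D.flat.map fun x => (x.1 + 1, x.2) := by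
  induction D with
  | nil => rfl
  | cons x D ih =>
    obtain ⟨x, s⟩ := x
    have : x.swap.word = x.word.map (· + 1) := by
      rcases x with c | ⟨P, c, S⟩ <;> simp [Item.swap, Item.word, Holes.swap]
    rw [stepE] at ih ⊢
    simp only [List.map_cons, flat_cons, ih, this, List.map_append]
    cases s <;> simp

theorem Deco.flat_stepI (D : Deco (List (Fin 2))) :
    D.stepI.flat = D.flat.map fun x => (x.1, !x.2) := by
  induction D with
  | nil => rfl
  | cons x D ih =>
    obtain ⟨x, s⟩ := x
    have : x.rev.word = x.word.reverse := by
      rcases x with c | ⟨P, c, S⟩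
      · simp [Item.rev, Item.word]
      · have : c + 1 + 1 = c := by fin_cases c <;> rfl
        simp [Item.rev, Item.word, Holes.rev, this]
    rw [stepI] at ih ⊢
    simp only [List.map_cons, flat_cons, ih, this, List.map_append]
    cases s <;> simp

/-! ### The automorphisms acting on reduced words -/

/-- The automorphism `a ↦ ab`, `b ↦ b`. -/
def autL : MulAut F2 :=
  MonoidHom.toMulEquiv
    (FreeGroup.lift ![FreeGroup.of 0 * FreeGroup.of 1, FreeGroup.of 1])
    (FreeGroup.lift ![FreeGroup.of 0 * (FreeGroup.of 1)⁻¹, FreeGroup.of 1])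
    (by ext i; fin_cases i <;> simp) (by ext i; fin_cases i <;> simp)

/-- The automorphism `a ↦ b`, `b ↦ a`. -/
def autE : MulAut F2 :=
  MonoidHom.toMulEquiv
    (FreeGroup.lift fun i => FreeGroup.of (i + 1)) (FreeGroup.lift fun i => FreeGroup.of (i + 1))
    (by ext i; fin_cases i <;> simp) (by ext i; fin_cases i <;> simp)

/-- The automorphism `a ↦ a⁻¹`, `b ↦ b⁻¹`. -/
def autI : MulAut F2 :=
  MonoidHom.toMulEquiv
    (FreeGroup.lift fun i => (FreeGroup.of i)⁻¹) (FreeGroup.lift fun i => (FreeGroup.of i)⁻¹)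
    (by ext i; fin_cases i <;> simp) (by ext i; fin_cases i <;> simp)

@[simp] theorem autL_zero : autL (FreeGroup.of 0) = FreeGroup.of 0 * FreeGroup.of 1 := by
  simp [autL]
@[simp] theorem autL_one : autL (FreeGroup.of 1) = FreeGroup.of 1 := by simp [autL]
@[simp] theorem autE_of (i : Fin 2) : autE (FreeGroup.of i) = FreeGroup.of (i + 1) := by
  simp [autE]
@[simp] theorem autI_of (i : Fin 2) : autI (FreeGroup.of i) = (FreeGroup.of i)⁻¹ := by
  simp [autI]

/-- The value of a signed letter. -/
def letterVal (x : Fin 2 × Bool) : F2 := if x.2 then FreeGroup.of x.1 else (FreeGroup.of x.1)⁻¹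

theorem mk_cons (x : Fin 2 × Bool) (w : Word) :
    (FreeGroup.mk (x :: w) : F2) = letterVal x * FreeGroup.mk w := by
  obtain ⟨c, s⟩ := x
  rw [show ((c, s) :: w : Word) = [(c, s)] ++ w from rfl, ← FreeGroup.mul_mk]
  cases s <;> simp [letterVal, FreeGroup.of, FreeGroup.invRev]

theorem mk_append (v w : Word) :
    (FreeGroup.mk (v ++ w) : F2) = FreeGroup.mk v * FreeGroup.mk w := FreeGroup.mul_mk.symm

theorem mk_wordL (prev : Bool) (w : Word) :
    (FreeGroup.mk (wordL prev w) : F2) =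
      (if prev && startsNeg w then FreeGroup.of 1 else 1) * autL (FreeGroup.mk w) := by
  induction w generalizing prev with
  | nil => simp [wordL, startsNeg, ← FreeGroup.one_eq_mk]
  | cons x w ih =>
    obtain ⟨c, s⟩ := x
    rw [wordL, mk_append, ih, mk_cons, map_mul]
    cases s
    · rcases two_letters c with rfl | rfl <;> cases prev <;>
        simp [letterVal, mk_cons, startsNeg, ← FreeGroup.one_eq_mk, mul_assoc]
    · have h : startsNeg ((c, true) :: w) = false := rfl
      rw [h]
      generalize startsNeg w = t
      rcases two_letters c with rfl | rfl <;> cases t <;>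
        simp [letterVal, mk_cons, ← FreeGroup.one_eq_mk, mul_assoc]

theorem mk_map_swap (w : Word) :
    (FreeGroup.mk (w.map fun x => (x.1 + 1, x.2)) : F2) = autE (FreeGroup.mk w) := by
  induction w with
  | nil => simp [← FreeGroup.one_eq_mk]
  | cons x w ih =>
    rw [List.map_cons, mk_cons, mk_cons, map_mul, ih]
    obtain ⟨c, s⟩ := x
    cases s <;> simp [letterVal]

theorem mk_map_not (w : Word) :
    (FreeGroup.mk (w.map fun x => (x.1, !x.2)) : F2) = autI (FreeGroup.mk w) := by
  induction w with
  | nil => simp [← FreeGroup.one_eq_mk]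
  | cons x w ih =>
    rw [List.map_cons, mk_cons, mk_cons, map_mul, ih]
    obtain ⟨c, s⟩ := x
    cases s <;> simp [letterVal]

theorem isReduced_map_swap {w : Word} (h : FreeGroup.IsReduced w) :
    FreeGroup.IsReduced (w.map fun x => (x.1 + 1, x.2)) := by
  rw [FreeGroup.IsReduced, List.isChain_map]
  exact List.IsChain.imp (fun x y hxy e => hxy (by simpa using e)) h

theorem isReduced_map_not {w : Word} (h : FreeGroup.IsReduced w) :
    FreeGroup.IsReduced (w.map fun x => (x.1, !x.2)) := by
  rw [FreeGroup.IsReduced, List.isChain_map]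
  exact List.IsChain.imp (fun x y hxy e => by simp [hxy e]) h

/-- The letters with which the image of a reduced word starting with a given letter can start. -/
def headSpec (prev : Bool) : Fin 2 × Bool → List (Fin 2 × Bool)
  | (0, true) => [(0, true)]
  | (1, true) => [(1, true), (0, false)]
  | (0, false) => if prev then [(0, false)] else [(1, false)]
  | (1, false) => if prev then [(0, true), (1, false)] else [(1, false)]

/-- The image under `L` of a letter of the given sign, with the final `b` cancelled if `cancel`. -/
def letterL (cancel : Bool) (x : Fin 2 × Bool) : Word :=
  signed x.2 (if cancel then (substL [x.1]).dropLast else substL [x.1])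

theorem wordL_cons (prev : Bool) (x : Fin 2 × Bool) (w : Word) :
    wordL prev (x :: w) = letterL (if x.2 then startsNeg w else prev) x ++ wordL x.2 w := rfl

theorem isReduced_letterL : ∀ (cancel : Bool) (x : Fin 2 × Bool),
    FreeGroup.IsReduced (letterL cancel x) := by
  unfold FreeGroup.IsReduced; decide

theorem head_letterL : ∀ (prev : Bool) (x y : Fin 2 × Bool), (x.1 = y.1 → x.2 = y.2) →
    ∀ a ∈ (letterL (if x.2 then !y.2 else prev) x).head?, a ∈ headSpec prev x := by
  decide

theorem head_letterL_nil : ∀ (prev : Bool) (x : Fin 2 × Bool),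
    ∀ a ∈ (letterL (if x.2 then false else prev) x).head?, a ∈ headSpec prev x := by
  decide

theorem letterL_compat : ∀ (prev : Bool) (x y : Fin 2 × Bool), (x.1 = y.1 → x.2 = y.2) →
    ∀ b ∈ headSpec x.2 y,
    (∀ a ∈ (letterL (if x.2 then !y.2 else prev) x).getLast?, a.1 = b.1 → a.2 = b.2) ∧
      ∀ a ∈ (letterL (if x.2 then !y.2 else prev) x ++ [b]).head?, a ∈ headSpec prev x := by
  decide

theorem wordL_spec (x : Fin 2 × Bool) (w : Word) (h : FreeGroup.IsReduced (x :: w)) (prev : Bool) :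
    FreeGroup.IsReduced (wordL prev (x :: w)) ∧
      ∀ y ∈ (wordL prev (x :: w)).head?, y ∈ headSpec prev x := by
  induction w generalizing x prev with
  | nil =>
    rw [wordL_cons]
    simp only [wordL, List.append_nil]
    exact ⟨isReduced_letterL _ _, head_letterL_nil prev x⟩
  | cons y w ih =>
    rw [FreeGroup.IsReduced, List.isChain_cons_cons] at h
    obtain ⟨hxy, h⟩ := h
    obtain ⟨ih1, ih2⟩ := ih y h x.2
    have hc := letterL_compat prev x y hxy
    rw [wordL_cons, show startsNeg (y :: w) = !y.2 from rfl]
    generalize wordL x.2 (y :: w) = v at *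
    rcases v with _ | ⟨b, v⟩
    · rw [List.append_nil]
      exact ⟨isReduced_letterL _ _, head_letterL prev x y hxy⟩
    · obtain ⟨h1, h2⟩ := hc b (ih2 b rfl)
      refine ⟨?_, ?_⟩
      · rw [FreeGroup.IsReduced, List.isChain_append]
        exact ⟨isReduced_letterL _ _, ih1, fun a ha b' hb' => by
          obtain rfl : b = b' := by simpa using hb'
          exact h1 a ha⟩
      · intro a ha
        refine h2 a ?_
        generalize letterL (if x.2 then !y.2 else prev) x = l at ha ⊢
        cases l <;> simpa using ha

/-- Cancelling `b` where signs change from positive to negative makes the image reduced. -/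
theorem isReduced_wordL {w : Word} (h : FreeGroup.IsReduced w) (prev : Bool) :
    FreeGroup.IsReduced (wordL prev w) := by
  cases w with
  | nil => simp [wordL, FreeGroup.IsReduced]
  | cons x w => exact (wordL_spec x w h prev).1

/-! ### Cyclically reduced words -/

theorem wordL_prev {w : Word} (h : startsNeg w = false) (prev prev' : Bool) :
    wordL prev w = wordL prev' w := by
  cases w with
  | nil => rfl
  | cons x w =>
    have : x.2 = true := by simpa [startsNeg] using h
    simp [wordL_cons, this]

theorem wordL_append {v : Word} (hv : v ≠ []) {w : Word} (h : (endsPos v && startsNeg w) = false)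
    (prev : Bool) : wordL prev (v ++ w) = wordL prev v ++ wordL false w := by
  induction v generalizing prev with
  | nil => exact absurd rfl hv
  | cons x v ih =>
    rcases v with _ | ⟨y, v⟩
    · rw [List.singleton_append, wordL_cons, wordL_cons]
      simp only [wordL, List.append_nil]
      obtain ⟨c, s⟩ := x
      cases s
      · rfl
      · have h : startsNeg w = false := by simpa [endsPos] using h
        simp only [h]
        rw [wordL_prev h]; rfl
    · rw [List.cons_append, wordL_cons, ih (by simp) h, wordL_cons prev x (y :: v),
        List.append_assoc]
      rfl

theorem mk_ne_one_of_isReduced {w : Word} (h : FreeGroup.IsReduced w) (hw : w ≠ []) :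
    (FreeGroup.mk w : F2) ≠ 1 := by
  intro h1
  rw [← FreeGroup.toWord_eq_nil_iff, FreeGroup.toWord_mk, h.reduce_eq] at h1
  exact hw h1

/-- A nonempty word all of whose powers are reduced. -/
def CycRed (v : Word) : Prop := v ≠ [] ∧ FreeGroup.IsReduced (v ++ v)

theorem CycRed.isReduced {v : Word} (h : CycRed v) : FreeGroup.IsReduced v :=
  h.2.infix (List.prefix_append v v).isInfix

theorem ne_nil_of_mk {v w : Word} {φ : MulAut F2} (hv : FreeGroup.IsReduced v) (h : v ≠ [])
    (hw : (FreeGroup.mk w : F2) = φ (FreeGroup.mk v)) : w ≠ [] := by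
  rintro rfl
  rw [← FreeGroup.one_eq_mk, eq_comm, EmbeddingLike.map_eq_one_iff] at hw
  exact mk_ne_one_of_isReduced hv h hw

theorem CycRed.wordL {v : Word} (h : CycRed v) (hs : (endsPos v && startsNeg v) = false) :
    CycRed (wordL false v) := by
  refine ⟨ne_nil_of_mk h.isReduced h.1 (φ := autL) (by simp [mk_wordL]), ?_⟩
  rw [← wordL_append h.1 hs]
  exact isReduced_wordL h.2 _

theorem CycRed.map_not {v : Word} (h : CycRed v) : CycRed (v.map fun x => (x.1, !x.2)) := by
  refine ⟨by simpa using h.1, ?_⟩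
  rw [← List.map_append]
  exact isReduced_map_not h.2

theorem CycRed.map_swap {v : Word} (h : CycRed v) : CycRed (v.map fun x => (x.1 + 1, x.2)) := by
  refine ⟨by simpa using h.1, ?_⟩
  rw [← List.map_append]
  exact isReduced_map_swap h.2

theorem endsPos_map_not {v : Word} (hv : v ≠ []) :
    endsPos (v.map fun x => (x.1, !x.2)) = !endsPos v := by
  obtain ⟨q, c, rfl⟩ := List.eq_nil_or_concat' v |>.resolve_left hv
  rw [List.map_append, endsPos_append _ (by simp), endsPos_append _ (by simp)]
  rfl

theorem startsNeg_map_not {v : Word} (hv : v ≠ []) :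
    startsNeg (v.map fun x => (x.1, !x.2)) = !startsNeg v := by
  cases v with
  | nil => exact absurd rfl hv
  | cons x v => simp [startsNeg]

/-! ### The action of the generators on tuples of decorated words -/

/-- Names for the automorphisms `L : a ↦ ab, b ↦ b`, `E : a ↦ b, b ↦ a`,
`I : a ↦ a⁻¹, b ↦ b⁻¹`, which generate a monoid containing all invertible substitutions. -/
inductive Gen
  | L
  | E
  | I

/-- The automorphism with a given name. -/
def Gen.aut : Gen → MulAut F2
  | .L => autL
  | .E => autE
  | .I => autI

/-- The product of generators, the first one being applied first. -/
def autW : List Gen → MulAut F2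
  | [] => 1
  | g :: w => autW w * g.aut

theorem autW_append (v w : List Gen) : autW (v ++ w) = autW w * autW v := by
  induction v with
  | nil => simp [autW]
  | cons g v ih => simp [autW, ih, mul_assoc]

section

variable {α : Type*} [Holes α]

/-- The action of a generator on decorated words. -/
def Deco.step : Gen → Deco α → Deco α
  | .L => Deco.stepL false
  | .E => Deco.stepE
  | .I => Deco.stepI

/-- The action of `a ↦ ba`, `b ↦ b`, which is `L` followed by a conjugation, on decorated words. -/
def Deco.stepL' (D : Deco α) : Deco α := Deco.stepI (Deco.stepL false (Deco.stepI D))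

/-- The action of a generator on tuples of decorated words. -/
def stepFix (g : Gen) (Ds : List (Deco α)) : List (Deco α) := Ds.map (Deco.step g)

/-- Whether the first word of the tuple ends with a positive item and starts with a negative one. -/
def sinkBase : List (Deco α) → Bool
  | [] => false
  | D :: _ => endsPos D && startsNeg D

/-- The action of a generator on tuples of decorated words up to a common conjugation, chosen so
that the first word stays cyclically reduced. -/
def stepConj (g : Gen) (Ds : List (Deco α)) : List (Deco α) :=
  match g with
  | .L => if sinkBase Ds then Ds.map Deco.stepL' else Ds.map (Deco.step .L)
  | g => Ds.map (Deco.step g)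

theorem Deco.length_step (g : Gen) (D : Deco α) : (D.step g).length ≤ D.length := by
  cases g
  · exact D.length_stepL false
  · exact (D.length_stepE).le
  · exact (D.length_stepI).le

theorem Deco.length_stepL' (D : Deco α) : D.stepL'.length ≤ D.length := by
  rw [stepL', length_stepI]
  exact (Deco.length_stepL false _).trans (D.length_stepI).le

end

theorem Deco.mk_flat_step (g : Gen) (D : Deco (List (Fin 2))) :
    (FreeGroup.mk (D.step g).flat : F2) = g.aut (FreeGroup.mk D.flat) := by
  cases g
  · simp [step, flat_stepL, mk_wordL, Gen.aut]
  · rw [step, flat_stepE, mk_map_swap]; rfl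
  · rw [step, flat_stepI, mk_map_not]; rfl

theorem Deco.isReduced_step (g : Gen) {D : Deco (List (Fin 2))} (h : FreeGroup.IsReduced D.flat) :
    FreeGroup.IsReduced (D.step g).flat := by
  cases g
  · rw [step, flat_stepL]; exact isReduced_wordL h _
  · rw [step, flat_stepE]; exact isReduced_map_swap h
  · rw [step, flat_stepI]; exact isReduced_map_not h

theorem autI_autL_autI (x : F2) :
    autI (autL (autI x)) = FreeGroup.of 1 * autL x * (FreeGroup.of 1)⁻¹ := by
  have : ((autI * autL * autI : MulAut F2)).toMonoidHom
      = (MulAut.conj (FreeGroup.of 1) * autL : MulAut F2).toMonoidHom := by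
    ext i
    rcases two_letters i with rfl | rfl <;> simp [MulAut.conj_apply, mul_assoc]
  exact DFunLike.congr_fun this x

theorem Deco.mk_flat_stepL' (D : Deco (List (Fin 2))) :
    (FreeGroup.mk D.stepL'.flat : F2) =
      FreeGroup.of 1 * autL (FreeGroup.mk D.flat) * (FreeGroup.of 1)⁻¹ := by
  rw [stepL', flat_stepI, mk_map_not, flat_stepL, mk_wordL, flat_stepI, mk_map_not]
  simpa using autI_autL_autI _

theorem Deco.isReduced_stepL' {D : Deco (List (Fin 2))} (h : FreeGroup.IsReduced D.flat) :
    FreeGroup.IsReduced D.stepL'.flat := by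
  rw [stepL', flat_stepI, flat_stepL, flat_stepI]
  exact isReduced_map_not (isReduced_wordL (isReduced_map_not h) _)

/-- The elements of `F2` that a tuple of decorated words stands for. -/
def vals (Ds : List (Deco (List (Fin 2)))) : List F2 := Ds.map fun D => FreeGroup.mk D.flat

theorem foldl_stepFix (w : List Gen) (Ds : List (Deco (List (Fin 2))))
    (h : ∀ D ∈ Ds, FreeGroup.IsReduced D.flat) :
    (∀ D ∈ w.foldl (fun Ds g => stepFix g Ds) Ds, FreeGroup.IsReduced D.flat) ∧
      vals (w.foldl (fun Ds g => stepFix g Ds) Ds) = (vals Ds).map (autW w) := by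
  induction w generalizing Ds with
  | nil => exact ⟨h, by simp [autW]⟩
  | cons g w ih =>
    obtain ⟨h1, h2⟩ := ih (stepFix g Ds) (by
      intro D hD
      obtain ⟨D', hD', rfl⟩ := List.mem_map.1 hD
      exact Deco.isReduced_step g (h D' hD'))
    refine ⟨h1, ?_⟩
    rw [List.foldl_cons, h2]
    simp [vals, stepFix, Deco.mk_flat_step, autW]

/-- The first word is cyclically reduced, and the others are reduced. -/
def ConjInv (Ds : List (Deco (List (Fin 2)))) : Prop :=
  (∀ D ∈ Ds, FreeGroup.IsReduced D.flat) ∧ ∃ D ∈ Ds.head?, CycRed D.flat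

theorem stepConj_spec (g : Gen) {Ds : List (Deco (List (Fin 2)))} (h : ConjInv Ds) :
    ConjInv (stepConj g Ds) ∧
      ∃ t : F2, vals (stepConj g Ds) = (vals Ds).map fun u => t * g.aut u * t⁻¹ := by
  obtain ⟨h1, D, hD, h2⟩ := h
  have hhead : ∀ f : Deco (List (Fin 2)) → Deco (List (Fin 2)), (Ds.map f).head? = some (f D) := by
    intro f
    rw [List.head?_map, hD]; rfl
  have hsink : sinkBase Ds = (endsPos D.flat && startsNeg D.flat) := by
    cases Ds with
    | nil => simp at hD
    | cons D' Ds =>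
      obtain rfl : D' = D := by simpa using hD
      rw [Deco.endsPos_flat, Deco.startsNeg_flat]; rfl
  have hgen : ∀ g : Gen, CycRed (D.step g).flat → ConjInv (Ds.map (Deco.step g)) ∧
      ∃ t : F2, vals (Ds.map (Deco.step g)) = (vals Ds).map fun u => t * g.aut u * t⁻¹ := by
    intro g hg
    refine ⟨⟨?_, _, hhead _, hg⟩, 1, by simp [vals, Deco.mk_flat_step]⟩
    intro D' hD'
    obtain ⟨D₁, hD₁, rfl⟩ := List.mem_map.1 hD'
    exact Deco.isReduced_step g (h1 D₁ hD₁)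
  rcases g with _ | _ | _
  · rw [stepConj, hsink]
    split_ifs with hs
    · refine ⟨⟨?_, _, hhead _, ?_⟩, FreeGroup.of 1, by simp [vals, Deco.mk_flat_stepL', Gen.aut]⟩
      · intro D' hD'
        obtain ⟨D₁, hD₁, rfl⟩ := List.mem_map.1 hD'
        exact Deco.isReduced_stepL' (h1 D₁ hD₁)
      · rw [Deco.stepL', Deco.flat_stepI, Deco.flat_stepL, Deco.flat_stepI]
        refine (h2.map_not.wordL ?_).map_not
        rw [endsPos_map_not h2.1, startsNeg_map_not h2.1]
        simp_all
    · refine hgen .L ?_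
      rw [Deco.step, Deco.flat_stepL]
      exact h2.wordL (by simpa using hs)
  · refine hgen .E ?_
    rw [Deco.step, Deco.flat_stepE]
    exact h2.map_swap
  · refine hgen .I ?_
    rw [Deco.step, Deco.flat_stepI]
    exact h2.map_not

theorem foldl_stepConj (w : List Gen) {Ds : List (Deco (List (Fin 2)))} (h : ConjInv Ds) :
    ConjInv (w.foldl (fun Ds g => stepConj g Ds) Ds) ∧
      ∃ t : F2, vals (w.foldl (fun Ds g => stepConj g Ds) Ds) =
        (vals Ds).map fun u => t * autW w u * t⁻¹ := by
  induction w generalizing Ds with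
  | nil => exact ⟨h, 1, by simp [autW]⟩
  | cons g w ih =>
    obtain ⟨h1, t, ht⟩ := stepConj_spec g h
    obtain ⟨h2, s, hs⟩ := ih h1
    refine ⟨h2, s * autW w t, ?_⟩
    rw [List.foldl_cons, hs, ht]
    simp [autW, mul_assoc]

/-- A word, with each letter as an item. -/
def toDeco (w : Word) : Deco (List (Fin 2)) := w.map fun x => (.inl x.1, x.2)

@[simp] theorem flat_toDeco (w : Word) : (toDeco w).flat = w := by
  induction w with
  | nil => rfl
  | cons x w ih =>
    obtain ⟨c, s⟩ := x
    rw [toDeco] at ih ⊢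
    rw [List.map_cons, Deco.flat_cons, ih]
    cases s <;> rfl

/-! ### Classes of positive words modulo the relations on a finite set -/

/-- Relations on a set with `q` elements. -/
abbrev FinRel (q : ℕ) : Type := Fin q → Fin q → Prop

/-- Composition of relations. -/
def relComp {q : ℕ} (r s : FinRel q) : FinRel q := fun x z => ∃ y, r x y ∧ s y z

/-- The relation of a positive word, when the letters act by the relations `ρ`. -/
def evalRel {q : ℕ} (ρ : Fin 2 → FinRel q) : List (Fin 2) → FinRel q
  | [] => Eq
  | c :: p => relComp (ρ c) (evalRel ρ p)

/-- Functions assigning to a pair of relations on `q` points a relation on `q` points.  The class of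
a positive word is its evaluation, an element of this finite set. -/
def Cls (q : ℕ) : Type := (Fin 2 → FinRel q) → FinRel q

instance (q : ℕ) : Holes (Cls q) where
  empty := fun _ => Eq
  substL f := fun ρ => f fun c => if c = 0 then relComp (ρ 0) (ρ 1) else ρ 1
  substL' f := fun ρ => f fun c => if c = 0 then relComp (ρ 1) (ρ 0) else ρ 1
  consB f := fun ρ => relComp (ρ 1) (f ρ)
  swap f := fun ρ => f fun c => ρ (c + 1)
  rev f := fun ρ x y => f (fun c x y => ρ c y x) y x

/-- The class of a positive word. -/
def cls (q : ℕ) (p : List (Fin 2)) : Cls q := fun ρ => evalRel ρ p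

theorem relComp_assoc {q : ℕ} (r s t : FinRel q) :
    relComp (relComp r s) t = relComp r (relComp s t) := by
  funext x y
  simp only [relComp, eq_iff_iff]
  constructor
  · rintro ⟨z, ⟨u, h1, h2⟩, h3⟩; exact ⟨u, h1, z, h2, h3⟩
  · rintro ⟨u, h1, z, h2, h3⟩; exact ⟨z, ⟨u, h1, h2⟩, h3⟩

@[simp] theorem eq_relComp {q : ℕ} (r : FinRel q) : relComp Eq r = r := by
  funext x y; simp [relComp]

@[simp] theorem relComp_eq {q : ℕ} (r : FinRel q) : relComp r Eq = r := by
  funext x y; simp [relComp]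

theorem evalRel_append {q : ℕ} (ρ : Fin 2 → FinRel q) (p p' : List (Fin 2)) :
    evalRel ρ (p ++ p') = relComp (evalRel ρ p) (evalRel ρ p') := by
  induction p with
  | nil => simp [evalRel]
  | cons c p ih => simp [evalRel, ih, relComp_assoc]

theorem cls_substL (q : ℕ) (p : List (Fin 2)) : cls q (substL p) = Holes.substL (cls q p) := by
  funext ρ
  simp only [cls, Holes.substL]
  induction p with
  | nil => rfl
  | cons c p ih =>
    rcases two_letters c with rfl | rfl <;> simp [evalRel, ih, relComp_assoc]

theorem cls_substL' (q : ℕ) (p : List (Fin 2)) : cls q (substL' p) = Holes.substL' (cls q p) := by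
  funext ρ
  simp only [cls, Holes.substL']
  induction p with
  | nil => rfl
  | cons c p ih =>
    rcases two_letters c with rfl | rfl <;> simp [evalRel, ih, relComp_assoc]

theorem cls_swap (q : ℕ) (p : List (Fin 2)) : cls q (p.map (· + 1)) = Holes.swap (cls q p) := by
  funext ρ
  simp only [cls, Holes.swap]
  induction p with
  | nil => rfl
  | cons c p ih => simp [evalRel, ih]

theorem evalRel_reverse {q : ℕ} (ρ : Fin 2 → FinRel q) (p : List (Fin 2)) :
    evalRel ρ p.reverse = fun x y => evalRel (fun c x y => ρ c y x) p y x := by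
  induction p with
  | nil => funext x y; simp [evalRel, eq_comm]
  | cons c p ih =>
    rw [List.reverse_cons, evalRel_append, ih]
    funext x y
    simp only [evalRel, relComp_eq]
    simp only [relComp, eq_iff_iff]
    exact ⟨fun ⟨z, h1, h2⟩ => ⟨z, h2, h1⟩, fun ⟨z, h1, h2⟩ => ⟨z, h2, h1⟩⟩

theorem cls_rev (q : ℕ) (p : List (Fin 2)) : cls q p.reverse = Holes.rev (cls q p) := by
  funext ρ
  simp only [cls, Holes.rev, evalRel_reverse]

/-- Items with holes replaced by their classes. -/
def Item.cls (q : ℕ) : Item (List (Fin 2)) → Item (Cls q)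
  | .inl c => .inl c
  | .inr (P, c, S) => .inr (_root_.cls q P, c, _root_.cls q S)

/-- The type of a decorated word: positive words in items are replaced by their classes. -/
def Deco.cls (q : ℕ) (D : Deco (List (Fin 2))) : Deco (Cls q) := D.map fun x => (x.1.cls q, x.2)

theorem Item.cls_stepL (q : ℕ) (cancel : Bool) (x : Item (List (Fin 2))) :
    (x.stepL cancel).map (Item.cls q) = (x.cls q).stepL cancel := by
  rcases x with c | ⟨P, c, S⟩
  · rcases two_letters c with rfl | rfl <;> cases cancel <;> rfl
  · cases cancel
    · simp only [Item.stepL, Item.cls, Option.map_some]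
      rw [← cls_substL, ← cls_substL]; rfl
    · simp only [Item.stepL, Item.cls, Option.map_some]
      rw [← cls_substL, ← cls_substL']; rfl

theorem startsNeg_cls (q : ℕ) (D : Deco (List (Fin 2))) :
    startsNeg (D.cls q) = startsNeg D := by cases D <;> rfl

theorem endsPos_cls (q : ℕ) (D : Deco (List (Fin 2))) : endsPos (D.cls q) = endsPos D := by
  induction D with
  | nil => rfl
  | cons x D ih =>
    cases D with
    | nil => rfl
    | cons y D => exact ih

theorem Deco.cls_stepL (q : ℕ) (prev : Bool) (D : Deco (List (Fin 2))) :
    Deco.cls q (D.stepL prev) = Deco.stepL prev (Deco.cls q D) := by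
  induction D generalizing prev with
  | nil => rfl
  | cons x D ih =>
    obtain ⟨x, s⟩ := x
    have hc : Deco.cls q ((x, s) :: D) = (x.cls q, s) :: Deco.cls q D := rfl
    have ha : ∀ D D' : Deco (List (Fin 2)), Deco.cls q (D ++ D') = Deco.cls q D ++ Deco.cls q D' :=
      fun D D' => List.map_append
    have ho : ∀ o : Option (Item (List (Fin 2))), Deco.cls q ((o.map (·, s)).toList) =
        ((o.map (Item.cls q)).map (·, s)).toList := by
      rintro (_ | o) <;> rfl
    rw [Deco.stepL, ha, ih, ho, Item.cls_stepL, hc, Deco.stepL, startsNeg_cls]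

theorem Deco.cls_stepE (q : ℕ) (D : Deco (List (Fin 2))) :
    Deco.cls q D.stepE = (D.cls q).stepE := by
  simp only [Deco.cls, Deco.stepE, List.map_map]
  refine List.map_congr_left fun x _ => ?_
  obtain ⟨c | ⟨P, c, S⟩, s⟩ := x
  · rfl
  · simp only [Function.comp, Item.cls, Item.swap]
    rw [← cls_swap, ← cls_swap]; rfl

theorem Deco.cls_stepI (q : ℕ) (D : Deco (List (Fin 2))) :
    Deco.cls q D.stepI = (D.cls q).stepI := by
  simp only [Deco.cls, Deco.stepI, List.map_map]
  refine List.map_congr_left fun x _ => ?_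
  obtain ⟨c | ⟨P, c, S⟩, s⟩ := x
  · rfl
  · simp only [Function.comp, Item.cls, Item.rev]
    rw [← cls_rev, ← cls_rev]; rfl

theorem Deco.cls_step (q : ℕ) (g : Gen) (D : Deco (List (Fin 2))) :
    Deco.cls q (D.step g) = (D.cls q).step g := by
  cases g
  · exact Deco.cls_stepL q false D
  · exact Deco.cls_stepE q D
  · exact Deco.cls_stepI q D

theorem Deco.cls_stepL' (q : ℕ) (D : Deco (List (Fin 2))) :
    Deco.cls q D.stepL' = (D.cls q).stepL' := by
  rw [Deco.stepL', Deco.stepL', Deco.cls_stepI, Deco.cls_stepL, Deco.cls_stepI]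

theorem stepFix_cls (q : ℕ) (g : Gen) (Ds : List (Deco (List (Fin 2)))) :
    (stepFix g Ds).map (Deco.cls q) = stepFix g (Ds.map (Deco.cls q)) := by
  simp [stepFix, Deco.cls_step]

theorem stepConj_cls (q : ℕ) (g : Gen) (Ds : List (Deco (List (Fin 2)))) :
    (stepConj g Ds).map (Deco.cls q) = stepConj g (Ds.map (Deco.cls q)) := by
  have hs : sinkBase (Ds.map (Deco.cls q)) = sinkBase Ds := by
    cases Ds with
    | nil => rfl
    | cons D Ds => simp [sinkBase, startsNeg_cls, endsPos_cls]
  cases g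
  · simp only [stepConj, hs]
    split_ifs <;> simp [Deco.cls_step, Deco.cls_stepL']
  · simp [stepConj, Deco.cls_step]
  · simp [stepConj, Deco.cls_step]

/-- The relation of an item. -/
def itemRel {q : ℕ} (ρ : Fin 2 → FinRel q) : Item (Cls q) → FinRel q
  | .inl c => ρ c
  | .inr (f, c, g) => relComp (f ρ) (relComp (ρ c) (relComp (ρ (c + 1)) (g ρ)))

/-- The relation of the type of a decorated word; inverses act by converse relations. -/
def decoRel {q : ℕ} (ρ : Fin 2 → FinRel q) : Deco (Cls q) → FinRel q
  | [] => Eq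
  | (x, s) :: D => relComp (if s then itemRel ρ x else fun i j => itemRel ρ x j i) (decoRel ρ D)

/-- The relation of a word over letters and inverse letters, read without cancellation. -/
def wordRel {q : ℕ} (ρ : Fin 2 → FinRel q) : Word → FinRel q
  | [] => Eq
  | (c, s) :: w => relComp (if s then ρ c else fun i j => ρ c j i) (wordRel ρ w)

theorem wordRel_append {q : ℕ} (ρ : Fin 2 → FinRel q) (v w : Word) :
    wordRel ρ (v ++ w) = relComp (wordRel ρ v) (wordRel ρ w) := by
  induction v with
  | nil => simp [wordRel]
  | cons c v ih => simp [wordRel, ih, relComp_assoc]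

theorem wordRel_signed {q : ℕ} (ρ : Fin 2 → FinRel q) (s : Bool) (p : List (Fin 2)) :
    wordRel ρ (signed s p) = if s then evalRel ρ p else fun i j => evalRel ρ p j i := by
  induction p with
  | nil =>
    cases s
    · funext x y; simp [wordRel, evalRel, eq_comm]
    · rfl
  | cons c p ih =>
    cases s
    · have : signed false (c :: p) = signed false p ++ [(c, false)] := by simp
      rw [this, wordRel_append, ih]
      funext x y
      simp only [wordRel, evalRel, relComp_eq, Bool.false_eq_true, if_false]
      simp only [relComp, eq_iff_iff]
      exact ⟨fun ⟨z, h1, h2⟩ => ⟨z, h2, h1⟩, fun ⟨z, h1, h2⟩ => ⟨z, h2, h1⟩⟩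
    · have : signed true (c :: p) = (c, true) :: signed true p := rfl
      rw [this, wordRel, ih]; rfl

theorem decoRel_cls {q : ℕ} (ρ : Fin 2 → FinRel q) (D : Deco (List (Fin 2))) :
    decoRel ρ (D.cls q) = wordRel ρ D.flat := by
  induction D with
  | nil => rfl
  | cons x D ih =>
    obtain ⟨x, s⟩ := x
    have hc : Deco.cls q ((x, s) :: D) = (x.cls q, s) :: Deco.cls q D := rfl
    have hx : itemRel ρ (x.cls q) = evalRel ρ x.word := by
      rcases x with c | ⟨P, c, S⟩
      · simp [Item.cls, Item.word, itemRel, evalRel]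
      · simp only [Item.cls, Item.word, itemRel, evalRel_append, evalRel]; rfl
    rw [hc, decoRel, ih, Deco.flat_cons, wordRel_append, wordRel_signed, hx]

/-! ### Reading words in the graph of cosets -/

section

variable {X : Type*} [MulAction F2 X]

/-- The points visited when the word `w` is read from `x`; a letter `y` leads from `x` to
`y⁻¹ • x`.  For cosets of `H`, this is the coset graph of `H`. -/
def verts (x : X) : Word → List X
  | [] => []
  | y :: w => ((letterVal y)⁻¹ • x) :: verts ((letterVal y)⁻¹ • x) w

theorem verts_append (x : X) (v w : Word) :
    verts x (v ++ w) = verts x v ++ verts ((FreeGroup.mk v : F2)⁻¹ • x) w := by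
  induction v generalizing x with
  | nil => simp [verts, ← FreeGroup.one_eq_mk]
  | cons y v ih => simp [verts, ih, mk_cons, mul_smul]

theorem length_verts (x : X) (w : Word) : (verts x w).length = w.length := by
  induction w generalizing x with
  | nil => rfl
  | cons y w ih => simp [verts, ih]

theorem end_mem_verts (x : X) {w : Word} (hw : w ≠ []) :
    (FreeGroup.mk w : F2)⁻¹ • x ∈ verts x w := by
  obtain ⟨q, c, rfl⟩ := List.eq_nil_or_concat' w |>.resolve_left hw
  rw [verts_append]
  simp [verts, mk_append, mk_cons, ← FreeGroup.one_eq_mk, mul_smul]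

theorem letterVal_not (y : Fin 2 × Bool) : letterVal (y.1, !y.2) = (letterVal y)⁻¹ := by
  obtain ⟨c, s⟩ := y
  cases s <;> simp [letterVal]

/-- Cancelling a pair of letters does not create new visited points. -/
theorem verts_subset_of_red {v w : Word} (h : FreeGroup.Red v w) (x : X) :
    verts x w ⊆ verts x v := by
  induction h with
  | refl => exact fun _ => id
  | tail _ h ih =>
    refine List.Subset.trans ?_ ih
    cases h with
    | not =>
      rw [verts_append, verts_append]
      intro z hz
      rcases List.mem_append.1 hz with hz | hz
      · exact List.mem_append_left _ hz
      · refine List.mem_append_right _ ?_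
        rw [verts, verts, letterVal_not (_, _), inv_inv, smul_inv_smul]
        exact List.mem_cons_of_mem _ (List.mem_cons_of_mem _ hz)

/-- `Reach S x g`: some word with value `g` can be read from `x` within `S`. -/
def Reach (S : Set X) (x : X) (g : F2) : Prop :=
  ∃ w : Word, FreeGroup.mk w = g ∧ ∀ z ∈ verts x w, z ∈ S

theorem Reach.one (S : Set X) (x : X) : Reach S x 1 :=
  ⟨[], FreeGroup.one_eq_mk.symm, by simp [verts]⟩

theorem Reach.mul {S : Set X} {x : X} {g h : F2} (hg : Reach S x g) (hh : Reach S (g⁻¹ • x) h) :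
    Reach S x (g * h) := by
  obtain ⟨v, rfl, hv⟩ := hg
  obtain ⟨w, rfl, hw⟩ := hh
  refine ⟨v ++ w, mk_append v w, ?_⟩
  rw [verts_append]
  intro z hz
  exact (List.mem_append.1 hz).elim (hv z) (hw z)

theorem Reach.inv {S : Set X} {x : X} {g : F2} (hx : x ∈ S) (hg : Reach S x g) :
    Reach S (g⁻¹ • x) g⁻¹ := by
  obtain ⟨v, rfl, hv⟩ := hg
  induction v generalizing x with
  | nil =>
    rw [← FreeGroup.one_eq_mk, inv_one, one_smul]
    exact Reach.one S x
  | cons y v ih =>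
    rw [mk_cons, mul_inv_rev, mul_smul]
    refine Reach.mul (ih (x := (letterVal y)⁻¹ • x) ?_ ?_) ?_
    · exact hv _ (by simp [verts])
    · exact fun z hz => hv z (by simp [verts, hz])
    · refine ⟨[(y.1, !y.2)], ?_, ?_⟩
      · rw [mk_cons, letterVal_not, ← FreeGroup.one_eq_mk, mul_one]
      · intro z hz
        rw [verts, verts, List.mem_singleton] at hz
        rw [hz, letterVal_not, inv_inv, inv_inv, smul_inv_smul, smul_inv_smul]
        exact hx

theorem Reach.toWord {S : Set X} {x : X} {g : F2} (hg : Reach S x g) :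
    ∀ z ∈ verts x g.toWord, z ∈ S := by
  obtain ⟨v, rfl, hv⟩ := hg
  intro z hz
  refine hv z (verts_subset_of_red ?_ x hz)
  rw [FreeGroup.toWord_mk]
  exact FreeGroup.reduce.red

/-- The relations by which the letters act on points with names in `Fin q`. -/
def stepRel {q : ℕ} (e : Fin q → X) (c : Fin 2) : FinRel q :=
  fun i j => e j = (FreeGroup.of c)⁻¹ • e i

theorem smul_eq_of_wordRel {q : ℕ} {e : Fin q → X} {w : Word} {i j : Fin q}
    (h : wordRel (stepRel e) w i j) : (FreeGroup.mk w : F2)⁻¹ • e i = e j := by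
  induction w generalizing i with
  | nil =>
    obtain rfl : i = j := h
    simp [← FreeGroup.one_eq_mk]
  | cons y w ih =>
    obtain ⟨c, s⟩ := y
    obtain ⟨k, hk, hw⟩ := h
    rw [mk_cons, mul_inv_rev, mul_smul, ← ih hw]
    congr 1
    cases s
    · have hk : e i = (FreeGroup.of c)⁻¹ • e k := hk
      simp [letterVal, hk]
    · have hk : e k = (FreeGroup.of c)⁻¹ • e i := hk
      simp [letterVal, hk]

theorem wordRel_of_verts {q : ℕ} {e : Fin q → X} {w : Word} {i j : Fin q} (hw : w ≠ [])
    (h : ∀ z ∈ verts (e i) w, z ∈ Set.range e) (hj : (FreeGroup.mk w : F2)⁻¹ • e i = e j) :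
    wordRel (stepRel e) w i j := by
  induction w generalizing i with
  | nil => exact absurd rfl hw
  | cons y w ih =>
    obtain ⟨c, s⟩ := y
    have hstep : ∀ k, (letterVal (c, s))⁻¹ • e i = e k →
        (if s then stepRel e c else fun i j => stepRel e c j i) i k := by
      intro k hk
      cases s
      · simp [letterVal] at hk
        simp [stepRel, ← hk]
      · simp [letterVal] at hk
        simp [stepRel, ← hk]
    rw [mk_cons, mul_inv_rev, mul_smul] at hj
    rcases eq_or_ne w [] with rfl | hw'
    · refine ⟨j, hstep j ?_, rfl⟩
      simpa [← FreeGroup.one_eq_mk] using hj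
    · obtain ⟨k, hk⟩ := h _ (List.mem_cons_self)
      refine ⟨k, hstep k hk.symm, ih hw' ?_ ?_⟩
      · intro z hz
        refine h z (List.mem_cons_of_mem _ ?_)
        rwa [hk] at hz
      · rwa [hk]

/-- A finite part of the coset graph that supports the reduced loops: it is connected to
the base point `x₀`, and each element fixing `x₀` can be read within it from `x₀`. -/
structure IsHull (S : Set X) (x₀ : X) : Prop where
  base : x₀ ∈ S
  conn : ∀ x ∈ S, ∃ g : F2, x = g⁻¹ • x₀ ∧ Reach S x₀ g
  loops : ∀ h : F2, h⁻¹ • x₀ = x₀ → Reach S x₀ h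

theorem IsHull.reach {S : Set X} {x₀ : X} (hS : IsHull S x₀) {x : X} (hx : x ∈ S) {h : F2}
    (hh : h⁻¹ • x = x) : Reach S x h := by
  obtain ⟨g, rfl, hg⟩ := hS.conn x hx
  have h1 : (g * h * g⁻¹)⁻¹ • x₀ = x₀ := by
    rw [mul_inv_rev, mul_inv_rev, mul_smul, mul_smul, hh, inv_inv, smul_inv_smul]
  have h2 := hg.inv hS.base
  have h3 : Reach S ((g⁻¹)⁻¹ • (g⁻¹ • x₀)) (g * h * g⁻¹) := by
    simpa using hS.loops _ h1
  have h4 := h2.mul h3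
  have h5 : Reach S ((g⁻¹ * (g * h * g⁻¹))⁻¹ • (g⁻¹ • x₀)) g := by
    rw [mul_inv_rev, mul_smul, inv_inv, smul_inv_smul, h1]
    exact hg
  have := h4.mul h5
  convert this using 1
  group

theorem IsHull.loop_iff {q : ℕ} {e : Fin q → X} {x₀ : X} (hS : IsHull (Set.range e) x₀) {v : Word}
    (hv : FreeGroup.IsReduced v) (i : Fin q) :
    (FreeGroup.mk v : F2)⁻¹ • e i = e i ↔ wordRel (stepRel e) v i i := by
  refine ⟨fun h => ?_, smul_eq_of_wordRel⟩
  rcases eq_or_ne v [] with rfl | hne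
  · exact rfl
  · refine wordRel_of_verts hne ?_ h
    have := (hS.reach ⟨i, rfl⟩ h).toWord
    rwa [FreeGroup.toWord_mk, hv.reduce_eq] at this

/-- Multiplying a reduced word `w` by a word of length `n` on the left changes at most the first
`n` letters of `w`. -/
theorem exists_reduce_append_left (a : Word) {w : Word} (hw : FreeGroup.IsReduced w) :
    ∃ p, FreeGroup.reduce (a ++ w) = p ++ w.drop a.length := by
  induction a with
  | nil => exact ⟨[], by simpa using hw.reduce_eq⟩
  | cons y a ih =>
    obtain ⟨p, hp⟩ := ih
    rw [List.cons_append, FreeGroup.reduce.cons, hp, List.length_cons, ← List.drop_drop]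
    generalize w.drop a.length = u
    cases p with
    | nil =>
      cases u with
      | nil => exact ⟨[y], rfl⟩
      | cons z u =>
        simp only [List.nil_append, List.drop_succ_cons, List.drop_zero]
        split_ifs
        · exact ⟨[], rfl⟩
        · exact ⟨[y, z], rfl⟩
    | cons z p =>
      simp only [List.cons_append]
      split_ifs
      · exact ⟨p ++ u.take 1, by cases u <;> simp⟩
      · exact ⟨y :: z :: p ++ u.take 1, by cases u <;> simp⟩

theorem exists_reduce_append_right {w : Word} (hw : FreeGroup.IsReduced w) (a : Word) :
    ∃ p, FreeGroup.reduce (w ++ a) = w.take (w.length - a.length) ++ p := by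
  have hw' : FreeGroup.IsReduced (FreeGroup.invRev w) := by
    rw [FreeGroup.isReduced_iff_reduce_eq, FreeGroup.reduce_invRev, hw.reduce_eq]
  obtain ⟨p, hp⟩ := exists_reduce_append_left (FreeGroup.invRev a) hw'
  refine ⟨FreeGroup.invRev p, ?_⟩
  rw [← FreeGroup.invRev_invRev (L₁ := FreeGroup.reduce (w ++ a)), ← FreeGroup.reduce_invRev]
  have : FreeGroup.invRev (w ++ a) = FreeGroup.invRev a ++ FreeGroup.invRev w := by
    simp [FreeGroup.invRev]
  rw [this, hp]
  simp [FreeGroup.invRev, List.map_drop, List.reverse_drop, Function.comp_def]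

/-- The points fixed by a cyclically reduced word lie on the hull: a high power of the word, read
at such a point, has to be read inside the hull. -/
theorem IsHull.mem_of_cycRed {S : Set X} {x₀ : X} (hS : IsHull S x₀) {v : Word} (hv : CycRed v)
    {x : X} {t : F2} (ht : x = t⁻¹ • x₀) (hx : (FreeGroup.mk v : F2)⁻¹ • x = x) : x ∈ S := by
  have hcyc : FreeGroup.IsCyclicallyReduced v := by
    have h := hv.2
    rw [FreeGroup.IsReduced, List.isChain_append] at h
    exact ⟨h.1, h.2.2⟩
  set T := t.toWord with hT
  set m := T.length + 1 with hm
  set V : Word := (List.replicate m v).flatten with hV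
  have hVmk : (FreeGroup.mk V : F2) = FreeGroup.mk v ^ m := by rw [FreeGroup.pow_mk]
  have hVV : FreeGroup.IsReduced (V ++ V) := by
    have := (hcyc.flatten_replicate (m + m)).isReduced
    rwa [List.replicate_add, List.flatten_append] at this
  have hVlen : T.length < V.length := by
    have : 1 ≤ v.length := List.length_pos_iff.2 hv.1
    rw [hV, List.length_flatten, List.map_replicate, List.sum_replicate, smul_eq_mul]
    nlinarith
  have hpow : ∀ k : ℕ, ((FreeGroup.mk v : F2) ^ k)⁻¹ • x = x := by
    intro k
    induction k with
    | zero => simp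
    | succ k ih => rw [pow_succ', mul_inv_rev, mul_smul, hx, ih]
  obtain ⟨p, hp⟩ := exists_reduce_append_left T hVV
  rw [List.drop_append_of_le_length hVlen.le, ← List.append_assoc p] at hp
  set Z := p ++ V.drop T.length with hZ
  have hZne : Z ≠ [] := by
    rw [hZ, ← List.length_pos_iff, List.length_append, List.length_drop]
    omega
  have hred : FreeGroup.IsReduced (Z ++ V) := by
    rw [FreeGroup.isReduced_iff_reduce_eq]
    nth_rewrite 1 [← hp]
    rw [FreeGroup.reduce.idem, hp]
  have hmkZ : (FreeGroup.mk Z : F2) = t * FreeGroup.mk v ^ m := by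
    have h1 : (FreeGroup.mk (Z ++ V) : F2) = FreeGroup.mk (T ++ (V ++ V)) := by
      rw [← hp, FreeGroup.reduce.self]
    rw [mk_append Z, mk_append T, mk_append V, hT, FreeGroup.mk_toWord, ← mul_assoc] at h1
    rw [← hVmk]
    exact mul_right_cancel h1
  obtain ⟨r, hr⟩ := exists_reduce_append_right hred (FreeGroup.invRev T)
  have htake : (Z ++ V).take ((Z ++ V).length - (FreeGroup.invRev T).length) =
      Z ++ V.take (V.length - T.length) := by
    rw [FreeGroup.invRev_length, List.length_append,
      show Z.length + V.length - T.length = Z.length + (V.length - T.length) by omega,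
      List.take_length_add_append]
  rw [htake, List.append_assoc Z (List.take _ _), ← FreeGroup.toWord_mk] at hr
  have hfix : ((FreeGroup.mk ((Z ++ V) ++ FreeGroup.invRev T) : F2))⁻¹ • x₀ = x₀ := by
    have hx₀ : x₀ = t • x := by rw [ht, smul_inv_smul]
    rw [mk_append, mk_append, hmkZ, hVmk, ← FreeGroup.inv_mk, hT, FreeGroup.mk_toWord]
    simp only [mul_inv_rev, inv_inv, mul_smul]
    rw [← ht, hpow, hpow, ← hx₀]
  have hmem := (hS.loops _ hfix).toWord
  rw [hr, verts_append] at hmem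
  have h2 := hmem _ (List.mem_append_left _ (end_mem_verts x₀ hZne))
  rw [hmkZ, mul_inv_rev, mul_smul, ← ht, hpow] at h2
  exact h2

end

/-! ### The hull of a finitely generated subgroup -/

/-- The points visited by the words of a list, read from the base point of the coset graph. -/
def hullList (gens : List Word) : List (F2 ⧸ fgSubgroup gens) :=
  ((1 : F2) : F2 ⧸ fgSubgroup gens) ::
    gens.flatMap (verts ((1 : F2) : F2 ⧸ fgSubgroup gens))

theorem length_hullList (gens : List Word) :
    (hullList gens).length = gens.flatten.length + 1 := by
  simp [hullList, List.length_flatMap, length_verts, List.length_flatten]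

theorem inv_smul_base_iff (H : Subgroup F2) (h : F2) :
    h⁻¹ • ((1 : F2) : F2 ⧸ H) = ((1 : F2) : F2 ⧸ H) ↔ h ∈ H := by
  rw [MulAction.Quotient.smul_mk, QuotientGroup.eq]
  simp

theorem isHull_hullList (gens : List Word) :
    IsHull {x | x ∈ hullList gens} ((1 : F2) : F2 ⧸ fgSubgroup gens) := by
  set H := fgSubgroup gens with hH
  set x₀ : F2 ⧸ fgSubgroup gens := ((1 : F2) : F2 ⧸ fgSubgroup gens) with hx₀
  have hbase : x₀ ∈ {x | x ∈ hullList gens} := by simp [hullList, hx₀]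
  have hgen : ∀ w ∈ gens, ∀ z ∈ verts x₀ w, z ∈ {x | x ∈ hullList gens} := by
    intro w hw z hz
    exact List.mem_cons_of_mem _ (List.mem_flatMap.2 ⟨w, hw, hz⟩)
  refine ⟨hbase, ?_, ?_⟩
  · intro x hx
    rcases List.mem_cons.1 hx with rfl | hx
    · exact ⟨1, by simp [hx₀], Reach.one _ _⟩
    · obtain ⟨w, hw, hx⟩ := List.mem_flatMap.1 hx
      have : ∀ (v : Word) (y : F2 ⧸ fgSubgroup gens), x ∈ verts y v →
          (∀ z ∈ verts y v, z ∈ {x | x ∈ hullList gens}) →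
          ∃ g : F2, x = g⁻¹ • y ∧ Reach {x | x ∈ hullList gens} y g := by
        intro v
        induction v with
        | nil => intro y hy; simp [verts] at hy
        | cons c v ih =>
          intro y hy hS
          have h1 : Reach {x | x ∈ hullList gens} y (letterVal c) :=
            ⟨[c], by rw [mk_cons, ← FreeGroup.one_eq_mk, mul_one], by
              intro z hz
              refine hS z ?_
              simp only [verts, List.mem_singleton] at hz
              rw [hz]; exact List.mem_cons_self⟩
          rcases List.mem_cons.1 hy with hy | hy
          · exact ⟨letterVal c, hy, h1⟩
          · obtain ⟨g, hg, hr⟩ := ih _ hy fun z hz => hS z (List.mem_cons_of_mem _ hz)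
            exact ⟨letterVal c * g, by rw [hg, mul_inv_rev, mul_smul], h1.mul hr⟩
      exact this w x₀ hx (hgen w hw)
  · intro h hh
    rw [hx₀, inv_smul_base_iff] at hh
    have hfix : ∀ g ∈ fgSubgroup gens, g⁻¹ • x₀ = x₀ := fun g hg =>
      (inv_smul_base_iff _ g).2 hg
    induction hh using Subgroup.closure_induction with
    | mem g hg =>
      obtain ⟨w, hw, rfl⟩ := hg
      exact ⟨w, rfl, hgen w hw⟩
    | one => exact Reach.one _ _
    | mul g g' hg hg' ih ih' =>
      refine ih.mul ?_
      rwa [hfix g hg]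
    | inv g hg ih =>
      have := ih.inv hbase
      rwa [hfix g hg] at this

/-- Names for the points of the hull. -/
theorem exists_enum_hull (gens : List Word) {q : ℕ} (hq : gens.flatten.length < q) :
    ∃ (e : Fin q → F2 ⧸ fgSubgroup gens) (i₀ : Fin q), e i₀ = ((1 : F2) : F2 ⧸ fgSubgroup gens) ∧
      IsHull (Set.range e) ((1 : F2) : F2 ⧸ fgSubgroup gens) := by
  have hlen := length_hullList gens
  have hS := isHull_hullList gens
  set x₀ : F2 ⧸ fgSubgroup gens := ((1 : F2) : F2 ⧸ fgSubgroup gens) with hx₀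
  refine ⟨fun i => (hullList gens).getD i x₀, ⟨0, by omega⟩, rfl, ?_⟩
  convert hS using 1
  ext x
  constructor
  · rintro ⟨i, rfl⟩
    change (hullList gens).getD i x₀ ∈ hullList gens
    by_cases hi : (i : ℕ) < (hullList gens).length
    · rw [List.getD_eq_getElem _ _ hi]
      exact List.getElem_mem _
    · rw [List.getD_eq_default _ _ (not_lt.1 hi)]
      exact hS.base
  · intro hx
    obtain ⟨n, hn, rfl⟩ := List.getElem_of_mem hx
    exact ⟨⟨n, by omega⟩, List.getD_eq_getElem _ _ hn⟩

/-! ### Languages with finitely many residuals -/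

/-- The words over `A` satisfying `P` form a language whose residuals `{z | P (w ++ z)}` are
determined by an element of `σ` depending on `w`.  For finite `σ` this means that the language is
regular. -/
def Recog {A : Type*} (P : List A → Prop) (σ : Type*) : Prop :=
  ∃ f : List A → σ, ∀ w w', f w = f w' → ∀ z, P (w ++ z) ↔ P (w' ++ z)

namespace Recog

variable {A B σ τ : Type*} {P Q : List A → Prop}

theorem congr (h : Recog P σ) (hPQ : ∀ w, P w ↔ Q w) : Recog Q σ := by
  obtain ⟨f, hf⟩ := h
  exact ⟨f, fun w w' hw z => by rw [← hPQ, ← hPQ]; exact hf w w' hw z⟩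

theorem and (hP : Recog P σ) (hQ : Recog Q τ) : Recog (fun w => P w ∧ Q w) (σ × τ) := by
  obtain ⟨f, hf⟩ := hP
  obtain ⟨g, hg⟩ := hQ
  refine ⟨fun w => (f w, g w), fun w w' h z => ?_⟩
  obtain ⟨h1, h2⟩ := Prod.mk.inj h
  exact and_congr (hf w w' h1 z) (hg w w' h2 z)

theorem forall' {ι : Type*} {P : ι → List A → Prop} (h : ∀ i, Recog (P i) σ) :
    Recog (fun w => ∀ i, P i w) (ι → σ) := by
  choose f hf using h
  exact ⟨fun w i => f i w, fun w w' hw z => forall_congr' fun i => hf i w w' (congrFun hw i) z⟩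

theorem embedding (h : Recog P σ) (e : σ ↪ τ) : Recog P τ := by
  obtain ⟨f, hf⟩ := h
  exact ⟨fun w => e (f w), fun w w' hw => hf w w' (e.injective hw)⟩

theorem flatMap (h : Recog P σ) (d : B → List A) : Recog (fun w => P (w.flatMap d)) σ := by
  obtain ⟨f, hf⟩ := h
  refine ⟨fun w => f (w.flatMap d), fun w w' hw z => ?_⟩
  simp only [List.flatMap_append]
  exact hf _ _ hw _

/-- The reversed language has at most `2 ^ n` residuals, if the language has `n`. -/
theorem reverse (h : Recog P σ) : Recog (fun w => P w.reverse) (Set σ) := by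
  obtain ⟨f, hf⟩ := h
  have key : ∀ w z : List A, P (z ++ w.reverse) ↔
      f z ∈ {c | ∃ z', f z' = c ∧ P (z' ++ w.reverse)} := by
    intro w z
    refine ⟨fun h => ⟨z, rfl, h⟩, ?_⟩
    rintro ⟨z', hz', h⟩
    exact (hf z' z hz' _).1 h
  refine ⟨fun w => {c | ∃ z', f z' = c ∧ P (z' ++ w.reverse)}, fun w w' hw z => ?_⟩
  dsimp only at hw ⊢
  rw [List.reverse_append, List.reverse_append, key, key, hw]

theorem const (p : Prop) [Nonempty σ] : Recog (fun _ : List A => p) σ :=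
  ⟨fun _ => Classical.arbitrary σ, fun _ _ _ _ => Iff.rfl⟩

/-- A deterministic automaton whose states are described by `code` up to a change that neither the
transitions nor acceptance notice. -/
theorem of_foldl {S T : Type*} (step : A → S → S) (s₀ : S) (ty : S → T) (stepT : A → T → T)
    (hstep : ∀ a s, ty (step a s) = stepT a (ty s)) (code : T → σ)
    (hcode : ∀ w w' : List A, code (ty (w.foldl (fun s a => step a s) s₀)) =
      code (ty (w'.foldl (fun s a => step a s) s₀)) →
      ty (w.foldl (fun s a => step a s) s₀) = ty (w'.foldl (fun s a => step a s) s₀))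
    (acc : T → Prop) (hP : ∀ w, P w ↔ acc (ty (w.foldl (fun s a => step a s) s₀))) :
    Recog P σ := by
  have hfold : ∀ (w : List A) (s : S), ty (w.foldl (fun s a => step a s) s) =
      w.foldl (fun t a => stepT a t) (ty s) := by
    intro w
    induction w with
    | nil => intro s; rfl
    | cons a w ih => intro s; rw [List.foldl_cons, ih, hstep]; rfl
  refine ⟨fun w => code (ty (w.foldl (fun s a => step a s) s₀)), fun w w' hw z => ?_⟩
  rw [hP, hP, List.foldl_append, List.foldl_append, hfold z, hfold z, hcode w w' hw]

end Recog

/-- Descriptions of lists of at most `N` lists of length at most `N`, with entries the types of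
signed items on `N` points. -/
abbrev StateCode (N : ℕ) : Type := Fin N → Option (Fin N → Option (Item (Cls N) × Bool))

/-- The description of a tuple of types of decorated words. -/
def stateCode (N : ℕ) (Ds : List (Deco (Cls N))) : StateCode N :=
  fun i => (Ds[(i : ℕ)]?).map fun D j => D[(j : ℕ)]?

theorem stateCode_inj {N : ℕ} {Ds Ds' : List (Deco (Cls N))} (h : Ds.length ≤ N)
    (h' : Ds'.length ≤ N) (hD : ∀ D ∈ Ds, D.length ≤ N) (hD' : ∀ D ∈ Ds', D.length ≤ N)
    (heq : stateCode N Ds = stateCode N Ds') : Ds = Ds' := by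
  have key : ∀ {β : Type} {l l' : List β}, l.length ≤ N → l'.length ≤ N →
      (∀ j : ℕ, j < N → l[j]? = l'[j]?) → l = l' := by
    intro β l l' hl hl' hj
    refine List.ext_getElem? fun j => ?_
    rcases lt_or_ge j N with hjN | hjN
    · exact hj j hjN
    · rw [List.getElem?_eq_none (hl.trans hjN), List.getElem?_eq_none (hl'.trans hjN)]
  refine key h h' fun i hi => ?_
  have h1 := congrFun heq ⟨i, hi⟩
  simp only [stateCode] at h1
  cases ha : Ds[i]? with
  | none =>
    rw [ha] at h1
    cases hb : Ds'[i]? with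
    | none => rfl
    | some D' => rw [hb] at h1; simp at h1
  | some D =>
    rw [ha] at h1
    cases hb : Ds'[i]? with
    | none => rw [hb] at h1; simp at h1
    | some D' =>
      rw [hb] at h1
      simp only [Option.map_some, Option.some.injEq] at h1
      rw [key (hD D (List.mem_of_getElem? ha)) (hD' D' (List.mem_of_getElem? hb))
        fun j hj => congrFun h1 ⟨j, hj⟩]

theorem foldl_bounded {N : ℕ} (step : Gen → List (Deco (List (Fin 2))) → List (Deco (List (Fin 2))))
    (h1 : ∀ g Ds, (step g Ds).length = Ds.length)
    (h2 : ∀ g Ds, (∀ D ∈ Ds, List.length D ≤ N) → ∀ D ∈ step g Ds, List.length D ≤ N)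
    (w : List Gen) (Ds : List (Deco (List (Fin 2)))) (hl : Ds.length ≤ N)
    (hD : ∀ D ∈ Ds, List.length D ≤ N) :
    (w.foldl (fun Ds g => step g Ds) Ds).length ≤ N ∧
      ∀ D ∈ w.foldl (fun Ds g => step g Ds) Ds, List.length D ≤ N := by
  induction w generalizing Ds with
  | nil => exact ⟨hl, hD⟩
  | cons g w ih => exact ih _ (by rwa [h1]) (h2 g Ds hD)

/-- An operation on tuples of decorated words that respects classes, and preserves bounds for the
number and the lengths of the words, is a finite automaton on the tuples of types. -/
theorem recog_of_step {N : ℕ} {P : List Gen → Prop}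
    (step : ∀ {α : Type} [Holes α], Gen → List (Deco α) → List (Deco α))
    (h1 : ∀ g (Ds : List (Deco (List (Fin 2)))), (step g Ds).length = Ds.length)
    (h2 : ∀ g (Ds : List (Deco (List (Fin 2)))), (∀ D ∈ Ds, List.length D ≤ N) →
      ∀ D ∈ step g Ds, List.length D ≤ N)
    (hcls : ∀ g (Ds : List (Deco (List (Fin 2)))),
      (step g Ds).map (Deco.cls N) = step g (Ds.map (Deco.cls N)))
    (Ds : List (Deco (List (Fin 2)))) (hl : Ds.length ≤ N) (hD : ∀ D ∈ Ds, List.length D ≤ N)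
    (acc : List (Deco (Cls N)) → Prop)
    (hP : ∀ w, P w ↔ acc ((w.foldl (fun Ds g => step g Ds) Ds).map (Deco.cls N))) :
    Recog P (StateCode N) := by
  refine Recog.of_foldl (S := List (Deco (List (Fin 2)))) step Ds
    (fun Ds => Ds.map (Deco.cls N)) step hcls (stateCode N) ?_ acc hP
  intro w w' h
  have hb := fun w => foldl_bounded (N := N) step h1 h2 w Ds hl hD
  have hlen : ∀ (Es : List (Deco (List (Fin 2)))), (∀ D ∈ Es, List.length D ≤ N) →
      ∀ D ∈ Es.map (Deco.cls N), List.length D ≤ N := by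
    intro Es h D hD
    obtain ⟨D, hD₁, rfl⟩ := List.mem_map.1 hD
    simpa [Deco.cls] using h D hD₁
  exact stateCode_inj (by simpa using (hb w).1) (by simpa using (hb w').1)
    (hlen _ (hb w).2) (hlen _ (hb w').2) h

theorem length_stepFix {α : Type} [Holes α] (g : Gen) (Ds : List (Deco α)) :
    (stepFix g Ds).length = Ds.length := by simp [stepFix]

theorem length_stepConj {α : Type} [Holes α] (g : Gen) (Ds : List (Deco α)) :
    (stepConj g Ds).length = Ds.length := by
  cases g
  · simp only [stepConj]; split_ifs <;> simp
  · simp [stepConj]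
  · simp [stepConj]

theorem le_of_mem_stepFix {α : Type} [Holes α] {N : ℕ} (g : Gen) (Ds : List (Deco α))
    (h : ∀ D ∈ Ds, List.length D ≤ N) : ∀ D ∈ stepFix g Ds, List.length D ≤ N := by
  intro D hD
  obtain ⟨D, hD₁, rfl⟩ := List.mem_map.1 hD
  exact (Deco.length_step g D).trans (h D hD₁)

theorem le_of_mem_stepConj {α : Type} [Holes α] {N : ℕ} (g : Gen) (Ds : List (Deco α))
    (h : ∀ D ∈ Ds, List.length D ≤ N) : ∀ D ∈ stepConj g Ds, List.length D ≤ N := by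
  have hmap : ∀ f : Deco α → Deco α, (∀ D, List.length (f D) ≤ List.length D) →
      ∀ D ∈ Ds.map f, List.length D ≤ N := by
    intro f hf D hD
    obtain ⟨D, hD₁, rfl⟩ := List.mem_map.1 hD
    exact (hf D).trans (h D hD₁)
  cases g
  · simp only [stepConj]
    split_ifs
    · exact hmap _ Deco.length_stepL'
    · exact hmap _ (Deco.length_step .L)
  · exact hmap _ (Deco.length_step .E)
  · exact hmap _ (Deco.length_step .I)

/-- Whether all elements of a tuple fix a point of the hull can be read off from the types. -/
theorem loops_iff {N : ℕ} {X : Type*} [MulAction F2 X] {e : Fin N → X} {x₀ : X}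
    (hS : IsHull (Set.range e) x₀) (i : Fin N) {Ds : List (Deco (List (Fin 2)))}
    (h : ∀ D ∈ Ds, FreeGroup.IsReduced D.flat) :
    (∀ g ∈ vals Ds, g⁻¹ • e i = e i) ↔
      ∀ D ∈ Ds.map (Deco.cls N), decoRel (stepRel e) D i i := by
  simp only [vals, List.mem_map, forall_exists_index, and_imp, forall_apply_eq_imp_iff₂,
    decoRel_cls]
  exact forall₂_congr fun D hD => hS.loop_iff (h D hD) i

/-- The automorphisms mapping given elements into a finitely generated subgroup form a regular
language. -/
theorem recog_mem {N : ℕ} (us gens : List Word) (h1 : us.length ≤ N)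
    (h2 : ∀ u ∈ us, u.length ≤ N) (h3 : gens.flatten.length < N) :
    Recog (fun w => ∀ u ∈ us, autW w (FreeGroup.mk u) ∈ fgSubgroup gens) (StateCode N) := by
  obtain ⟨e, i₀, he, hS⟩ := exists_enum_hull gens h3
  refine recog_of_step (fun {α} _ => stepFix) length_stepFix le_of_mem_stepFix (stepFix_cls N)
    (us.map fun u => toDeco (FreeGroup.reduce u)) (by simpa using h1) ?_
    (fun Ds => ∀ D ∈ Ds, decoRel (stepRel e) D i₀ i₀) ?_
  · intro D hD
    obtain ⟨u, hu, rfl⟩ := List.mem_map.1 hD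
    rw [toDeco, List.length_map]
    exact (FreeGroup.reduce.red.length_le).trans (h2 u hu)
  · intro w
    obtain ⟨hr, hv⟩ := foldl_stepFix w (us.map fun u => toDeco (FreeGroup.reduce u)) (by
      intro D hD
      obtain ⟨u, hu, rfl⟩ := List.mem_map.1 hD
      rw [flat_toDeco, FreeGroup.isReduced_iff_reduce_eq, FreeGroup.reduce.idem])
    rw [← loops_iff hS i₀ hr, hv, he]
    simp only [vals, List.mem_map, forall_exists_index, and_imp, forall_apply_eq_imp_iff₂,
      flat_toDeco, FreeGroup.reduce.self, inv_smul_base_iff]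

/-- A subgroup conjugate to `H` corresponds to a point of the coset graph.  As the first word stays
cyclically reduced, only the points of the hull matter. -/
theorem recog_conj_of_cycRed {N : ℕ} (v : Word) (hv : CycRed v) (us gens : List Word)
    (h1 : us.length + 1 ≤ N) (h2 : ∀ u ∈ v :: us, u.length ≤ N) (h3 : gens.flatten.length < N) :
    Recog (fun w => ∃ x : F2, ∀ u ∈ v :: us,
      x⁻¹ * autW w (FreeGroup.mk u) * x ∈ fgSubgroup gens) (StateCode N) := by
  obtain ⟨e, i₀, he, hS⟩ := exists_enum_hull gens h3
  have hvr := hv.isReduced.reduce_eq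
  have hinv : ConjInv ((v :: us).map fun u => toDeco (FreeGroup.reduce u)) := by
    refine ⟨?_, _, rfl, ?_⟩
    · intro D hD
      obtain ⟨u, hu, rfl⟩ := List.mem_map.1 hD
      rw [flat_toDeco, FreeGroup.isReduced_iff_reduce_eq, FreeGroup.reduce.idem]
    · rwa [flat_toDeco, hvr]
  refine recog_of_step (fun {α} _ => stepConj) length_stepConj le_of_mem_stepConj (stepConj_cls N)
    ((v :: us).map fun u => toDeco (FreeGroup.reduce u)) (by simpa using h1) ?_
    (fun Ds => ∃ i, ∀ D ∈ Ds, decoRel (stepRel e) D i i) ?_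
  · intro D hD
    obtain ⟨u, hu, rfl⟩ := List.mem_map.1 hD
    rw [toDeco, List.length_map]
    exact (FreeGroup.reduce.red.length_le).trans (h2 u hu)
  · intro w
    obtain ⟨⟨hr, D, hD, hDc⟩, t, hw⟩ := foldl_stepConj w hinv
    simp only [← loops_iff hS _ hr]
    have hval : ∀ x : F2, (∀ u ∈ v :: us, x⁻¹ * autW w (FreeGroup.mk u) * x ∈ fgSubgroup gens) ↔
        ∀ g ∈ (vals ((v :: us).map fun u => toDeco (FreeGroup.reduce u))).map
          (fun u => t * autW w u * t⁻¹), g⁻¹ • ((t * x : F2) : F2 ⧸ fgSubgroup gens) =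
            ((t * x : F2) : F2 ⧸ fgSubgroup gens) := by
      intro x
      simp only [vals, List.mem_map, forall_exists_index, and_imp, forall_apply_eq_imp_iff₂,
        flat_toDeco, FreeGroup.reduce.self]
      refine forall₂_congr fun u _ => ?_
      rw [MulAction.Quotient.smul_mk, QuotientGroup.eq]
      have : ((t * autW w (FreeGroup.mk u) * t⁻¹)⁻¹ • (t * x))⁻¹ * (t * x) =
          x⁻¹ * autW w (FreeGroup.mk u) * x := by
        simp only [smul_eq_mul]; group
      rw [this]
    constructor
    · rintro ⟨x, hx⟩
      have hx := (hval x).1 hx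
      rw [← hw] at hx
      have hmem : ((t * x : F2) : F2 ⧸ fgSubgroup gens) ∈ Set.range e := by
        refine hS.mem_of_cycRed hDc (t := (t * x)⁻¹) ?_ (hx _ ?_)
        · rw [inv_inv, MulAction.Quotient.smul_mk, smul_eq_mul, mul_one]
        · exact List.mem_map.2 ⟨D, List.mem_of_mem_head? hD, rfl⟩
      obtain ⟨i, hi⟩ := hmem
      exact ⟨i, by rwa [hi]⟩
    · rintro ⟨i, hi⟩
      obtain ⟨y, hy⟩ := QuotientGroup.mk_surjective (e i)
      refine ⟨t⁻¹ * y, (hval _).2 ?_⟩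
      rw [← hw, mul_inv_cancel_left]
      rw [← hy] at hi
      exact hi

theorem length_le_of_mem {us : List Word} {u : Word} (hu : u ∈ us) :
    u.length ≤ us.flatten.length := by
  rw [List.length_flatten]
  exact List.single_le_sum (by simp) _ (List.mem_map_of_mem hu)

/-- A nontrivial element is a conjugate of the value of a cyclically reduced word. -/
theorem exists_cycRed_conj {u : Word} (hne : (FreeGroup.mk u : F2) ≠ 1) :
    ∃ c v : Word, CycRed v ∧
      (FreeGroup.mk u : F2) = FreeGroup.mk c * FreeGroup.mk v * (FreeGroup.mk c)⁻¹ ∧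
      c.length + v.length + c.length ≤ u.length := by
  set L := FreeGroup.reduce u with hL
  have hLr : FreeGroup.IsReduced L := by
    rw [FreeGroup.isReduced_iff_reduce_eq, FreeGroup.reduce.idem]
  set v := FreeGroup.reduceCyclically L with hv
  set c := FreeGroup.reduceCyclically.conjugator L with hc
  have hL' : c ++ v ++ FreeGroup.invRev c = L := by
    rw [FreeGroup.reduceCyclically.conj_conjugator_reduceCyclically]
  have hmk : (FreeGroup.mk u : F2) = FreeGroup.mk c * FreeGroup.mk v * (FreeGroup.mk c)⁻¹ := by
    rw [← FreeGroup.reduce.self (L := u), ← hL, ← hL', mk_append, mk_append, FreeGroup.inv_mk]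
  refine ⟨c, v, ⟨?_, ?_⟩, hmk, ?_⟩
  · intro h0
    exact hne (by rw [hmk, h0, ← FreeGroup.one_eq_mk, mul_one, mul_inv_cancel])
  · have h := FreeGroup.reduceCyclically.isCyclicallyReduced hLr
    rw [← hv] at h
    rw [FreeGroup.IsReduced, List.isChain_append]
    exact ⟨h.1, h.1, h.2⟩
  · have := congrArg List.length hL'
    rw [List.length_append, List.length_append, FreeGroup.invRev_length] at this
    rw [this]
    exact FreeGroup.reduce.red.length_le

/-- The automorphisms mapping given elements into one conjugate of a finitely generated subgroup
form a regular language. -/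
theorem recog_conj {N : ℕ} (us gens : List Word)
    (h1 : us.length + 1 ≤ N) (h2 : 3 * us.flatten.length ≤ N) (h3 : gens.flatten.length < N) :
    Recog (fun w => ∃ x : F2, ∀ u ∈ us,
      x⁻¹ * autW w (FreeGroup.mk u) * x ∈ fgSubgroup gens) (StateCode N) := by
  have hle : ∀ u ∈ us, u.length ≤ us.flatten.length := fun u hu => length_le_of_mem hu
  by_cases hone : ∀ u ∈ us, (FreeGroup.mk u : F2) = 1
  · refine (Recog.const True).congr fun w => ⟨fun _ => ⟨1, fun u hu => ?_⟩, fun _ => trivial⟩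
    simp [hone u hu]
  · push Not at hone
    obtain ⟨u₁, hu₁, hne⟩ := hone
    obtain ⟨c, v, hvc, hmk, hlen⟩ := exists_cycRed_conj hne
    have hu₁len := hle u₁ hu₁
    -- conjugating by `c` makes a nontrivial element cyclically reduced; every word gets longer by
    -- at most `2 * c.length`, hence the factor `3` in the bound
    refine (recog_conj_of_cycRed (N := N) v hvc
      (us.map fun u => FreeGroup.invRev c ++ u ++ c) gens (by simpa using h1) ?_ h3).congr ?_
    · intro u hu
      rcases List.mem_cons.1 hu with rfl | hu
      · omega
      · obtain ⟨u', hu', rfl⟩ := List.mem_map.1 hu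
        have := hle u' hu'
        simp only [List.length_append, FreeGroup.invRev_length]
        omega
    · intro w
      have key : ∀ (x : F2) (u : Word),
          x⁻¹ * autW w (FreeGroup.mk (FreeGroup.invRev c ++ u ++ c)) * x =
            (autW w (FreeGroup.mk c) * x)⁻¹ * autW w (FreeGroup.mk u) *
            (autW w (FreeGroup.mk c) * x) := by
        intro x u
        rw [mk_append, mk_append, ← FreeGroup.inv_mk, map_mul, map_mul, map_inv]
        group
      have key' : ∀ x : F2, x⁻¹ * autW w (FreeGroup.mk v) * x =
          (autW w (FreeGroup.mk c) * x)⁻¹ * autW w (FreeGroup.mk u₁) *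
            (autW w (FreeGroup.mk c) * x) := by
        intro x
        rw [hmk, map_mul, map_mul, map_inv]
        group
      simp only [List.forall_mem_cons, List.forall_mem_map, key, key']
      constructor
      · rintro ⟨x, -, h⟩
        exact ⟨_, h⟩
      · rintro ⟨y, h⟩
        refine ⟨(autW w (FreeGroup.mk c))⁻¹ * y, ?_⟩
        rw [mul_inv_cancel_left]
        exact ⟨h u₁ hu₁, h⟩

/-! ### The involution exchanging automorphisms and inverses -/

/-- The automorphism `a ↦ a`, `b ↦ b⁻¹`. -/
def iota : MulAut F2 :=
  MonoidHom.toMulEquiv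
    (FreeGroup.lift ![FreeGroup.of 0, (FreeGroup.of 1)⁻¹])
    (FreeGroup.lift ![FreeGroup.of 0, (FreeGroup.of 1)⁻¹])
    (by ext i; fin_cases i <;> simp) (by ext i; fin_cases i <;> simp)

@[simp] theorem iota_zero : iota (FreeGroup.of 0) = FreeGroup.of 0 := by simp [iota]
@[simp] theorem iota_one : iota (FreeGroup.of 1) = (FreeGroup.of 1)⁻¹ := by simp [iota]

theorem mulAut_ext {φ ψ : MulAut F2} (h0 : φ (FreeGroup.of 0) = ψ (FreeGroup.of 0))
    (h1 : φ (FreeGroup.of 1) = ψ (FreeGroup.of 1)) : φ = ψ := by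
  have : φ.toMonoidHom = ψ.toMonoidHom := by
    apply FreeGroup.ext_hom
    intro i
    rcases two_letters i with rfl | rfl
    · exact h0
    · exact h1
  ext1 x
  exact DFunLike.congr_fun this x

@[simp] theorem iota_mul_iota : iota * iota = 1 := mulAut_ext (by simp) (by simp)

@[simp] theorem iota_iota (x : F2) : iota (iota x) = x := DFunLike.congr_fun iota_mul_iota x

/-- The word obtained by exchanging `b` and `b⁻¹`. -/
def flipB (w : Word) : Word := w.map fun x => (x.1, if x.1 = 0 then x.2 else !x.2)

@[simp] theorem length_flipB (w : Word) : (flipB w).length = w.length := by simp [flipB]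

@[simp] theorem mk_flipB (w : Word) : (FreeGroup.mk (flipB w) : F2) = iota (FreeGroup.mk w) := by
  induction w with
  | nil => simp [flipB, ← FreeGroup.one_eq_mk]
  | cons x w ih =>
    rw [flipB] at ih ⊢
    rw [List.map_cons, mk_cons, mk_cons, map_mul, ih]
    obtain ⟨c, s⟩ := x
    rcases two_letters c with rfl | rfl <;> cases s <;> simp [letterVal]

theorem mem_fgSubgroup_flipB (gens : List Word) (x : F2) :
    x ∈ fgSubgroup (gens.map flipB) ↔ iota x ∈ fgSubgroup gens := by
  have h : fgSubgroup (gens.map flipB) = (fgSubgroup gens).map iota.toMonoidHom := by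
    rw [fgSubgroup, fgSubgroup, MonoidHom.map_closure]
    congr 1
    ext y
    constructor
    · rintro ⟨w, hw, rfl⟩
      obtain ⟨w', hw', rfl⟩ := List.mem_map.1 hw
      exact ⟨_, ⟨w', hw', rfl⟩, (mk_flipB w').symm⟩
    · rintro ⟨_, ⟨w, hw, rfl⟩, rfl⟩
      exact ⟨flipB w, List.mem_map_of_mem hw, (mk_flipB w).symm⟩
  rw [h]
  constructor
  · rintro ⟨y, hy, rfl⟩
    simpa using hy
  · intro hx
    exact ⟨iota x, hx, by simp⟩

/-- The word of generators for the conjugate by `iota` of the inverse of a generator. -/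
def Gen.dual : Gen → List Gen
  | .L => [.L]
  | .E => [.I, .E]
  | .I => [.I]

theorem autW_dual (g : Gen) : autW g.dual = iota * g.aut⁻¹ * iota := by
  have h : ∀ φ ψ : MulAut F2, φ * (iota * ψ) = iota → φ = iota * ψ⁻¹ * iota := by
    intro φ ψ h
    have h1 : φ = iota * (iota * ψ)⁻¹ := eq_mul_inv_of_mul_eq h
    have h2 : iota⁻¹ = iota := inv_eq_of_mul_eq_one_left iota_mul_iota
    rw [h1, mul_inv_rev, h2, mul_assoc]
  cases g <;> refine h _ _ (mulAut_ext ?_ ?_) <;> simp [Gen.dual, Gen.aut, autW]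

theorem autW_reverse_dual (w : List Gen) :
    autW (w.reverse.flatMap Gen.dual) = iota * (autW w)⁻¹ * iota := by
  induction w with
  | nil => simp [autW]
  | cons g w ih =>
    rw [List.reverse_cons, List.flatMap_append, autW_append, ih]
    simp only [List.flatMap_cons, List.flatMap_nil, List.append_nil, autW_dual, autW, mul_inv_rev]
    have : iota * g.aut⁻¹ * iota * (iota * (autW w)⁻¹ * iota) =
        iota * g.aut⁻¹ * (iota * iota) * (autW w)⁻¹ * iota := by group
    rw [this, iota_mul_iota, mul_one, mul_assoc iota]

theorem flatten_length_map_flipB (us : List Word) :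
    (us.map flipB).flatten.length = us.flatten.length := by
  simp [List.length_flatten, Function.comp_def]

/-- The automorphisms whose inverses map given elements into a finitely generated subgroup form
a regular language. -/
theorem recog_inv_mem {N : ℕ} (us gens : List Word) (h1 : us.length ≤ N)
    (h2 : ∀ u ∈ us, u.length ≤ N) (h3 : gens.flatten.length < N) :
    Recog (fun w => ∀ u ∈ us, (autW w)⁻¹ (FreeGroup.mk u) ∈ fgSubgroup gens)
      (Set (StateCode N)) := by
  refine ((recog_mem (N := N) (us.map flipB) (gens.map flipB) (by simpa using h1) ?_
    (by rwa [flatten_length_map_flipB])).flatMap Gen.dual).reverse.congr fun w => ?_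
  · intro u hu
    obtain ⟨u', hu', rfl⟩ := List.mem_map.1 hu
    rw [length_flipB]; exact h2 u' hu'
  · simp only [autW_reverse_dual, List.forall_mem_map, mem_fgSubgroup_flipB, mk_flipB,
      MulAut.mul_apply, iota_iota]

/-- The automorphisms whose inverses map given elements into one conjugate of a finitely generated
subgroup form a regular language. -/
theorem recog_inv_conj {N : ℕ} (us gens : List Word)
    (h1 : us.length + 1 ≤ N) (h2 : 3 * us.flatten.length ≤ N) (h3 : gens.flatten.length < N) :
    Recog (fun w => ∃ x : F2, ∀ u ∈ us,
      x⁻¹ * (autW w)⁻¹ (FreeGroup.mk u) * x ∈ fgSubgroup gens) (Set (StateCode N)) := by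
  refine ((recog_conj (N := N) (us.map flipB) (gens.map flipB) (by simpa using h1)
    (by rwa [flatten_length_map_flipB])
    (by rwa [flatten_length_map_flipB])).flatMap Gen.dual).reverse.congr fun w => ?_
  simp only [autW_reverse_dual, List.forall_mem_map, mem_fgSubgroup_flipB, mk_flipB,
    MulAut.mul_apply, iota_iota, map_mul, map_inv]
  constructor
  · rintro ⟨x, h⟩
    exact ⟨iota x, h⟩
  · rintro ⟨x, h⟩
    exact ⟨iota x, by simpa using h⟩

/-! ### Permutation representations separating a finitely generated subgroup from an element -/

theorem fgSubgroup_le_iff {gens : List Word} {K : Subgroup F2} :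
    fgSubgroup gens ≤ K ↔ ∀ w ∈ gens, FreeGroup.mk w ∈ K := by
  rw [fgSubgroup, Subgroup.closure_le]
  constructor
  · intro h w hw
    exact h ⟨w, hw, rfl⟩
  · rintro h _ ⟨w, hw, rfl⟩
    exact h w hw

theorem mk_mem_fgSubgroup {gens : List Word} {w : Word} (hw : w ∈ gens) :
    FreeGroup.mk w ∈ fgSubgroup gens :=
  Subgroup.subset_closure ⟨w, hw, rfl⟩

/-- A partial action of `F2` on a finite set of points extends to an action. -/
theorem exists_perm_extending {X : Type*} [MulAction F2 X] (S : Finset X) :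
    ∃ ρ : F2 →* Equiv.Perm S, ∀ (w : Word) (x : S), (∀ z ∈ verts (x : X) w, z ∈ S) →
      (((ρ (FreeGroup.mk w))⁻¹ x : S) : X) = (FreeGroup.mk w : F2)⁻¹ • (x : X) := by
  classical
  have hext : ∀ c : Fin 2, ∃ σ : Equiv.Perm S, ∀ x : S,
      FreeGroup.of c • (x : X) ∈ S → ((σ x : S) : X) = FreeGroup.of c • (x : X) := by
    intro c
    obtain ⟨σ, hσ⟩ := Finset.exists_equiv_extend_of_card_eq (α := S) (t := S) (by simp)
      (s := Finset.univ.filter fun x : S => FreeGroup.of c • (x : X) ∈ S)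
      (f := fun x : S => FreeGroup.of c • (x : X))
      (by
        intro z hz
        obtain ⟨x, hx, rfl⟩ := Finset.mem_image.1 hz
        exact (Finset.mem_filter.1 hx).2)
      (fun x _ y _ h => Subtype.ext (MulAction.injective _ h))
    exact ⟨σ, fun x hx => hσ x (Finset.mem_filter.2 ⟨Finset.mem_univ _, hx⟩)⟩
  choose σ hσ using hext
  refine ⟨FreeGroup.lift σ, fun w => ?_⟩
  induction w with
  | nil => intro x _; simp [← FreeGroup.one_eq_mk]
  | cons y w ih =>
    intro x hx
    obtain ⟨c, s⟩ := y
    simp only [verts, List.forall_mem_cons] at hx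
    rw [mk_cons, map_mul, mul_inv_rev, mul_inv_rev, Equiv.Perm.mul_apply, mul_smul]
    have key : (((FreeGroup.lift σ (letterVal (c, s)))⁻¹ x : S) : X) =
        (letterVal (c, s))⁻¹ • (x : X) := by
      cases s
      · have h1 := hx.1
        simp only [letterVal, Bool.false_eq_true, if_false, inv_inv, map_inv,
          FreeGroup.lift_apply_of] at h1 ⊢
        exact hσ c x h1
      · have h1 := hx.1
        simp only [letterVal, if_true, FreeGroup.lift_apply_of] at h1 ⊢
        have h2 := hσ c ⟨_, h1⟩ (by simp)
        rw [smul_inv_smul] at h2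
        have h3 : (σ c)⁻¹ x = ⟨_, h1⟩ := Equiv.Perm.inv_eq_iff_eq.2 (Subtype.ext h2).symm
        rw [h3]
    rw [ih _ (by rw [key]; exact hx.2), key]

/-- Marshall Hall's theorem with a bound: an element outside a finitely generated subgroup `H` is
separated from `H` by the stabilizer of a point in an action on few points. -/
theorem exists_perm_of_notMem {gens : List Word} {u : Word}
    (h : FreeGroup.mk u ∉ fgSubgroup gens) :
    ∃ k ≤ gens.flatten.length + u.length + 1, ∃ (ρ : F2 →* Equiv.Perm (Fin k)) (v : Fin k),
      (∀ w ∈ gens, ρ (FreeGroup.mk w) v = v) ∧ ρ (FreeGroup.mk u) v ≠ v := by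
  classical
  set x₀ : F2 ⧸ fgSubgroup gens := ((1 : F2) : F2 ⧸ fgSubgroup gens) with hx₀
  set S : Finset (F2 ⧸ fgSubgroup gens) := (hullList gens ++ verts x₀ u).toFinset with hS
  have hcard : S.card ≤ gens.flatten.length + u.length + 1 := by
    refine (List.toFinset_card_le _).trans ?_
    rw [List.length_append, length_hullList, length_verts]
    omega
  have h0 : x₀ ∈ S := by simp [hS, hullList, hx₀]
  obtain ⟨ρ, hρ⟩ := exists_perm_extending S
  let e : S ≃ Fin S.card := S.equivFin
  have key : ∀ w : Word, (∀ z ∈ verts x₀ w, z ∈ S) →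
      (ρ (FreeGroup.mk w) ⟨x₀, h0⟩ = ⟨x₀, h0⟩ ↔ FreeGroup.mk w ∈ fgSubgroup gens) := by
    intro w hw
    rw [← inv_smul_base_iff, ← hx₀, ← hρ w ⟨x₀, h0⟩ hw, eq_comm, ← Equiv.Perm.inv_eq_iff_eq]
    exact Subtype.ext_iff
  refine ⟨S.card, hcard, (e.permCongrHom.toMonoidHom).comp ρ, e ⟨x₀, h0⟩, ?_, ?_⟩
  · intro w hw
    have := (key w (fun z hz => ?_)).2 (mk_mem_fgSubgroup hw)
    · simp [Equiv.permCongrHom, this]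
    · simp only [hS, List.mem_toFinset]
      exact List.mem_append_left _ (List.mem_cons_of_mem _ (List.mem_flatMap.2 ⟨w, hw, hz⟩))
  · have := (key u (fun z hz => ?_)).not.2 h
    · simpa [Equiv.permCongrHom] using this
    · simp only [hS, List.mem_toFinset]
      exact List.mem_append_right _ hz

theorem mem_conjSubgroup {w x : F2} {K : Subgroup F2} :
    x ∈ conjSubgroup w K ↔ w * x * w⁻¹ ∈ K := by
  constructor
  · rintro ⟨y, hy, rfl⟩
    have : w * (w⁻¹ * y * w) * w⁻¹ = y := by group
    simpa [this] using hy
  · intro hx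
    refine ⟨_, hx, ?_⟩
    simp only [MulEquiv.coe_toMonoidHom, MulAut.conj_apply, inv_inv]
    group

/-- A finitely generated subgroup of `F2` is not conjugate to a proper subgroup of itself. -/
theorem conjSubgroup_eq_of_le {gens : List Word} {w : F2}
    (h : conjSubgroup w (fgSubgroup gens) ≤ fgSubgroup gens) :
    conjSubgroup w (fgSubgroup gens) = fgSubgroup gens := by
  refine le_antisymm h fun x hx => ?_
  rw [mem_conjSubgroup]
  by_contra hn
  rw [← FreeGroup.mk_toWord (x := w * x * w⁻¹)] at hn
  obtain ⟨k, -, ρ, v, hv, hne⟩ := exists_perm_of_notMem hn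
  rw [FreeGroup.mk_toWord] at hne
  set K := fgSubgroup gens with hK
  have hfix : ∀ y ∈ K, ρ y v = v := by
    intro y hy
    exact (fgSubgroup_le_iff (K := (MulAction.stabilizer _ v).comap ρ)).2 hv hy
  have h1 : (conjSubgroup w K).map ρ ≤ K.map ρ := Subgroup.map_mono h
  have h2 : (conjSubgroup w K).map ρ = (K.map ρ).map (MulAut.conj (ρ w)⁻¹).toMonoidHom := by
    rw [conjSubgroup, Subgroup.map_map, Subgroup.map_map]
    congr 1
    ext1 y
    simp
  have h3 : (conjSubgroup w K).map ρ = K.map ρ := by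
    refine Subgroup.eq_of_le_of_card_ge h1 ?_
    rw [h2]
    exact (Nat.card_congr ((K.map ρ).equivMapOfInjective _
      (MulAut.conj (ρ w)⁻¹).injective).toEquiv).le
  have h4 : ρ x ∈ (conjSubgroup w K).map ρ := by
    rw [h3]; exact ⟨x, hx, rfl⟩
  obtain ⟨y, hy, hyx⟩ := h4
  refine hne ?_
  rw [map_mul, map_mul, ← hyx, ← map_mul, ← map_mul]
  exact hfix _ (mem_conjSubgroup.1 hy)

/-! ### Short conjugators -/

theorem exists_prefix_of_mem_verts {X : Type*} [MulAction F2 X] {x z : X} {w : Word}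
    (hz : z ∈ verts x w) : ∃ p : Word, p.length ≤ w.length ∧ z = (FreeGroup.mk p : F2)⁻¹ • x := by
  induction w generalizing x with
  | nil => simp [verts] at hz
  | cons y w ih =>
    rcases List.mem_cons.1 hz with rfl | hz
    · exact ⟨[y], by simp, by rw [mk_cons, ← FreeGroup.one_eq_mk, mul_one]⟩
    · obtain ⟨p, hp, rfl⟩ := ih hz
      exact ⟨y :: p, by simpa using hp, by rw [mk_cons, mul_inv_rev, mul_smul]⟩

/-- A conjugator moving a nontrivial element into a finitely generated subgroup can be shortened by
an element of the subgroup. -/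
theorem exists_short_conjugator {u : Word} (hu : (FreeGroup.mk u : F2) ≠ 1) {gens : List Word}
    {w : F2} (h : w⁻¹ * FreeGroup.mk u * w ∈ fgSubgroup gens) :
    ∃ h ∈ fgSubgroup gens, ∃ w' : Word, FreeGroup.mk w' = w * h ∧
      w'.length ≤ u.length + gens.flatten.length := by
  obtain ⟨c, v, hv, hmk, hlen⟩ := exists_cycRed_conj hu
  have hhull := isHull_hullList gens
  set x₀ : F2 ⧸ fgSubgroup gens := ((1 : F2) : F2 ⧸ fgSubgroup gens) with hx₀
  have hmem := hhull.mem_of_cycRed hv (x := (w⁻¹ * FreeGroup.mk c)⁻¹ • x₀) rfl (by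
    rw [← mul_smul, ← mul_inv_rev, hx₀, MulAction.Quotient.smul_mk, MulAction.Quotient.smul_mk,
      QuotientGroup.eq]
    have : ((w⁻¹ * FreeGroup.mk c * FreeGroup.mk v)⁻¹ • (1 : F2))⁻¹ *
        (w⁻¹ * FreeGroup.mk c)⁻¹ • (1 : F2) = w⁻¹ * FreeGroup.mk u * w := by
      rw [hmk]; simp only [smul_eq_mul]; group
    rwa [this])
  have hp : ∃ p : Word, p.length ≤ gens.flatten.length ∧
      (w⁻¹ * FreeGroup.mk c)⁻¹ • x₀ = (FreeGroup.mk p : F2)⁻¹ • x₀ := by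
    rcases List.mem_cons.1 hmem with h | h
    · exact ⟨[], by simp, by rw [h, ← FreeGroup.one_eq_mk, inv_one, one_smul]⟩
    · obtain ⟨g, hg, h⟩ := List.mem_flatMap.1 h
      obtain ⟨p, hp, h⟩ := exists_prefix_of_mem_verts h
      exact ⟨p, hp.trans (length_le_of_mem hg), h⟩
  obtain ⟨p, hpl, hp⟩ := hp
  rw [hx₀, MulAction.Quotient.smul_mk, MulAction.Quotient.smul_mk, QuotientGroup.eq] at hp
  refine ⟨_, hp, c ++ FreeGroup.invRev p, ?_, ?_⟩
  · rw [mk_append, ← FreeGroup.inv_mk]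
    simp only [smul_eq_mul]
    group
  · rw [List.length_append, FreeGroup.invRev_length]
    omega

theorem conjSubgroup_mul (w h : F2) (K : Subgroup F2) :
    conjSubgroup (w * h) K = conjSubgroup h (conjSubgroup w K) := by
  ext x
  simp only [mem_conjSubgroup, mul_inv_rev, mul_assoc]

theorem conjSubgroup_of_mem {h : F2} {K : Subgroup F2} (hh : h ∈ K) : conjSubgroup h K = K := by
  ext x
  rw [mem_conjSubgroup]
  refine ⟨fun hx => ?_, fun hx => K.mul_mem (K.mul_mem hh hx) (K.inv_mem hh)⟩
  have := K.mul_mem (K.mul_mem (K.inv_mem hh) hx) hh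
  simpa [mul_assoc] using this

theorem conjSubgroup_mono {w : F2} {K L : Subgroup F2} (h : K ≤ L) :
    conjSubgroup w K ≤ conjSubgroup w L := Subgroup.map_mono h

theorem mk_eq_one_of_fgSubgroup {gens : List Word} (h : ∀ u ∈ gens, (FreeGroup.mk u : F2) = 1) :
    fgSubgroup gens = ⊥ := by
  rw [eq_bot_iff, fgSubgroup_le_iff]
  exact h

/-- A conjugator of `K` into `H` may be taken short, without changing the conjugate up to
conjugation in `H`. -/
theorem exists_short_conjugator_subgroup {K H : List Word} {w : F2}
    (h : conjSubgroup w (fgSubgroup K) ≤ fgSubgroup H) :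
    ∃ w' : Word, w'.length ≤ K.flatten.length + H.flatten.length ∧ ∃ h ∈ fgSubgroup H,
      conjSubgroup (FreeGroup.mk w') (fgSubgroup K) =
        conjSubgroup h (conjSubgroup w (fgSubgroup K)) := by
  by_cases hone : ∀ u ∈ K, (FreeGroup.mk u : F2) = 1
  · refine ⟨[], by simp, 1, one_mem _, ?_⟩
    rw [mk_eq_one_of_fgSubgroup hone]
    simp [conjSubgroup]
  · push Not at hone
    obtain ⟨u, hu, hne⟩ := hone
    have huw : w⁻¹ * FreeGroup.mk u * w ∈ fgSubgroup H := by
      refine h (mem_conjSubgroup.2 ?_)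
      have : w * (w⁻¹ * FreeGroup.mk u * w) * w⁻¹ = FreeGroup.mk u := by group
      rw [this]
      exact mk_mem_fgSubgroup hu
    obtain ⟨h', hh', w', hw', hl⟩ := exists_short_conjugator hne huw
    have := length_le_of_mem hu
    exact ⟨w', by omega, h', hh', by rw [hw', conjSubgroup_mul]⟩

/-! ### Positive words -/

/-- The positive element with given letters. -/
def pos (A : List (Fin 2)) : F2 := FreeGroup.mk (signed true A)

@[simp] theorem pos_nil : pos [] = 1 := FreeGroup.one_eq_mk.symm

@[simp] theorem pos_append (A B : List (Fin 2)) : pos (A ++ B) = pos A * pos B := by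
  rw [pos, pos, pos, ← mk_append, signed_true, List.map_append]
  rfl

@[simp] theorem pos_cons (c : Fin 2) (A : List (Fin 2)) :
    pos (c :: A) = FreeGroup.of c * pos A := by
  simp [pos, mk_cons, letterVal]

theorem isReduced_signed (s : Bool) (A : List (Fin 2)) : FreeGroup.IsReduced (signed s A) := by
  refine List.Pairwise.isChain (List.pairwise_of_forall_mem_list ?_)
  intro x hx y hy _
  cases s <;> simp only [signed_true, signed_false, List.mem_map] at hx hy <;>
    obtain ⟨_, _, rfl⟩ := hx <;> obtain ⟨_, _, rfl⟩ := hy <;> rfl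

theorem isReduced_mk_inj {v w : Word} (hv : FreeGroup.IsReduced v) (hw : FreeGroup.IsReduced w)
    (h : (FreeGroup.mk v : F2) = FreeGroup.mk w) : v = w := by
  have := congrArg FreeGroup.toWord h
  rwa [FreeGroup.toWord_mk, FreeGroup.toWord_mk, hv.reduce_eq, hw.reduce_eq] at this

theorem pos_injective : Function.Injective pos := by
  intro A B h
  have := isReduced_mk_inj (isReduced_signed true A) (isReduced_signed true B) h
  exact List.map_injective_iff.2 (fun x y h => (Prod.mk.inj h).1) this

theorem mem_positiveElements {x : F2} : x ∈ positiveElements ↔ ∃ A, x = pos A := by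
  constructor
  · intro hx
    induction hx using Submonoid.closure_induction with
    | mem x hx => obtain ⟨i, rfl⟩ := hx; exact ⟨[i], by simp⟩
    | one => exact ⟨[], by simp⟩
    | mul x y _ _ hx hy =>
      obtain ⟨A, rfl⟩ := hx
      obtain ⟨B, rfl⟩ := hy
      exact ⟨A ++ B, by simp⟩
  · rintro ⟨A, rfl⟩
    induction A with
    | nil => simp
    | cons c A ih => rw [pos_cons]; exact mul_mem (Submonoid.subset_closure ⟨c, rfl⟩) ih

theorem mem_IS {φ : MulAut F2} : φ ∈ IS ↔ ∀ i, ∃ A, φ (FreeGroup.of i) = pos A :=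
  forall_congr' fun _ => mem_positiveElements

theorem autL_pos (A : List (Fin 2)) : autL (pos A) = pos (substL A) := by
  induction A with
  | nil => simp
  | cons c A ih => rcases two_letters c with rfl | rfl <;> simp [ih, mul_assoc]

/-- The automorphism `a ↦ b * a`, `b ↦ b`. -/
def autL' : MulAut F2 := autI * autL * autI

@[simp] theorem autL'_zero : autL' (FreeGroup.of 0) = FreeGroup.of 1 * FreeGroup.of 0 := by
  simp [autL']

@[simp] theorem autL'_one : autL' (FreeGroup.of 1) = FreeGroup.of 1 := by simp [autL']

theorem autL'_pos (A : List (Fin 2)) : autL' (pos A) = pos (substL' A) := by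
  induction A with
  | nil => simp
  | cons c A ih => rcases two_letters c with rfl | rfl <;> simp [ih, mul_assoc]

theorem autE_pos (A : List (Fin 2)) : autE (pos A) = pos (A.map (· + 1)) := by
  induction A with
  | nil => simp
  | cons c A ih => simp [ih]

@[simp] theorem autE_mul_autE : autE * autE = 1 := mulAut_ext (by simp) (by simp)

/-! ### Generators of the monoid of invertible substitutions -/

/-- The submonoid generated by `a ↦ ab`, by `a ↦ ba` (both fixing `b`), and by the exchange of
`a` and `b`. -/
def stdSub : Submonoid (MulAut F2) := Submonoid.closure {autL, autL', autE}

theorem autL_mem : autL ∈ stdSub := Submonoid.subset_closure (by simp)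
theorem autL'_mem : autL' ∈ stdSub := Submonoid.subset_closure (by simp)
theorem autE_mem : autE ∈ stdSub := Submonoid.subset_closure (by simp)

theorem stdSub_le_IS : stdSub ≤ IS := by
  refine Submonoid.closure_le.2 ?_
  rintro φ (rfl | rfl | rfl) <;> refine mem_IS.2 fun i => ?_
  · exact ⟨substL [i], by rw [← autL_pos]; simp⟩
  · exact ⟨substL' [i], by rw [← autL'_pos]; simp⟩
  · exact ⟨[i].map (· + 1), by rw [← autE_pos]; simp⟩

theorem ne_nil_of_pos {φ : MulAut F2} {i : Fin 2} {A : List (Fin 2)}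
    (h : φ (FreeGroup.of i) = pos A) : A ≠ [] := by
  rintro rfl
  rw [pos_nil, MulEquiv.map_eq_one_iff] at h
  exact FreeGroup.of_ne_one i h

theorem mul_conj (φ : MulAut F2) (x : F2) :
    φ * MulAut.conj x = MulAut.conj (φ x) * φ := by
  ext1 y
  simp

/-- If the images of both letters under a positive automorphism `σ` of the standard submonoid end
with the letter `x`, then moving this letter to the front does not lead out of the submonoid. -/
theorem conj_mul_mem_stdSub {σ : MulAut F2} (hσ : σ ∈ stdSub) (x : Fin 2)
    (hx : ∀ i, ∃ U, σ (FreeGroup.of i) = pos (U ++ [x])) :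
    MulAut.conj (FreeGroup.of x) * σ ∈ stdSub := by
  have hswap : MulAut.conj (FreeGroup.of 1) * autL = autL' :=
    mulAut_ext (by simp [mul_assoc]) (by simp)
  unfold stdSub at hσ
  induction hσ using Submonoid.closure_induction_left generalizing x with
  | one =>
    exfalso
    have key : ∀ i, x = i := by
      intro i
      obtain ⟨U, hU⟩ := hx i
      have h : [i] = U ++ [x] := pos_injective (by rw [← hU]; simp)
      have := congrArg List.getLast? h
      simpa [eq_comm] using this
    exact absurd ((key 0).symm.trans (key 1)) (by decide)
  | mul_left g hg τ hτ ih =>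
    have hpos := mem_IS.1 (stdSub_le_IS hτ)
    have hlast : ∀ i, ∃ U y, τ (FreeGroup.of i) = pos (U ++ [y]) := by
      intro i
      obtain ⟨A, hA⟩ := hpos i
      obtain ⟨U, y, rfl⟩ := (List.eq_nil_or_concat' A).resolve_left (ne_nil_of_pos hA)
      exact ⟨U, y, hA⟩
    rw [← mul_assoc]
    rcases hg with rfl | rfl | rfl
    · obtain ⟨U, hU⟩ := hx 0
      obtain ⟨V, y, hV⟩ := hlast 0
      rw [MulAut.mul_apply, hV, autL_pos] at hU
      have h := congrArg List.getLast? (pos_injective hU)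
      obtain rfl : x = 1 := by
        rcases two_letters y with rfl | rfl <;> simpa [List.getLast?_cons, eq_comm] using h
      rw [hswap]
      exact mul_mem autL'_mem hτ
    · have hτx : ∀ i, ∃ U, τ (FreeGroup.of i) = pos (U ++ [x]) := by
        intro i
        obtain ⟨U, hU⟩ := hx i
        obtain ⟨V, y, hV⟩ := hlast i
        rw [MulAut.mul_apply, hV, autL'_pos] at hU
        have h := congrArg List.getLast? (pos_injective hU)
        obtain rfl : x = y := by
          rcases two_letters y with rfl | rfl <;>
            simpa [substL', List.getLast?_cons, eq_comm] using h
        exact ⟨V, hV⟩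
      have h1 := ih x hτx
      rcases two_letters x with rfl | rfl
      · have : MulAut.conj (FreeGroup.of 0) * autL' = autL * MulAut.conj (FreeGroup.of 0) := by
          rw [mul_conj, autL_zero, map_mul, mul_assoc, hswap]
        rw [this, mul_assoc]
        exact mul_mem autL_mem h1
      · have : MulAut.conj (FreeGroup.of 1) * autL' = autL' * MulAut.conj (FreeGroup.of 1) := by
          rw [mul_conj, autL'_one]
        rw [this, mul_assoc]
        exact mul_mem autL'_mem h1
    · have h2 : ∀ c : Fin 2, c + 1 + 1 = c := by decide
      have : MulAut.conj (FreeGroup.of x) * autE = autE * MulAut.conj (FreeGroup.of (x + 1)) := by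
        rw [mul_conj, autE_of, h2]
      rw [this, mul_assoc]
      refine mul_mem autE_mem (ih (x + 1) fun i => ?_)
      obtain ⟨U, hU⟩ := hx i
      refine ⟨U.map (· + 1), ?_⟩
      have h3 := congrArg autE hU
      rw [← MulAut.mul_apply, ← mul_assoc, autE_mul_autE, one_mul, autE_pos] at h3
      simpa using h3

theorem exists_prefix_split {β : Type*} (A B : List β) :
    (∃ D, B = A ++ D) ∨ (∃ D, A = B ++ D) ∨
      ∃ p u v A' B', u ≠ v ∧ A = p ++ u :: A' ∧ B = p ++ v :: B' := by
  induction A generalizing B with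
  | nil => exact Or.inl ⟨B, rfl⟩
  | cons x A ih =>
    cases B with
    | nil => exact Or.inr (Or.inl ⟨_, rfl⟩)
    | cons y B =>
      by_cases hxy : x = y
      · subst hxy
        rcases ih B with ⟨D, rfl⟩ | ⟨D, rfl⟩ | ⟨p, u, v, A', B', huv, rfl, rfl⟩
        · exact Or.inl ⟨D, rfl⟩
        · exact Or.inr (Or.inl ⟨D, rfl⟩)
        · exact Or.inr (Or.inr ⟨x :: p, u, v, A', B', huv, rfl, rfl⟩)
      · exact Or.inr (Or.inr ⟨[], x, y, A, B, hxy, rfl, rfl⟩)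

theorem exists_suffix_split {β : Type*} (A B : List β) :
    (∃ D, B = D ++ A) ∨ (∃ D, A = D ++ B) ∨
      ∃ s u v A' B', u ≠ v ∧ A = A' ++ [u] ++ s ∧ B = B' ++ [v] ++ s := by
  have hrev : ∀ {l m : List β}, l.reverse = m → l = m.reverse := fun h => by
    rw [← h, List.reverse_reverse]
  rcases exists_prefix_split A.reverse B.reverse with
    ⟨D, h⟩ | ⟨D, h⟩ | ⟨p, u, v, A', B', huv, h, h'⟩
  · exact Or.inl ⟨D.reverse, by simpa using hrev h⟩
  · exact Or.inr (Or.inl ⟨D.reverse, by simpa using hrev h⟩)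
  · exact Or.inr (Or.inr ⟨p.reverse, u, v, A'.reverse, B'.reverse, huv, by simpa using hrev h,
      by simpa using hrev h'⟩)

theorem mk_signed (s : Bool) (A : List (Fin 2)) :
    (FreeGroup.mk (signed s A) : F2) = if s then pos A else (pos A)⁻¹ := by
  cases s
  · simp only [pos, FreeGroup.inv_mk]
    congr 1
    simp [FreeGroup.invRev, Function.comp_def]
  · rfl

theorem isReduced_append_signed {s : Bool} {A : List (Fin 2)} {u : Word}
    (hu : FreeGroup.IsReduced u)
    (h : ∀ x ∈ (signed s A).getLast?, ∀ y ∈ u.head?, x.1 = y.1 → x.2 = y.2) :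
    FreeGroup.IsReduced (signed s A ++ u) :=
  List.isChain_append.2 ⟨isReduced_signed s A, hu, h⟩

/-- When the words `W i` begin with distinct letters and end with distinct letters, little cancels
in a product of the elements `W i * s` and their inverses: the reduced word of the product begins as
the first factor does. -/
theorem exists_reduced_of_bifix {φ : MulAut F2} {W : Fin 2 → List (Fin 2)} {s : List (Fin 2)}
    (hφ : ∀ i, φ (FreeGroup.of i) = pos (W i ++ s)) (hne : ∀ i, W i ≠ [])
    (hhead : ∀ i j, i ≠ j → ∀ x ∈ (W i).head?, ∀ y ∈ (W j).head?, x ≠ y)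
    (hlast : ∀ i j, i ≠ j → ∀ x ∈ (W i).getLast?, ∀ y ∈ (W j).getLast?, x ≠ y)
    (w : Word) (i : Fin 2) (t : Bool) (hw : FreeGroup.IsReduced ((i, t) :: w)) :
    ∃ r, FreeGroup.IsReduced (signed t (if t then W i else W i ++ s) ++ r) ∧
      φ (FreeGroup.mk ((i, t) :: w)) =
        FreeGroup.mk (signed t (if t then W i else W i ++ s) ++ r) := by
  have hsgn : ∀ (t : Bool) (A : List (Fin 2)), ∀ x ∈ signed t A, x.2 = t := by
    intro t A x hx
    cases t <;> simp only [signed_true, signed_false, List.mem_map] at hx <;>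
      obtain ⟨_, _, rfl⟩ := hx <;> rfl
  induction w generalizing i t with
  | nil =>
    cases t
    · refine ⟨[], by simpa using isReduced_signed false (W i ++ s), ?_⟩
      simp [mk_cons, letterVal, ← FreeGroup.one_eq_mk, hφ, mk_signed, -signed_false]
    · refine ⟨signed true s, ?_, ?_⟩
      · simpa using isReduced_signed true (W i ++ s)
      · simp [mk_cons, letterVal, ← FreeGroup.one_eq_mk, hφ, mk_signed, mk_append,
          -FreeGroup.mul_mk, -signed_true]
  | cons y w ih =>
    obtain ⟨j, t'⟩ := y
    have hw' : FreeGroup.IsReduced ((j, t') :: w) := List.IsChain.tail hw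
    have hij : i = j → t = t' := (List.isChain_cons_cons.1 hw).1
    obtain ⟨r, hr, hmk⟩ := ih j t' hw'
    rw [mk_cons, map_mul, hmk]
    have hhd : ∀ (A : List (Fin 2)), A ≠ [] → ∀ y ∈ (signed t' A ++ r).head?, y ∈ signed t' A := by
      intro A hA y hy
      rw [List.head?_append_of_ne_nil _ (signed_ne_nil hA)] at hy
      exact List.mem_of_mem_head? hy
    cases t <;> cases t'
    · refine ⟨signed false (W j ++ s) ++ r, ?_, ?_⟩
      · refine isReduced_append_signed hr fun x hx y hy _ => ?_
        rw [hsgn _ _ x (List.mem_of_getLast? hx), hsgn _ _ y (hhd _ (by simp [hne]) y hy)]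
      · simp [mk_append, mul_assoc, -FreeGroup.mul_mk, letterVal, hφ, mk_signed, -signed_false]
    · have hij : i ≠ j := fun h => by simpa using hij h
      refine ⟨signed true (W j) ++ r, ?_, ?_⟩
      · refine isReduced_append_signed hr fun x hx y hy h => ?_
        exfalso
        rw [List.head?_append_of_ne_nil _ (signed_ne_nil (hne j))] at hy
        simp only [Bool.false_eq_true, if_false, signed_false, List.getLast?_map,
          List.getLast?_reverse, List.head?_append_of_ne_nil _ (hne i), signed_true,
          List.head?_map, Option.mem_map] at hx hy
        obtain ⟨x', hx', rfl⟩ := hx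
        obtain ⟨y', hy', rfl⟩ := hy
        exact hhead i j hij x' hx' y' hy' h
      · simp [mk_append, mul_assoc, -FreeGroup.mul_mk, letterVal, hφ, mk_signed,
          -signed_false, -signed_true]
    · have hij : i ≠ j := fun h => by simpa using hij h
      have hsplit : signed false (W j ++ s) = signed false s ++ signed false (W j) := by simp
      simp only [Bool.false_eq_true, if_false, hsplit, List.append_assoc] at hr ⊢
      refine ⟨signed false (W j) ++ r, ?_, ?_⟩
      · refine isReduced_append_signed (List.isChain_append.1 hr).2.1 fun x hx y hy h => ?_
        exfalso
        rw [List.head?_append_of_ne_nil _ (signed_ne_nil (hne j))] at hy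
        simp only [if_true, signed_false, List.getLast?_map, List.head?_reverse, signed_true,
          List.head?_map, Option.mem_map] at hx hy
        obtain ⟨x', hx', rfl⟩ := hx
        obtain ⟨y', hy', rfl⟩ := hy
        exact hlast i j hij x' hx' y' hy' h
      · simp [mk_append, -FreeGroup.mul_mk, letterVal, hφ, mk_signed, -signed_false,
          -signed_true, mul_assoc]
    · refine ⟨signed true s ++ (signed true (W j) ++ r), ?_, ?_⟩
      · have : signed true (W i) ++ (signed true s ++ (signed true (W j) ++ r)) =
            signed true (W i ++ s) ++ (signed true (W j) ++ r) := by simp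
        rw [if_pos rfl, this]
        refine isReduced_append_signed hr fun x hx y hy _ => ?_
        rw [hsgn _ _ x (List.mem_of_getLast? hx), hsgn _ _ y (hhd _ (hne j) y hy)]
      · simp [mk_append, -FreeGroup.mul_mk, letterVal, hφ, mk_signed, -signed_false,
          -signed_true, mul_assoc]

/-- The base case of the decomposition of positive automorphisms: there are only two with images
`W i ++ s` as above. -/
theorem mem_stdSub_of_bifix {φ : MulAut F2} {W : Fin 2 → List (Fin 2)} {s : List (Fin 2)}
    (hφ : ∀ i, φ (FreeGroup.of i) = pos (W i ++ s)) (hne : ∀ i, W i ≠ [])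
    (hhead : ∀ i j, i ≠ j → ∀ x ∈ (W i).head?, ∀ y ∈ (W j).head?, x ≠ y)
    (hlast : ∀ i j, i ≠ j → ∀ x ∈ (W i).getLast?, ∀ y ∈ (W j).getLast?, x ≠ y) :
    φ ∈ stdSub := by
  have key : ∀ c : Fin 2, ∃ i, W i = [c] ∧ s = [] := by
    intro c
    obtain ⟨z, hz⟩ := φ.surjective (FreeGroup.of c)
    have hred := FreeGroup.isReduced_toWord (x := z)
    rw [← FreeGroup.mk_toWord (x := z)] at hz
    generalize z.toWord = w at hz hred
    have hc : (FreeGroup.of c : F2) = FreeGroup.mk [(c, true)] := rfl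
    cases w with
    | nil =>
      rw [← FreeGroup.one_eq_mk, map_one] at hz
      exact absurd hz.symm (FreeGroup.of_ne_one c)
    | cons x w =>
      obtain ⟨i, t⟩ := x
      obtain ⟨r, hr, hmk⟩ := exists_reduced_of_bifix hφ hne hhead hlast w i t hred
      rw [hz, hc] at hmk
      have h := isReduced_mk_inj (FreeGroup.IsReduced.singleton) hr hmk
      cases t
      · exfalso
        obtain ⟨U, x, hU⟩ := (List.eq_nil_or_concat' (W i ++ s)).resolve_left (by simp [hne])
        simp [hU] at h
      · obtain ⟨x, U, hU⟩ := List.exists_cons_of_ne_nil (hne i)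
        simp only [if_true, hU, signed_true, List.map_cons, List.cons_append, List.cons.injEq,
          Prod.mk.injEq, and_true] at h
        obtain ⟨rfl, h⟩ := h
        have hU0 : U = [] := by
          have := (List.append_eq_nil_iff.1 h.symm).1
          simpa using this
        subst hU0
        refine ⟨i, hU, ?_⟩
        -- the remaining letters of the preimage map to the inverse of `s`
        have hrest : φ (FreeGroup.mk w) = FreeGroup.mk (signed false s) := by
          rw [mk_cons, map_mul] at hz
          simp only [letterVal, if_true, hφ, hU, pos_append, pos_cons, pos_nil, mul_one,
            mul_assoc] at hz
          rw [mk_signed, if_neg (by simp)]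
          exact eq_inv_of_mul_eq_one_right (mul_eq_left.1 hz)
        cases w with
        | nil =>
          rw [← FreeGroup.one_eq_mk, map_one] at hrest
          have := isReduced_mk_inj (FreeGroup.IsReduced.nil) (isReduced_signed false s)
            (FreeGroup.one_eq_mk.symm.trans hrest)
          simpa using this.symm
        | cons y w =>
          exfalso
          obtain ⟨j, t⟩ := y
          obtain ⟨r, hr, hmk⟩ := exists_reduced_of_bifix hφ hne hhead hlast w j t
            (List.IsChain.tail hred)
          rw [hrest] at hmk
          have h := isReduced_mk_inj (isReduced_signed false s) hr hmk
          have hlen := congrArg List.length h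
          cases t
          · simp at hlen
            simp [hne] at hlen
          · obtain ⟨y, V, hV⟩ := List.exists_cons_of_ne_nil (hne j)
            rw [if_pos rfl, hV, signed_true, List.map_cons, List.cons_append] at h
            have : (y, true) ∈ signed false s := by rw [h]; exact List.mem_cons_self
            simp at this
  obtain ⟨i, hi, hs⟩ := key 0
  obtain ⟨j, hj, -⟩ := key 1
  subst hs
  have hij : i ≠ j := by
    rintro rfl
    rw [hi] at hj
    simp at hj
  rcases two_letters i with rfl | rfl <;> rcases two_letters j with rfl | rfl
  · exact absurd rfl hij
  · have : φ = 1 := mulAut_ext (by simp [hφ, hi]) (by simp [hφ, hj])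
    rw [this]; exact one_mem _
  · have : φ = autE := mulAut_ext (by simp [hφ, hj]) (by simp [hφ, hi])
    rw [this]; exact autE_mem
  · exact absurd rfl hij

/-- The monoid of invertible substitutions is generated by `a ↦ ab`, by `a ↦ ba` and by the exchange
of the letters. -/
theorem IS_le_stdSub : IS ≤ stdSub := by
  have main : ∀ (n : ℕ) (A B : List (Fin 2)) (φ : MulAut F2), A.length + B.length = n →
      φ (FreeGroup.of 0) = pos A → φ (FreeGroup.of 1) = pos B → φ ∈ stdSub := by
    intro n
    induction n using Nat.strong_induction_on with
    | _ n IH =>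
      -- The images begin with distinct letters.  If one image is a suffix of the other, a generator
      -- splits off on the right; otherwise the images differ before a common suffix.
      have base : ∀ (A B : List (Fin 2)) (φ : MulAut F2) (x y : Fin 2) (A' B' : List (Fin 2)),
          A.length + B.length = n → φ (FreeGroup.of 0) = pos A → φ (FreeGroup.of 1) = pos B →
          A = x :: A' → B = y :: B' → x ≠ y → φ ∈ stdSub := by
        intro A B φ x y A' B' hn hA hB hxA hyB hxy
        rcases exists_suffix_split A B with ⟨D, rfl⟩ | ⟨D, rfl⟩ | ⟨s, u, v, A₁, B₁, huv, hAs, hBs⟩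
        · set g := autE * autL * autE with hg
          have h0 : g⁻¹ (FreeGroup.of 0) = FreeGroup.of 0 := by
            rw [MulAut.inv_apply, MulEquiv.symm_apply_eq]; simp [hg]
          have h1 : g⁻¹ (FreeGroup.of 1) = FreeGroup.of 1 * (FreeGroup.of 0)⁻¹ := by
            rw [MulAut.inv_apply, MulEquiv.symm_apply_eq]; simp [hg]
          have : φ = φ * g⁻¹ * g := by simp
          rw [this]
          refine mul_mem (IH (A.length + D.length) ?_ A D _ rfl ?_ ?_)
            (mul_mem (mul_mem autE_mem autL_mem) autE_mem)
          · rw [← hn, hxA]; simp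
          · rw [MulAut.mul_apply, h0, hA]
          · rw [MulAut.mul_apply, h1, map_mul, map_inv, hA, hB, pos_append, mul_inv_cancel_right]
        · have h0 : autL⁻¹ (FreeGroup.of 0) = FreeGroup.of 0 * (FreeGroup.of 1)⁻¹ := by
            rw [MulAut.inv_apply, MulEquiv.symm_apply_eq]; simp
          have h1 : autL⁻¹ (FreeGroup.of 1) = FreeGroup.of 1 := by
            rw [MulAut.inv_apply, MulEquiv.symm_apply_eq]; simp
          have : φ = φ * autL⁻¹ * autL := by simp
          rw [this]
          refine mul_mem (IH (D.length + B.length) ?_ D B _ rfl ?_ ?_) autL_mem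
          · rw [← hn, hyB]; simp
          · rw [MulAut.mul_apply, h0, map_mul, map_inv, hA, hB, pos_append, mul_inv_cancel_right]
          · rw [MulAut.mul_apply, h1, hB]
        · refine mem_stdSub_of_bifix (W := ![A₁ ++ [u], B₁ ++ [v]]) (s := s) ?_ ?_ ?_ ?_
          · intro i
            rcases two_letters i with rfl | rfl
            · rw [hA, hAs]; rfl
            · rw [hB, hBs]; rfl
          · intro i
            rcases two_letters i with rfl | rfl <;> simp
          · have hx : (A₁ ++ [u]).head? = some x := by
              have := congrArg List.head? (hxA.symm.trans hAs)
              rw [List.head?_append_of_ne_nil _ (by simp)] at this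
              exact this.symm
            have hy : (B₁ ++ [v]).head? = some y := by
              have := congrArg List.head? (hyB.symm.trans hBs)
              rw [List.head?_append_of_ne_nil _ (by simp)] at this
              exact this.symm
            intro i j hij
            rcases two_letters i with rfl | rfl <;> rcases two_letters j with rfl | rfl
            · exact absurd rfl hij
            · simpa [hx, hy] using hxy
            · simpa [hx, hy] using hxy.symm
            · exact absurd rfl hij
          · intro i j hij
            rcases two_letters i with rfl | rfl <;> rcases two_letters j with rfl | rfl
            · exact absurd rfl hij
            · simpa using huv
            · simpa using huv.symm
            · exact absurd rfl hij
      -- If both images begin with the same letter, a conjugation moves this letter to the end; this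
      -- removes the first letter of the common prefix `p` of `A ++ B` and `B ++ A`.
      have rot : ∀ (p : List (Fin 2)) (A B : List (Fin 2)) (φ : MulAut F2) (x y : Fin 2)
          (r r' : List (Fin 2)), A.length + B.length = n → φ (FreeGroup.of 0) = pos A →
          φ (FreeGroup.of 1) = pos B → A ++ B = p ++ x :: r → B ++ A = p ++ y :: r' → x ≠ y →
          φ ∈ stdSub := by
        intro p
        induction p with
        | nil =>
          intro A B φ x y r r' hn hA hB hAB hBA hxy
          obtain ⟨x', A', rfl⟩ := List.exists_cons_of_ne_nil (ne_nil_of_pos hA)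
          obtain ⟨y', B', rfl⟩ := List.exists_cons_of_ne_nil (ne_nil_of_pos hB)
          obtain rfl : x' = x := by simpa using congrArg List.head? hAB
          obtain rfl : y' = y := by simpa using congrArg List.head? hBA
          exact base _ _ φ x' y' A' B' hn hA hB rfl rfl hxy
        | cons c p ih =>
          intro A B φ x y r r' hn hA hB hAB hBA hxy
          obtain ⟨x', A', rfl⟩ := List.exists_cons_of_ne_nil (ne_nil_of_pos hA)
          obtain ⟨y', B', rfl⟩ := List.exists_cons_of_ne_nil (ne_nil_of_pos hB)
          simp only [List.cons_append, List.cons.injEq] at hAB hBA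
          obtain ⟨rfl, hAB⟩ := hAB
          obtain ⟨rfl, hBA⟩ := hBA
          set ψ := MulAut.conj (FreeGroup.of y')⁻¹ * φ with hψ
          have h0 : ψ (FreeGroup.of 0) = pos (A' ++ [y']) := by
            rw [hψ, MulAut.mul_apply, hA]; simp
          have h1 : ψ (FreeGroup.of 1) = pos (B' ++ [y']) := by
            rw [hψ, MulAut.mul_apply, hB]; simp
          have hmem : ψ ∈ stdSub := by
            refine ih (A' ++ [y']) (B' ++ [y']) ψ x y (r ++ [y']) (r' ++ [y']) ?_ h0 h1 ?_ ?_ hxy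
            · simp at hn ⊢; omega
            · have := congrArg (· ++ [y']) hAB
              simpa using this
            · have := congrArg (· ++ [y']) hBA
              simpa using this
          have := conj_mul_mem_stdSub hmem y' fun i => by
            rcases two_letters i with rfl | rfl
            exacts [⟨A', h0⟩, ⟨B', h1⟩]
          rwa [hψ, ← mul_assoc, ← map_mul, mul_inv_cancel, map_one, one_mul] at this
      intro A B φ hn hA hB
      -- the images of `a` and `b` do not commute
      have hne : A ++ B ≠ B ++ A := by
        intro h
        have h1 : φ (FreeGroup.of 0 * FreeGroup.of 1) = φ (FreeGroup.of 1 * FreeGroup.of 0) := by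
          rw [map_mul, map_mul, hA, hB, ← pos_append, ← pos_append, h]
        have h2 : pos [0, 1] = pos [1, 0] := by simpa using φ.injective h1
        exact absurd (pos_injective h2) (by decide)
      rcases exists_prefix_split (A ++ B) (B ++ A) with
        ⟨D, h⟩ | ⟨D, h⟩ | ⟨p, u, v, r, r', huv, h, h'⟩
      · have hl := congrArg List.length h
        have : D = [] := by
          rw [← List.length_eq_zero_iff]; simp at hl; omega
        subst this
        exact absurd (by simpa using h.symm) hne
      · have hl := congrArg List.length h
        have : D = [] := by
          rw [← List.length_eq_zero_iff]; simp at hl; omega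
        subst this
        exact absurd (by simpa using h) hne
      · exact rot p A B φ u v r r' hn hA hB h h' huv
  intro φ hφ
  obtain ⟨A, hA⟩ := mem_IS.1 hφ 0
  obtain ⟨B, hB⟩ := mem_IS.1 hφ 1
  exact main _ A B φ rfl hA hB

/-! ### Automorphisms given by pairs of words -/

/-- A pair of words `(x, y)`, naming the endomorphism `a ↦ x`, `b ↦ y`. -/
abbrev WordPair : Type := Word × Word

/-- The automorphism `φ` is the endomorphism named by `p`. -/
def Reps (p : WordPair) (φ : MulAut F2) : Prop :=
  φ (FreeGroup.of 0) = FreeGroup.mk p.1 ∧ φ (FreeGroup.of 1) = FreeGroup.mk p.2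

theorem Reps.unique {p : WordPair} {φ ψ : MulAut F2} (h : Reps p φ) (h' : Reps p ψ) : φ = ψ :=
  mulAut_ext (h.1.trans h'.1.symm) (h.2.trans h'.2.symm)

/-- The image of a word under an endomorphism named by a pair of words. -/
def WordPair.subst (p : WordPair) (w : Word) : Word :=
  w.flatMap fun x => if x.2 then (if x.1 = 0 then p.1 else p.2)
    else FreeGroup.invRev (if x.1 = 0 then p.1 else p.2)

theorem Reps.mk_subst {p : WordPair} {φ : MulAut F2} (h : Reps p φ) (w : Word) :
    FreeGroup.mk (p.subst w) = φ (FreeGroup.mk w) := by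
  induction w with
  | nil => simp [WordPair.subst, ← FreeGroup.one_eq_mk]
  | cons x w ih =>
    rw [WordPair.subst] at ih ⊢
    rw [List.flatMap_cons, mk_append, ih, mk_cons, map_mul]
    congr 1
    obtain ⟨c, s⟩ := x
    rcases two_letters c with rfl | rfl <;> cases s <;>
      simp [letterVal, h.1, h.2, ← FreeGroup.inv_mk]

/-- Composition of endomorphisms named by pairs of words. -/
def WordPair.comp (p q : WordPair) : WordPair := (p.subst q.1, p.subst q.2)

theorem Reps.comp {p q : WordPair} {φ ψ : MulAut F2} (h : Reps p φ) (h' : Reps q ψ) :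
    Reps (p.comp q) (φ * ψ) := by
  refine ⟨?_, ?_⟩
  · rw [MulAut.mul_apply, h'.1, WordPair.comp, h.mk_subst]
  · rw [MulAut.mul_apply, h'.2, WordPair.comp, h.mk_subst]

/-- The pair of words naming the identity. -/
def WordPair.id : WordPair := ([(0, true)], [(1, true)])

theorem reps_id : Reps WordPair.id 1 := ⟨rfl, rfl⟩

/-- The pairs of words naming `a ↦ ab` and `a ↦ ba` (both fixing `b`), and the compositions of
these automorphisms with the exchange of letters. -/
def stepPairs : List WordPair :=
  [([(0, true), (1, true)], [(1, true)]), ([(1, true), (0, true)], [(1, true)]),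
    ([(1, true)], [(0, true), (1, true)]), ([(1, true)], [(1, true), (0, true)])]

theorem reps_autL : Reps ([(0, true), (1, true)], [(1, true)]) autL :=
  ⟨by simp [mk_cons, letterVal, ← FreeGroup.one_eq_mk],
    by simp [mk_cons, letterVal, ← FreeGroup.one_eq_mk]⟩

theorem reps_autL' : Reps ([(1, true), (0, true)], [(1, true)]) autL' :=
  ⟨by simp [mk_cons, letterVal, ← FreeGroup.one_eq_mk],
    by simp [mk_cons, letterVal, ← FreeGroup.one_eq_mk]⟩

theorem Reps.swap {x y : Word} {φ : MulAut F2} (h : Reps (x, y) φ) : Reps (y, x) (φ * autE) :=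
  ⟨by simpa using h.2, by simpa using h.1⟩

/-- A finite list of names of invertible substitutions, which contains all those that are short. -/
def subsPairs : ℕ → List WordPair
  | 0 => [WordPair.id, ([(1, true)], [(0, true)])]
  | n + 1 => subsPairs n ++ (subsPairs n).flatMap fun p => stepPairs.map fun q => p.comp q

/-- The automorphism has a name in the list. -/
def HasName (n : ℕ) (φ : MulAut F2) : Prop := ∃ p ∈ subsPairs n, Reps p φ

theorem exists_reps_stdSub {n : ℕ} {p : WordPair} (h : p ∈ subsPairs n) :
    ∃ φ ∈ stdSub, Reps p φ := by
  induction n generalizing p with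
  | zero =>
    simp only [subsPairs, List.mem_cons, List.not_mem_nil, or_false] at h
    rcases h with rfl | rfl
    · exact ⟨1, one_mem _, reps_id⟩
    · exact ⟨1 * autE, mul_mem (one_mem _) autE_mem, reps_id.swap⟩
  | succ n ih =>
    rcases List.mem_append.1 h with h | h
    · exact ih h
    · obtain ⟨p, hp, h⟩ := List.mem_flatMap.1 h
      obtain ⟨q, hq, rfl⟩ := List.mem_map.1 h
      obtain ⟨φ, hφ, hpφ⟩ := ih hp
      have : ∃ ψ ∈ stdSub, Reps q ψ := by
        simp only [stepPairs, List.mem_cons, List.not_mem_nil, or_false] at hq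
        rcases hq with rfl | rfl | rfl | rfl
        · exact ⟨_, autL_mem, reps_autL⟩
        · exact ⟨_, autL'_mem, reps_autL'⟩
        · exact ⟨_, mul_mem autL_mem autE_mem, reps_autL.swap⟩
        · exact ⟨_, mul_mem autL'_mem autE_mem, reps_autL'.swap⟩
      obtain ⟨ψ, hψ, hqψ⟩ := this
      exact ⟨φ * ψ, mul_mem hφ hψ, hpφ.comp hqψ⟩

theorem HasName.mono {m n : ℕ} (h : m ≤ n) {φ : MulAut F2} (hφ : HasName m φ) : HasName n φ := by
  induction n, h using Nat.le_induction with
  | base => exact hφ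
  | succ n _ ih =>
    obtain ⟨p, hp, h⟩ := ih
    exact ⟨p, List.mem_append_left _ hp, h⟩

theorem HasName.mul_step {n : ℕ} {φ ψ : MulAut F2} (hφ : HasName n φ) {q : WordPair}
    (hq : q ∈ stepPairs) (hψ : Reps q ψ) : HasName (n + 1) (φ * ψ) := by
  obtain ⟨p, hp, h⟩ := hφ
  exact ⟨p.comp q, List.mem_append_right _ (List.mem_flatMap.2 ⟨p, hp, List.mem_map_of_mem hq⟩),
    h.comp hψ⟩

theorem HasName.mul_autE {n : ℕ} {φ : MulAut F2} (hφ : HasName n φ) : HasName n (φ * autE) := by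
  induction n generalizing φ with
  | zero =>
    obtain ⟨p, hp, h⟩ := hφ
    simp only [subsPairs, List.mem_cons, List.not_mem_nil, or_false] at hp
    rcases hp with rfl | rfl
    · exact ⟨_, by simp [subsPairs], h.swap⟩
    · exact ⟨WordPair.id, by simp [subsPairs], h.swap⟩
  | succ n ih =>
    obtain ⟨p, hp, h⟩ := hφ
    rcases List.mem_append.1 hp with hp | hp
    · exact (ih ⟨p, hp, h⟩).mono n.le_succ
    · obtain ⟨p₀, hp₀, hp⟩ := List.mem_flatMap.1 hp
      obtain ⟨q, hq, rfl⟩ := List.mem_map.1 hp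
      refine ⟨p₀.comp (q.2, q.1), List.mem_append_right _ (List.mem_flatMap.2 ⟨p₀, hp₀,
        List.mem_map_of_mem ?_⟩), Reps.swap h⟩
      simp only [stepPairs, List.mem_cons, List.not_mem_nil, or_false] at hq ⊢
      rcases hq with rfl | rfl | rfl | rfl <;> simp

theorem hasName_one (n : ℕ) : HasName n 1 :=
  HasName.mono (Nat.zero_le n) ⟨WordPair.id, by simp [subsPairs], reps_id⟩

theorem HasName.mul {m n : ℕ} {φ ψ : MulAut F2} (hφ : HasName m φ) (hψ : HasName n ψ) :
    HasName (m + n) (φ * ψ) := by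
  induction n generalizing ψ with
  | zero =>
    obtain ⟨p, hp, h⟩ := hψ
    simp only [subsPairs, List.mem_cons, List.not_mem_nil, or_false] at hp
    rcases hp with rfl | rfl
    · rw [h.unique reps_id, mul_one]; exact hφ
    · rw [h.unique reps_id.swap, one_mul]; exact hφ.mul_autE
  | succ n ih =>
    obtain ⟨p, hp, h⟩ := hψ
    rcases List.mem_append.1 hp with hp | hp
    · exact (ih ⟨p, hp, h⟩).mono (by omega)
    · obtain ⟨p₀, hp₀, hp⟩ := List.mem_flatMap.1 hp
      obtain ⟨q, hq, rfl⟩ := List.mem_map.1 hp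
      obtain ⟨φ₀, -, h₀⟩ := exists_reps_stdSub hp₀
      have h1 : Reps q (φ₀⁻¹ * ψ) := by
        refine ⟨?_, ?_⟩
        · rw [MulAut.mul_apply, MulAut.inv_apply, MulEquiv.symm_apply_eq, ← h₀.mk_subst]
          exact h.1
        · rw [MulAut.mul_apply, MulAut.inv_apply, MulEquiv.symm_apply_eq, ← h₀.mk_subst]
          exact h.2
      have := (ih ⟨p₀, hp₀, h₀⟩).mul_step hq h1
      rwa [← mul_assoc, mul_inv_cancel_right] at this

/-- The homomorphism to the integers with given values on the letters. -/
def weight (ε : Fin 2 → ℤ) : F2 →* Multiplicative ℤ :=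
  FreeGroup.lift fun i => Multiplicative.ofAdd (ε i)

theorem abs_weight_le {ε : Fin 2 → ℤ} (h : ∀ i, |ε i| ≤ 1) (w : Word) :
    |(weight ε (FreeGroup.mk w)).toAdd| ≤ w.length := by
  induction w with
  | nil => simp [← FreeGroup.one_eq_mk]
  | cons x w ih =>
    rw [mk_cons, map_mul, toAdd_mul, List.length_cons]
    have h1 : |(weight ε (letterVal x)).toAdd| ≤ 1 := by
      obtain ⟨c, s⟩ := x
      cases s <;> simpa [letterVal, weight] using h c
    refine (abs_add_le _ _).trans ?_
    push_cast
    linarith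

/-- A short invertible substitution has a name in the list: each generator other than the exchange
of letters makes the images of the letters longer. -/
theorem hasName_of_reps {p : WordPair} {φ : MulAut F2} (hφ : φ ∈ IS) (hp : Reps p φ) :
    HasName (p.1.length + p.2.length) φ := by
  have key : ∃ n : ℕ, HasName n φ ∧ 0 < (weight 1 (φ (FreeGroup.of 0))).toAdd ∧
      0 < (weight 1 (φ (FreeGroup.of 1))).toAdd ∧
      n ≤ (weight 1 (φ (FreeGroup.of 0))).toAdd + (weight 1 (φ (FreeGroup.of 1))).toAdd := by
    clear hp
    replace hφ := IS_le_stdSub hφ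
    unfold stdSub at hφ
    induction hφ using Submonoid.closure_induction_right with
    | one => exact ⟨0, hasName_one 0, by simp [weight], by simp [weight], by simp [weight]⟩
    | mul_right σ hσ g hg ih =>
      obtain ⟨n, hn, h0, h1, h2⟩ := ih
      rcases hg with rfl | rfl | rfl
      · refine ⟨n + 1, hn.mul_step (by simp [stepPairs]) reps_autL, ?_, ?_, ?_⟩ <;>
          simp <;> omega
      · refine ⟨n + 1, hn.mul_step (by simp [stepPairs]) reps_autL', ?_, ?_, ?_⟩ <;>
          simp <;> omega
      · refine ⟨n, hn.mul_autE, ?_, ?_, ?_⟩ <;> simp <;> omega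
  obtain ⟨n, hn, -, -, h⟩ := key
  refine hn.mono ?_
  have h0 := abs_weight_le (ε := 1) (fun _ => by simp) p.1
  have h1 := abs_weight_le (ε := 1) (fun _ => by simp) p.2
  rw [← hp.1] at h0
  rw [← hp.2] at h1
  have := le_abs_self (weight 1 (φ (FreeGroup.of 0))).toAdd
  have := le_abs_self (weight 1 (φ (FreeGroup.of 1))).toAdd
  omega

/-- An invertible substitution whose inverse is short has a name in the list: the inverse is
composed of `a ↦ a * b⁻¹`, of `a ↦ b⁻¹ * a` and of the exchange of letters, and the weights
`1` and `-1` of the letters prevent cancellation. -/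
theorem hasName_of_reps_inv {p : WordPair} {φ : MulAut F2} (hφ : φ ∈ IS) (hp : Reps p φ⁻¹) :
    HasName (p.1.length + p.2.length) φ := by
  have key : ∃ n : ℕ, HasName n φ ∧
      (0 < (weight ![1, -1] (φ⁻¹ (FreeGroup.of 0))).toAdd ∧
        (weight ![1, -1] (φ⁻¹ (FreeGroup.of 1))).toAdd < 0 ∨
      (weight ![1, -1] (φ⁻¹ (FreeGroup.of 0))).toAdd < 0 ∧
        0 < (weight ![1, -1] (φ⁻¹ (FreeGroup.of 1))).toAdd) ∧
      n ≤ |(weight ![1, -1] (φ⁻¹ (FreeGroup.of 0))).toAdd -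
        (weight ![1, -1] (φ⁻¹ (FreeGroup.of 1))).toAdd| := by
    clear hp
    replace hφ := IS_le_stdSub hφ
    unfold stdSub at hφ
    induction hφ using Submonoid.closure_induction_left with
    | one => exact ⟨0, hasName_one 0, by simp [weight], by simp [weight]⟩
    | mul_left g hg σ hσ ih =>
      obtain ⟨n, hn, h0, h1⟩ := ih
      have hL0 : autL⁻¹ (FreeGroup.of 0) = FreeGroup.of 0 * (FreeGroup.of 1)⁻¹ := by
        rw [MulAut.inv_apply, MulEquiv.symm_apply_eq]; simp
      have hL1 : autL⁻¹ (FreeGroup.of 1) = FreeGroup.of 1 := by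
        rw [MulAut.inv_apply, MulEquiv.symm_apply_eq]; simp
      have hL0' : autL'⁻¹ (FreeGroup.of 0) = (FreeGroup.of 1)⁻¹ * FreeGroup.of 0 := by
        rw [MulAut.inv_apply, MulEquiv.symm_apply_eq]; simp
      have hL1' : autL'⁻¹ (FreeGroup.of 1) = FreeGroup.of 1 := by
        rw [MulAut.inv_apply, MulEquiv.symm_apply_eq]; simp
      have hE : autE⁻¹ = autE := inv_eq_of_mul_eq_one_left autE_mul_autE
      rw [abs_eq_max_neg] at h1
      simp only [mul_inv_rev, MulAut.mul_apply]
      rcases hg with rfl | rfl | rfl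
      · refine ⟨1 + n, ((hasName_one 0).mul_step (by simp [stepPairs]) reps_autL).mul hn, ?_⟩
        rw [hL0, hL1, map_mul, map_inv, map_mul, map_inv, toAdd_mul, toAdd_inv, abs_eq_max_neg]
        push_cast
        omega
      · refine ⟨1 + n, ((hasName_one 0).mul_step (by simp [stepPairs]) reps_autL').mul hn, ?_⟩
        rw [hL0', hL1', map_mul, map_inv, map_mul, map_inv, toAdd_mul, toAdd_inv, abs_eq_max_neg]
        push_cast
        omega
      · refine ⟨0 + n, ((hasName_one 0).mul_autE).mul hn, ?_⟩
        rw [hE, autE_of, autE_of, show (0 : Fin 2) + 1 = 1 from rfl,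
          show (1 : Fin 2) + 1 = 0 from rfl, abs_eq_max_neg]
        push_cast
        omega
  obtain ⟨n, hn, -, h⟩ := key
  refine hn.mono ?_
  have hε : ∀ i : Fin 2, |(![1, -1] : Fin 2 → ℤ) i| ≤ 1 := by
    intro i
    rcases two_letters i with rfl | rfl <;> simp
  have h0 := abs_weight_le hε p.1
  have h1 := abs_weight_le hε p.2
  rw [← hp.1] at h0
  rw [← hp.2] at h1
  have := abs_sub (weight ![1, -1] (φ⁻¹ (FreeGroup.of 0))).toAdd
    (weight ![1, -1] (φ⁻¹ (FreeGroup.of 1))).toAdd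
  omega

/-- The pair of words names an invertible substitution if and only if it has the same value as one
of finitely many pairs. -/
theorem exists_mem_IS_iff (p : WordPair) :
    (∃ φ ∈ IS, Reps p φ) ↔ ∃ q ∈ subsPairs (p.1.length + p.2.length),
      (FreeGroup.mk q.1 : F2) = FreeGroup.mk p.1 ∧ (FreeGroup.mk q.2 : F2) = FreeGroup.mk p.2 := by
  constructor
  · rintro ⟨φ, hφ, hp⟩
    obtain ⟨q, hq, h⟩ := hasName_of_reps hφ hp
    exact ⟨q, hq, h.1.symm.trans hp.1, h.2.symm.trans hp.2⟩
  · rintro ⟨q, hq, h0, h1⟩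
    obtain ⟨φ, hφ, h⟩ := exists_reps_stdSub hq
    exact ⟨φ, stdSub_le_IS hφ, h.1.trans h0, h.2.trans h1⟩

/-- The pair of words names the inverse of an invertible substitution if and only if one of finitely
many invertible substitutions maps the words to the letters. -/
theorem exists_mem_IS_inv_iff (p : WordPair) :
    (∃ φ ∈ IS⁻¹, Reps p φ) ↔ ∃ q ∈ subsPairs (p.1.length + p.2.length),
      (FreeGroup.mk (q.subst p.1) : F2) = FreeGroup.mk [(0, true)] ∧
      (FreeGroup.mk (q.subst p.2) : F2) = FreeGroup.mk [(1, true)] := by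
  constructor
  · rintro ⟨φ, hφ, hp⟩
    have hφ' : φ⁻¹ ∈ IS := Submonoid.mem_inv.1 hφ
    obtain ⟨q, hq, h⟩ := hasName_of_reps_inv hφ' (by rwa [inv_inv])
    refine ⟨q, hq, ?_, ?_⟩
    · rw [h.mk_subst, ← hp.1, MulAut.inv_apply_self]; rfl
    · rw [h.mk_subst, ← hp.2, MulAut.inv_apply_self]; rfl
  · rintro ⟨q, hq, h0, h1⟩
    obtain ⟨φ, hφ, h⟩ := exists_reps_stdSub hq
    refine ⟨φ⁻¹, Submonoid.mem_inv.2 (by rw [inv_inv]; exact stdSub_le_IS hφ), ?_, ?_⟩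
    · rw [MulAut.inv_apply, MulEquiv.symm_apply_eq, ← h.mk_subst, h0]; rfl
    · rw [MulAut.inv_apply, MulEquiv.symm_apply_eq, ← h.mk_subst, h1]; rfl

/-! ### Short words of regular languages -/

/-- Pumping: a nonempty language with finitely many residuals contains a word whose length is at
most their number. -/
theorem Recog.exists_short {A σ : Type*} [Finite σ] {P : List A → Prop} (h : Recog P σ)
    (hP : ∃ l, P l) : ∃ l, P l ∧ l.length ≤ Nat.card σ := by
  classical
  obtain ⟨f, hf⟩ := h
  have hex : ∃ n, ∃ l, P l ∧ l.length = n := by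
    obtain ⟨l, hl⟩ := hP
    exact ⟨_, l, hl, rfl⟩
  obtain ⟨l, hl, hn⟩ := Nat.find_spec hex
  refine ⟨l, hl, ?_⟩
  by_contra hlt
  push Not at hlt
  have := Fintype.ofFinite σ
  obtain ⟨i, j, hij, hfij⟩ := Fintype.exists_ne_map_eq_of_card_lt
    (fun i : Fin (l.length + 1) => f (l.take i)) (by
      rw [← Nat.card_eq_fintype_card, Fintype.card_fin]; omega)
  have key : ∀ i j : Fin (l.length + 1), i < j → f (l.take i) = f (l.take j) → False := by
    intro i j hij hfij
    have h1 : P (l.take i ++ l.drop j) := by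
      rw [hf _ _ hfij, List.take_append_drop]
      exact hl
    have h2 := Nat.find_min' hex ⟨_, h1, rfl⟩
    rw [← hn, List.length_append, List.length_take, List.length_drop] at h2
    have := j.2
    have : (i : ℕ) < j := hij
    omega
  rcases lt_or_gt_of_ne hij with h | h
  · exact key i j h hfij
  · exact key j i h hfij.symm

instance (q : ℕ) : Finite (Cls q) := inferInstanceAs (Finite ((Fin 2 → FinRel q) → FinRel q))

/-- A finite set sufficient to describe the residuals of the languages attached to the decision
problems. -/
abbrev Residual (N : ℕ) : Type := (Fin N → StateCode N) × StateCode N × Set (StateCode N)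

instance (N : ℕ) : Finite (Residual N) := by
  have h : Finite (StateCode N) := inferInstance
  have h1 : Finite (Fin N → StateCode N) := inferInstance
  have h2 : Finite (Set (StateCode N)) := inferInstance
  exact Finite.instProd

theorem Recog.residual_of_state {A : Type*} {P : List A → Prop} {N : ℕ}
    (h : Recog P (StateCode N)) : Recog P (Residual N) :=
  h.embedding ⟨fun s => (fun _ _ => none, s, ∅), fun s t h => by simpa using h⟩

theorem Recog.residual_of_pair {A : Type*} {P : List A → Prop} {N : ℕ}
    (h : Recog P (StateCode N × Set (StateCode N))) : Recog P (Residual N) :=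
  h.embedding ⟨fun s => (fun _ _ => none, s), fun s t h => by simpa using h⟩

theorem Recog.residual_of_tuple {A : Type*} {P : List A → Prop} {N : ℕ}
    (h : Recog P (Fin N → StateCode N)) : Recog P (Residual N) :=
  h.embedding ⟨fun s => (s, fun _ => none, ∅), fun s t h => by simpa using h⟩

/-- The number of relations on `N` points. -/
def cardRel (N : ℕ) : ℕ := (2 ^ N) ^ N

/-- The number of classes of positive words. -/
def cardCls (N : ℕ) : ℕ := cardRel N ^ cardRel N ^ 2

/-- The number of state descriptions. -/
def cardState (N : ℕ) : ℕ :=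
  (((2 + cardCls N * (2 * cardCls N)) * 2 + 1) ^ N + 1) ^ N

/-- The number of residual descriptions. -/
def cardResidual (N : ℕ) : ℕ := cardState N ^ N * (cardState N * 2 ^ cardState N)

theorem nat_card_prop : Nat.card Prop = 2 := by
  rw [Nat.card_eq_fintype_card]; rfl

theorem nat_card_cls (N : ℕ) : Nat.card (Cls N) = cardCls N := by
  have h : Nat.card (FinRel N) = cardRel N := by
    rw [Nat.card_fun, Nat.card_fun, nat_card_prop, Nat.card_fin, cardRel]
  change Nat.card ((Fin 2 → FinRel N) → FinRel N) = _
  have e : ∀ (X Y : Type) [Finite X], Nat.card (X → Y) = Nat.card Y ^ Nat.card X :=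
    fun X Y _ => Nat.card_fun
  rw [e (Fin 2 → FinRel N) (FinRel N), e (Fin 2) (FinRel N), h, Nat.card_fin, cardCls]

theorem nat_card_stateCode (N : ℕ) : Nat.card (StateCode N) = cardState N := by
  rw [Nat.card_fun, Finite.card_option, Nat.card_fun, Finite.card_option, Nat.card_prod,
    Nat.card_sum, Nat.card_prod, Nat.card_prod, nat_card_cls, Nat.card_fin, Nat.card_fin, cardState]
  simp

theorem nat_card_residual (N : ℕ) : Nat.card (Residual N) = cardResidual N := by
  rw [Nat.card_prod, Nat.card_prod, Nat.card_fun, nat_card_stateCode, Nat.card_fin, cardResidual]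
  congr 2
  change Nat.card (StateCode N → Prop) = _
  rw [Nat.card_fun, nat_card_prop, nat_card_stateCode]

/-! ### Runs of automata -/

/-- The transitions of automata given as data. -/
abbrev Edge : Type := ℕ × WordPair × ℕ

/-- The state reached by following a list of transitions, if they are consecutive. -/
def runState (p : ℕ) (es : List Edge) : Option ℕ :=
  es.foldl (fun o e => if o = some e.1 then some e.2.2 else none) (some p)

theorem foldl_none (es : List Edge) :
    es.foldl (fun o e => if o = some e.1 then some e.2.2 else none) none = none := by
  induction es with
  | nil => rfl
  | cons e es ih => simpa using ih

theorem runState_cons {p q : ℕ} {e : Edge} {es : List Edge} :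
    runState p (e :: es) = some q ↔ p = e.1 ∧ runState e.2.2 es = some q := by
  rw [runState, List.foldl_cons]
  by_cases h : p = e.1
  · rw [if_pos (by rw [h])]
    simp [h, runState]
  · rw [if_neg (by simpa using h), foldl_none]
    simp [h]

theorem runState_concat (p : ℕ) (es : List Edge) (e : Edge) :
    runState p (es ++ [e]) = none ∨ runState p (es ++ [e]) = some e.2.2 := by
  rw [runState, List.foldl_append, List.foldl_cons, List.foldl_nil]
  split_ifs <;> simp

theorem runState_append (p : ℕ) (es es' : List Edge) :
    runState p (es ++ es') =
      es'.foldl (fun o e => if o = some e.1 then some e.2.2 else none) (runState p es) := by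
  rw [runState, List.foldl_append]; rfl

/-- The product of the labels along a list of transitions. -/
def label (es : List Edge) : WordPair := es.foldr (fun e p => e.2.1.comp p) WordPair.id

theorem reps_label {M : Submonoid (MulAut F2)} {es : List Edge}
    (h : ∀ e ∈ es, ∃ φ ∈ M, Reps e.2.1 φ) : ∃ φ ∈ M, Reps (label es) φ := by
  induction es with
  | nil => exact ⟨1, one_mem _, reps_id⟩
  | cons e es ih =>
    obtain ⟨φ, hφ, h1⟩ := h e List.mem_cons_self
    obtain ⟨ψ, hψ, h2⟩ := ih fun e he => h e (List.mem_cons_of_mem _ he)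
    exact ⟨φ * ψ, mul_mem hφ hψ, h1.comp h2⟩

/-- The automorphisms recognized by an automaton, in terms of lists of transitions. -/
theorem mem_auts_iff {M : Submonoid (MulAut F2)} {A : AutomatonCode} {μ : MulAut F2} :
    μ ∈ A.auts M ↔ ∃ es : List Edge, (∀ e ∈ es, e ∈ A.2.2) ∧
      (∀ e ∈ es, ∃ φ ∈ M, Reps e.2.1 φ) ∧ (∃ q ∈ A.2.1, runState A.1 es = some q) ∧
      Reps (label es) μ := by
  have h1 : ∀ {p q : ℕ} {m : M}, AutPath (A.edges M) p m q → ∃ es : List Edge,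
      (∀ e ∈ es, e ∈ A.2.2) ∧ (∀ e ∈ es, ∃ φ ∈ M, Reps e.2.1 φ) ∧ runState p es = some q ∧
      Reps (label es) m := by
    intro p q m h
    induction h with
    | nil p => exact ⟨[], by simp, by simp, rfl, reps_id⟩
    | @cons p q r x m h _ ih =>
      obtain ⟨es, he1, he2, he3, he4⟩ := ih
      obtain ⟨y, z, hm, hy, hz⟩ := h
      have hr : Reps (y, z) (x : MulAut F2) := ⟨hy, hz⟩
      refine ⟨(p, (y, z), q) :: es, ?_, ?_, ?_, ?_⟩
      · exact List.forall_mem_cons.2 ⟨hm, he1⟩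
      · exact List.forall_mem_cons.2 ⟨⟨x, x.2, hr⟩, he2⟩
      · exact runState_cons.2 ⟨rfl, he3⟩
      · exact hr.comp he4
  have h2 : ∀ (es : List Edge) (p q : ℕ), (∀ e ∈ es, e ∈ A.2.2) →
      (∀ e ∈ es, ∃ φ ∈ M, Reps e.2.1 φ) → runState p es = some q →
      ∃ m : M, AutPath (A.edges M) p m q ∧ Reps (label es) m := by
    intro es
    induction es with
    | nil =>
      intro p q _ _ h
      obtain rfl : p = q := by simpa [runState] using h
      exact ⟨1, .nil p, reps_id⟩
    | cons e es ih =>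
      intro p q he1 he2 h
      obtain ⟨rfl, h'⟩ := runState_cons.1 h
      rw [List.forall_mem_cons] at he1 he2
      obtain ⟨m, hm, hl⟩ := ih _ _ he1.2 he2.2 h'
      obtain ⟨φ, hφ, hr⟩ := he2.1
      exact ⟨(⟨φ, hφ⟩ : M) * m, .cons (x := (⟨φ, hφ⟩ : M)) ⟨e.2.1.1, e.2.1.2, he1.1, hr.1, hr.2⟩ hm,
        Reps.comp hr hl⟩
  constructor
  · rintro ⟨m, ⟨q, hq, hm⟩, rfl⟩
    obtain ⟨es, he1, he2, he3, he4⟩ := h1 hm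
    exact ⟨es, he1, he2, ⟨q, hq, he3⟩, he4⟩
  · rintro ⟨es, he1, he2, ⟨q, hq, he3⟩, he4⟩
    obtain ⟨m, hm, hl⟩ := h2 es _ _ he1 he2 he3
    exact ⟨m, ⟨q, hq, hm⟩, hl.unique he4⟩

/-! ### Bounding the search -/

/-- A bound for the lengths, the numbers of words and the sizes of hulls occurring in the automata
for a pair of lists of words. -/
def sizeBound (K H : List Word) : ℕ :=
  3 * (K.flatten.length + H.flatten.length + K.length + H.length + 1)

theorem sizeBound_flipB (K H : List Word) :
    sizeBound (K.map flipB) (H.map flipB) = sizeBound K H := by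
  simp only [sizeBound, flatten_length_map_flipB, List.length_map]

theorem exists_autW {φ : MulAut F2} (hφ : φ ∈ IS) : ∃ w, φ = autW w := by
  replace hφ := IS_le_stdSub hφ
  unfold stdSub at hφ
  induction hφ using Submonoid.closure_induction with
  | mem g hg =>
    rcases hg with rfl | rfl | rfl
    · exact ⟨[.L], by simp [autW, Gen.aut]⟩
    · exact ⟨[.I, .L, .I], by simp [autW, Gen.aut, autL', mul_assoc]⟩
    · exact ⟨[.E], by simp [autW, Gen.aut]⟩
  | one => exact ⟨[], rfl⟩
  | mul φ ψ _ _ h h' =>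
    obtain ⟨w, rfl⟩ := h
    obtain ⟨w', rfl⟩ := h'
    exact ⟨w' ++ w, (autW_append _ _).symm⟩

/-- If the property `Q K H` of inverses of products of generators is regular, and compatible with
the involution `iota`, then the property holds for an element of a rational subset of `IS` or `IS⁻¹`
only if it holds for the label of a short path. -/
theorem exists_short_run {Q : List Word → List Word → MulAut F2 → Prop}
    (hreg : ∀ K H, Recog (fun w => Q K H (autW w)⁻¹) (Residual (sizeBound K H)))
    (hflip : ∀ K H φ, Q K H (iota * φ * iota) ↔ Q (K.map flipB) (H.map flipB) φ)
    {M : Submonoid (MulAut F2)} (hM : M = IS ∨ M = IS⁻¹) (K H : List Word) (A : AutomatonCode) :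
    (∃ μ ∈ A.auts M, Q K H μ) ↔ ∃ es : List Edge,
      es.length ≤ 2 * (A.2.2.length + 1) * cardResidual (sizeBound K H) ∧
      (∀ e ∈ es, e ∈ A.2.2) ∧ (∀ e ∈ es, ∃ φ ∈ M, Reps e.2.1 φ) ∧
      (∃ q ∈ A.2.1, runState A.1 es = some q) ∧ ∃ μ, Reps (label es) μ ∧ Q K H μ := by
  classical
  constructor
  swap
  · rintro ⟨es, -, h1, h2, h3, μ, h4, h5⟩
    exact ⟨μ, mem_auts_iff.2 ⟨es, h1, h2, h3, h4⟩, h5⟩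
  rintro ⟨μ, hμ, hQ⟩
  obtain ⟨es, h1, h2, h3, h4⟩ := mem_auts_iff.1 hμ
  let A' : Type := {e : Edge // e ∈ A.2.2 ∧ ∃ φ ∈ M, Reps e.2.1 φ}
  have hfin : Finite A' := (A.2.2.finite_toSet.subset fun e he => he.1).to_subtype
  have hcard : Nat.card A' ≤ A.2.2.length := by
    refine (Nat.card_le_card_of_injective
      (fun e : A' => (⟨e.1, List.mem_toFinset.2 e.2.1⟩ : {e // e ∈ A.2.2.toFinset}))
      fun e e' h => Subtype.ext (Subtype.mk.inj h)).trans ?_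
    rw [Nat.card_eq_fintype_card, Fintype.card_coe]
    exact List.toFinset_card_le _
  choose φ hφM hφ using fun e : A' => e.2.2
  let aut : List A' → MulAut F2 := fun es => (es.map φ).prod
  have haut : ∀ es : List A', Reps (label (es.map Subtype.val)) (aut es) := by
    intro es
    induction es with
    | nil => exact reps_id
    | cons e es ih =>
      have := (hφ e).comp ih
      simpa [aut, label] using this
  have hregA : Recog (fun es : List A' => Q K H (aut es)) (Residual (sizeBound K H)) := by
    rcases hM with rfl | rfl
    -- in `IS`, pass to inverses by the involution; in `IS⁻¹`, the labels are inverses of products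
    -- of generators already
    · choose d hd using fun e : A' => exists_autW (hφM e)
      have h : ∀ es : List A', aut es =
          iota * (autW (es.flatMap fun e => (d e).reverse.flatMap Gen.dual))⁻¹ * iota := by
        have h2 : iota⁻¹ = iota := inv_eq_of_mul_eq_one_left iota_mul_iota
        intro es
        induction es with
        | nil => simp [aut, autW]
        | cons e es ih =>
          have h3 : aut (e :: es) = φ e * aut es := by simp [aut]
          rw [h3, ih, List.flatMap_cons, autW_append, autW_reverse_dual, hd e]
          simp only [mul_inv_rev, h2, inv_inv]
          simp only [← mul_assoc, iota_mul_iota, one_mul]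
      rw [← sizeBound_flipB]
      refine ((hreg (K.map flipB) (H.map flipB)).flatMap
        fun e : A' => (d e).reverse.flatMap Gen.dual).congr fun es => ?_
      rw [h, hflip]
    · choose d hd using fun e : A' => exists_autW (Submonoid.mem_inv.1 (hφM e))
      have h : ∀ es : List A', aut es = (autW (es.flatMap d))⁻¹ := by
        intro es
        induction es with
        | nil => simp [aut, autW]
        | cons e es ih =>
          have h3 : aut (e :: es) = φ e * aut es := by simp [aut]
          rw [h3, ih, List.flatMap_cons, autW_append, mul_inv_rev, ← hd, inv_inv]
      exact ((hreg K H).flatMap d).congr fun es => by rw [h]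
  -- the state reached is the target of the last transition, if the transitions are consecutive
  have hrun : Recog (fun es : List A' => ∃ q ∈ A.2.1, runState A.1 (es.map Subtype.val) = some q)
      (Bool × Option A') := by
    refine ⟨fun es => ((runState A.1 (es.map Subtype.val)).isSome, es.getLast?), ?_⟩
    intro es es' h z
    have hstate : runState A.1 (es.map Subtype.val) = runState A.1 (es'.map Subtype.val) := by
      obtain ⟨hs, hl⟩ := Prod.mk.inj h
      rcases List.eq_nil_or_concat' es with rfl | ⟨v, e, rfl⟩ <;>
        rcases List.eq_nil_or_concat' es' with rfl | ⟨v', e', rfl⟩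
      · rfl
      · simp at hl
      · simp at hl
      · obtain rfl : e = e' := by simpa using hl
        simp only [List.map_append, List.map_cons, List.map_nil] at hs ⊢
        rcases runState_concat A.1 (v.map Subtype.val) e.1 with h1 | h1 <;>
          rcases runState_concat A.1 (v'.map Subtype.val) e.1 with h2 | h2 <;>
          simp [h1, h2] at hs ⊢
    simp only [List.map_append, runState_append, hstate]
  obtain ⟨l, ⟨hl1, hl2⟩, hlen⟩ := (hrun.and hregA).exists_short (by
    refine ⟨es.attach.map fun e => ⟨e.1, h1 e.1 e.2, h2 e.1 e.2⟩, ?_⟩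
    have hmap : (es.attach.map fun e => (⟨e.1, h1 e.1 e.2, h2 e.1 e.2⟩ : A')).map Subtype.val =
        es := by
      rw [List.map_map]
      exact es.attach_map_subtype_val
    refine ⟨by rw [hmap]; exact h3, ?_⟩
    have := haut (es.attach.map fun e => ⟨e.1, h1 e.1 e.2, h2 e.1 e.2⟩)
    rw [hmap] at this
    rwa [this.unique h4])
  refine ⟨l.map Subtype.val, ?_, ?_, ?_, hl1, aut l, haut l, hl2⟩
  · rw [List.length_map]
    refine hlen.trans ?_
    rw [Nat.card_prod, Nat.card_prod, Finite.card_option, nat_card_residual]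
    have : Nat.card Bool = 2 := by simp
    rw [this]
    gcongr
  · intro e he
    obtain ⟨e, -, rfl⟩ := List.mem_map.1 he
    exact e.2.1
  · intro e he
    obtain ⟨e, -, rfl⟩ := List.mem_map.1 he
    exact e.2.2

/-! ### The properties to be decided -/

theorem mem_map_aut {H : Subgroup F2} {μ : MulAut F2} {x : F2} :
    x ∈ H.map μ.toMonoidHom ↔ μ⁻¹ x ∈ H := by
  constructor
  · rintro ⟨y, hy, rfl⟩
    simpa using hy
  · intro h
    exact ⟨_, h, by simp⟩

theorem map_fgSubgroup {μ : MulAut F2} {p : WordPair} (h : Reps p μ) (H : List Word) :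
    (fgSubgroup H).map μ.toMonoidHom = fgSubgroup (H.map p.subst) := by
  rw [fgSubgroup, fgSubgroup, MonoidHom.map_closure]
  congr 1
  ext y
  constructor
  · rintro ⟨_, ⟨w, hw, rfl⟩, rfl⟩
    exact ⟨_, List.mem_map_of_mem hw, (h.mk_subst w).symm⟩
  · rintro ⟨w, hw, rfl⟩
    obtain ⟨w', hw', rfl⟩ := List.mem_map.1 hw
    exact ⟨_, ⟨w', hw', rfl⟩, (h.mk_subst w').symm⟩

theorem map_iota_fgSubgroup_flipB (K : List Word) :
    (fgSubgroup (K.map flipB)).map iota.toMonoidHom = fgSubgroup K := by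
  have h : iota⁻¹ = iota := inv_eq_of_mul_eq_one_left iota_mul_iota
  ext x
  rw [mem_map_aut, h, mem_fgSubgroup_flipB, iota_iota]

theorem map_iota_conj (H : List Word) (φ : MulAut F2) :
    (fgSubgroup H).map (iota * φ * iota).toMonoidHom =
      ((fgSubgroup (H.map flipB)).map φ.toMonoidHom).map iota.toMonoidHom := by
  have h : iota⁻¹ = iota := inv_eq_of_mul_eq_one_left iota_mul_iota
  ext x
  rw [mem_map_aut, mem_map_aut, mem_map_aut, mem_fgSubgroup_flipB, h, mul_inv_rev, mul_inv_rev, h]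
  rfl

theorem iota_toMonoidHom_injective : Function.Injective iota.toMonoidHom := iota.injective

theorem conjSubgroup_map (w : F2) (L : Subgroup F2) (φ : MulAut F2) :
    conjSubgroup (φ w) (L.map φ.toMonoidHom) = (conjSubgroup w L).map φ.toMonoidHom := by
  ext x
  rw [mem_conjSubgroup, mem_map_aut, mem_map_aut, mem_conjSubgroup]
  simp

theorem conjSubgroup_le_iff {w : F2} {K : List Word} {L : Subgroup F2} :
    conjSubgroup w (fgSubgroup K) ≤ L ↔ ∀ u ∈ K, w⁻¹ * FreeGroup.mk u * w ∈ L := by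
  have h : conjSubgroup w (fgSubgroup K) ≤ L ↔
      fgSubgroup K ≤ L.comap (MulAut.conj w⁻¹).toMonoidHom := Subgroup.map_le_iff_le_comap
  rw [h, fgSubgroup_le_iff]
  refine forall₂_congr fun u _ => ?_
  rw [Subgroup.mem_comap]
  simp

/-- `K ≤ μ(H)`. -/
def ImageContains (K H : List Word) (μ : MulAut F2) : Prop :=
  fgSubgroup K ≤ (fgSubgroup H).map μ.toMonoidHom

/-- A conjugate of `K` is contained in `μ(H)`. -/
def ImageContainsConj (K H : List Word) (μ : MulAut F2) : Prop :=
  ∃ w : F2, conjSubgroup w (fgSubgroup K) ≤ (fgSubgroup H).map μ.toMonoidHom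

/-- `K = μ(H)`. -/
def ImageEq (K H : List Word) (μ : MulAut F2) : Prop :=
  fgSubgroup K = (fgSubgroup H).map μ.toMonoidHom

/-- A conjugate of `K` is equal to `μ(H)`. -/
def ImageEqConj (K H : List Word) (μ : MulAut F2) : Prop :=
  ∃ w : F2, conjSubgroup w (fgSubgroup K) = (fgSubgroup H).map μ.toMonoidHom

/-- Each of the elements `us` has a conjugate in `μ(H)`. -/
def ImageMeetsConj (us H : List Word) (μ : MulAut F2) : Prop :=
  ∀ u ∈ us, ∃ w : F2, w⁻¹ * FreeGroup.mk u * w ∈ (fgSubgroup H).map μ.toMonoidHom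

section

variable (K H : List Word) (φ : MulAut F2)

theorem imageContains_flip : ImageContains K H (iota * φ * iota) ↔
    ImageContains (K.map flipB) (H.map flipB) φ := by
  rw [ImageContains, map_iota_conj, ← map_iota_fgSubgroup_flipB K,
    Subgroup.map_le_map_iff_of_injective iota_toMonoidHom_injective]
  rfl

theorem imageEq_flip : ImageEq K H (iota * φ * iota) ↔
    ImageEq (K.map flipB) (H.map flipB) φ := by
  rw [ImageEq, map_iota_conj, ← map_iota_fgSubgroup_flipB K,
    (Subgroup.map_injective iota_toMonoidHom_injective).eq_iff]
  rfl

theorem imageContainsConj_flip : ImageContainsConj K H (iota * φ * iota) ↔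
    ImageContainsConj (K.map flipB) (H.map flipB) φ := by
  rw [ImageContainsConj, map_iota_conj, ← map_iota_fgSubgroup_flipB K, iota.surjective.exists]
  refine exists_congr fun w => ?_
  rw [conjSubgroup_map, Subgroup.map_le_map_iff_of_injective iota_toMonoidHom_injective]

theorem imageEqConj_flip : ImageEqConj K H (iota * φ * iota) ↔
    ImageEqConj (K.map flipB) (H.map flipB) φ := by
  rw [ImageEqConj, map_iota_conj, ← map_iota_fgSubgroup_flipB K, iota.surjective.exists]
  refine exists_congr fun w => ?_
  rw [conjSubgroup_map, (Subgroup.map_injective iota_toMonoidHom_injective).eq_iff]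

theorem imageMeetsConj_flip : ImageMeetsConj K H (iota * φ * iota) ↔
    ImageMeetsConj (K.map flipB) (H.map flipB) φ := by
  have h : iota⁻¹ = iota := inv_eq_of_mul_eq_one_left iota_mul_iota
  simp only [ImageMeetsConj, List.forall_mem_map, map_iota_conj, mk_flipB]
  refine forall₂_congr fun u _ => ?_
  rw [iota.surjective.exists]
  refine exists_congr fun w => ?_
  rw [mem_map_aut (μ := iota), h, map_mul, map_mul, map_inv, iota_iota]

theorem length_le_sizeBound : K.length + 1 ≤ sizeBound K H ∧ H.length + 1 ≤ sizeBound K H ∧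
    3 * K.flatten.length ≤ sizeBound K H ∧ 3 * H.flatten.length ≤ sizeBound K H ∧
    K.flatten.length < sizeBound K H ∧ H.flatten.length < sizeBound K H := by
  simp only [sizeBound]
  omega

theorem imageContains_iff : ImageContains K H φ ↔
    ∀ u ∈ K, φ⁻¹ (FreeGroup.mk u) ∈ fgSubgroup H := by
  simp only [ImageContains, fgSubgroup_le_iff, mem_map_aut]

theorem imageContainsConj_iff : ImageContainsConj K H φ ↔
    ∃ x : F2, ∀ u ∈ K, x⁻¹ * φ⁻¹ (FreeGroup.mk u) * x ∈ fgSubgroup H := by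
  simp only [ImageContainsConj, conjSubgroup_le_iff, mem_map_aut]
  rw [φ.surjective.exists]
  simp

theorem imageEq_iff : ImageEq K H φ ↔
    (∀ u ∈ K, φ⁻¹ (FreeGroup.mk u) ∈ fgSubgroup H) ∧
      ∀ h ∈ H, φ (FreeGroup.mk h) ∈ fgSubgroup K := by
  rw [ImageEq, le_antisymm_iff, Subgroup.map_le_iff_le_comap, fgSubgroup_le_iff,
    fgSubgroup_le_iff]
  simp only [mem_map_aut, Subgroup.mem_comap]
  rfl

/-- For finitely generated subgroups, mutual containment up to conjugacy is conjugacy. -/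
theorem imageEqConj_iff : ImageEqConj K H φ ↔
    (∃ x : F2, ∀ u ∈ K, x⁻¹ * φ⁻¹ (FreeGroup.mk u) * x ∈ fgSubgroup H) ∧
      ∃ x : F2, ∀ h ∈ H, x⁻¹ * φ (FreeGroup.mk h) * x ∈ fgSubgroup K := by
  rw [← imageContainsConj_iff]
  have key : ∀ x : F2, (∀ h ∈ H, x⁻¹ * φ (FreeGroup.mk h) * x ∈ fgSubgroup K) ↔
      conjSubgroup x ((fgSubgroup H).map φ.toMonoidHom) ≤ fgSubgroup K := by
    intro x
    obtain ⟨y, rfl⟩ := φ.surjective x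
    rw [conjSubgroup_map, Subgroup.map_le_iff_le_comap, conjSubgroup_le_iff]
    simp only [Subgroup.mem_comap]
    simp
  simp only [key]
  constructor
  · rintro ⟨w, h⟩
    refine ⟨⟨w, h.le⟩, w⁻¹, ?_⟩
    rw [← h, ← conjSubgroup_mul, mul_inv_cancel, conjSubgroup_of_mem (one_mem _)]
  · rintro ⟨⟨w, hw⟩, x, hx⟩
    have h1 : conjSubgroup (w * x) (fgSubgroup K) ≤
        conjSubgroup x ((fgSubgroup H).map φ.toMonoidHom) := by
      rw [conjSubgroup_mul]
      exact conjSubgroup_mono hw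
    have h2 := conjSubgroup_eq_of_le (h1.trans hx)
    have h3 : conjSubgroup x ((fgSubgroup H).map φ.toMonoidHom) = fgSubgroup K :=
      le_antisymm hx (h2 ▸ h1)
    refine ⟨x⁻¹, ?_⟩
    rw [← h3, ← conjSubgroup_mul, mul_inv_cancel, conjSubgroup_of_mem (one_mem _)]

theorem recog_imageContains :
    Recog (fun w => ImageContains K H (autW w)⁻¹) (Residual (sizeBound K H)) := by
  obtain ⟨h1, h2, h3, h4, h5, h6⟩ := length_le_sizeBound K H
  refine ((recog_mem K H (by omega) (fun u hu => ?_) h6).congr fun w => ?_).residual_of_state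
  · exact (length_le_of_mem hu).trans h5.le
  · rw [imageContains_iff, inv_inv]

theorem recog_imageContainsConj :
    Recog (fun w => ImageContainsConj K H (autW w)⁻¹) (Residual (sizeBound K H)) := by
  obtain ⟨h1, h2, h3, h4, h5, h6⟩ := length_le_sizeBound K H
  refine ((recog_conj K H h1 h3 h6).congr fun w => ?_).residual_of_state
  rw [imageContainsConj_iff, inv_inv]

theorem recog_imageEq :
    Recog (fun w => ImageEq K H (autW w)⁻¹) (Residual (sizeBound K H)) := by
  obtain ⟨h1, h2, h3, h4, h5, h6⟩ := length_le_sizeBound K H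
  refine (((recog_mem K H (by omega) (fun u hu => ?_) h6).and
    (recog_inv_mem H K (by omega) (fun u hu => ?_) h5)).congr fun w => ?_).residual_of_pair
  · exact (length_le_of_mem hu).trans h5.le
  · exact (length_le_of_mem hu).trans h6.le
  · rw [imageEq_iff, inv_inv]

theorem recog_imageEqConj :
    Recog (fun w => ImageEqConj K H (autW w)⁻¹) (Residual (sizeBound K H)) := by
  obtain ⟨h1, h2, h3, h4, h5, h6⟩ := length_le_sizeBound K H
  refine (((recog_conj K H h1 h3 h6).and
    (recog_inv_conj H K h2 h4 h5)).congr fun w => ?_).residual_of_pair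
  rw [imageEqConj_iff, inv_inv]

theorem recog_imageMeetsConj :
    Recog (fun w => ImageMeetsConj K H (autW w)⁻¹) (Residual (sizeBound K H)) := by
  obtain ⟨h1, h2, h3, h4, h5, h6⟩ := length_le_sizeBound K H
  have hne : Nonempty (StateCode (sizeBound K H)) := ⟨fun _ => none⟩
  have h : ∀ i : Fin (sizeBound K H), Recog (fun w => ∀ u, K[(i : ℕ)]? = some u →
      ∃ x : F2, ∀ v ∈ [u], x⁻¹ * autW w (FreeGroup.mk v) * x ∈ fgSubgroup H)
      (StateCode (sizeBound K H)) := by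
    intro i
    cases hi : K[(i : ℕ)]? with
    | none => exact (Recog.const True).congr fun w => by simp
    | some u =>
      have hu := length_le_of_mem (List.mem_of_getElem? hi)
      have hK : 1 ≤ K.length := List.length_pos_of_mem (List.mem_of_getElem? hi)
      refine (recog_conj [u] H ?_ ?_ h6).congr fun w => by simp
      · simp; omega
      · simp; omega
  refine ((Recog.forall' h).congr fun w => ?_).residual_of_tuple
  simp only [ImageMeetsConj, mem_map_aut, inv_inv, List.forall_mem_singleton]
  constructor
  · intro h u hu
    obtain ⟨n, hn, rfl⟩ := List.getElem_of_mem hu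
    obtain ⟨x, hx⟩ := h ⟨n, by omega⟩ _ (List.getElem?_eq_getElem hn)
    refine ⟨(autW w)⁻¹ x, ?_⟩
    simpa using hx
  · intro h i u hu
    obtain ⟨x, hx⟩ := h u (List.mem_of_getElem? hu)
    refine ⟨autW w x, ?_⟩
    simpa using hx

end

/-! ### Testing the properties with words -/

theorem mk_conj (w u : Word) : (FreeGroup.mk (FreeGroup.invRev w ++ u ++ w) : F2) =
    (FreeGroup.mk w)⁻¹ * FreeGroup.mk u * FreeGroup.mk w := by
  rw [mk_append, mk_append, FreeGroup.inv_mk]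

section

variable {p : WordPair} {μ : MulAut F2}

theorem imageContains_iff_words (hp : Reps p μ) (K H : List Word) :
    ImageContains K H μ ↔
    ∀ u ∈ K, FreeGroup.mk u ∈ fgSubgroup (H.map p.subst) := by
  rw [ImageContains, map_fgSubgroup hp, fgSubgroup_le_iff]

theorem imageEq_iff_words (hp : Reps p μ) (K H : List Word) :
    ImageEq K H μ ↔
    (∀ u ∈ K, FreeGroup.mk u ∈ fgSubgroup (H.map p.subst)) ∧
      ∀ h ∈ H.map p.subst, FreeGroup.mk h ∈ fgSubgroup K := by
  rw [ImageEq, map_fgSubgroup hp, le_antisymm_iff, fgSubgroup_le_iff, fgSubgroup_le_iff]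

theorem imageContainsConj_iff_words (hp : Reps p μ) (K H : List Word) :
    ImageContainsConj K H μ ↔
    ∃ w : Word, w.length ≤ K.flatten.length + (H.map p.subst).flatten.length ∧
      ∀ u ∈ K, FreeGroup.mk (FreeGroup.invRev w ++ u ++ w) ∈ fgSubgroup (H.map p.subst) := by
  simp only [mk_conj, ← conjSubgroup_le_iff]
  rw [ImageContainsConj, map_fgSubgroup hp]
  constructor
  · rintro ⟨w, hw⟩
    obtain ⟨w', hl, h, hh, h'⟩ := exists_short_conjugator_subgroup hw
    refine ⟨w', hl, ?_⟩
    rw [h']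
    exact (conjSubgroup_mono hw).trans (conjSubgroup_of_mem hh).le
  · rintro ⟨w, -, hw⟩
    exact ⟨_, hw⟩

theorem imageEqConj_iff_words (hp : Reps p μ) (K H : List Word) :
    ImageEqConj K H μ ↔
    ∃ w : Word, w.length ≤ K.flatten.length + (H.map p.subst).flatten.length ∧
      (∀ u ∈ K, FreeGroup.mk (FreeGroup.invRev w ++ u ++ w) ∈ fgSubgroup (H.map p.subst)) ∧
      ∀ h ∈ H.map p.subst, FreeGroup.mk (w ++ h ++ FreeGroup.invRev w) ∈ fgSubgroup K := by
  have key : ∀ w : Word, (∀ h ∈ H.map p.subst,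
      FreeGroup.mk (w ++ h ++ FreeGroup.invRev w) ∈ fgSubgroup K) ↔
      fgSubgroup (H.map p.subst) ≤ conjSubgroup (FreeGroup.mk w) (fgSubgroup K) := by
    intro w
    rw [fgSubgroup_le_iff]
    simp only [mem_conjSubgroup, mk_append, FreeGroup.inv_mk]
  simp only [key, mk_conj, ← conjSubgroup_le_iff, ← le_antisymm_iff]
  rw [ImageEqConj, map_fgSubgroup hp]
  constructor
  · rintro ⟨w, hw⟩
    obtain ⟨w', hl, h, hh, h'⟩ := exists_short_conjugator_subgroup hw.le
    refine ⟨w', hl, ?_⟩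
    rw [h', hw, conjSubgroup_of_mem hh]
  · rintro ⟨w, -, hw⟩
    exact ⟨_, hw⟩

theorem imageMeetsConj_iff_words (hp : Reps p μ) (K H : List Word) :
    ImageMeetsConj K H μ ↔
    ∀ u ∈ K, ∃ w : Word, w.length ≤ K.flatten.length + (H.map p.subst).flatten.length ∧
      FreeGroup.mk (FreeGroup.invRev w ++ u ++ w) ∈ fgSubgroup (H.map p.subst) := by
  rw [ImageMeetsConj, map_fgSubgroup hp]
  refine forall₂_congr fun u hu => ?_
  simp only [mk_conj]
  constructor
  · rintro ⟨w, hw⟩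
    by_cases hone : (FreeGroup.mk u : F2) = 1
    · exact ⟨[], by simp, by
        simp only [hone, mul_one, inv_mul_cancel]; exact one_mem _⟩
    · obtain ⟨h, hh, w', hw', hl⟩ := exists_short_conjugator hone hw
      have := length_le_of_mem hu
      refine ⟨w', by omega, ?_⟩
      rw [hw']
      have h1 := mul_mem (mul_mem (inv_mem hh) hw) hh
      have h2 : (w * h)⁻¹ * FreeGroup.mk u * (w * h) =
          h⁻¹ * (w⁻¹ * FreeGroup.mk u * w) * h := by group
      rwa [h2]
  · rintro ⟨w, -, hw⟩
    exact ⟨_, hw⟩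

end

/-! ### Primitive recursive tests -/

section

variable {α β : Type*} [Primcodable α] [Primcodable β]

theorem PrimrecPred.forall_mem {f : α → List β} {p : α → β → Prop} (hf : Primrec f)
    (hp : PrimrecPred fun x : α × β => p x.1 x.2) : PrimrecPred fun a => ∀ b ∈ f a, p a b :=
  (PrimrecRel.forall_mem_list (R := fun b a => p a b)
    (hp.comp (Primrec.snd.pair Primrec.fst))).comp hf Primrec.id

theorem PrimrecPred.exists_mem {f : α → List β} {p : α → β → Prop} (hf : Primrec f)
    (hp : PrimrecPred fun x : α × β => p x.1 x.2) : PrimrecPred fun a => ∃ b ∈ f a, p a b :=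
  (PrimrecRel.exists_mem_list (R := fun b a => p a b)
    (hp.comp (Primrec.snd.pair Primrec.fst))).comp hf Primrec.id

theorem PrimrecPred.imp {p q : α → Prop} (hp : PrimrecPred p) (hq : PrimrecPred q) :
    PrimrecPred fun a => p a → q a :=
  (hp.not.or hq).of_eq fun _ => by tauto

theorem Primrec.nat_pow {f g : α → ℕ} (hf : Primrec f) (hg : Primrec g) :
    Primrec fun a => f a ^ g a := by
  have h : Primrec₂ ((· ^ ·) : ℕ → ℕ → ℕ) := Primrec₂.unpaired'.1 Nat.Primrec.pow
  exact h.comp hf hg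

end

/-- The lists of length at most `n` with entries in a given list. -/
def listsUpTo {α : Type*} (l : List α) : ℕ → List (List α)
  | 0 => [[]]
  | n + 1 => [] :: l.flatMap fun x => (listsUpTo l n).map (x :: ·)

theorem mem_listsUpTo {α : Type*} {l : List α} {n : ℕ} {m : List α} :
    m ∈ listsUpTo l n ↔ m.length ≤ n ∧ ∀ x ∈ m, x ∈ l := by
  induction n generalizing m with
  | zero =>
    simp only [listsUpTo, List.mem_singleton, Nat.le_zero, List.length_eq_zero_iff]
    constructor
    · rintro rfl; simp
    · exact fun h => h.1
  | succ n ih =>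
    cases m with
    | nil => simp [listsUpTo]
    | cons x m =>
      simp only [listsUpTo, List.mem_cons, reduceCtorEq, List.mem_flatMap, List.mem_map,
        List.cons.injEq, false_or, ih, List.length_cons, forall_eq_or_imp,
        Nat.add_le_add_iff_right]
      constructor
      · rintro ⟨y, hy, m', ⟨h1, h2⟩, rfl, rfl⟩
        exact ⟨h1, hy, h2⟩
      · rintro ⟨h1, h2, h3⟩
        exact ⟨x, h2, m, ⟨h1, h3⟩, rfl, rfl⟩

theorem primrec_listsUpTo {α : Type*} [Primcodable α] :
    Primrec₂ (listsUpTo : List α → ℕ → List (List α)) := by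
  have h : Primrec₂ fun (l : List α) (n : ℕ) => n.rec (motive := fun _ => List (List α)) [[]]
      fun _ r => [] :: l.flatMap fun x => r.map (x :: ·) := by
    refine Primrec.nat_rec (g := fun (l : List α) (x : ℕ × List (List α)) =>
      [] :: l.flatMap fun y => x.2.map (y :: ·)) (Primrec.const _) ?_
    refine Primrec.list_cons.comp (Primrec.const _) (Primrec.list_flatMap Primrec.fst ?_)
    refine Primrec.list_map ((Primrec.snd.comp Primrec.snd).comp Primrec.fst) ?_
    exact Primrec.list_cons.comp (Primrec.snd.comp Primrec.fst) Primrec.snd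
  refine h.of_eq fun l n => ?_
  induction n with
  | zero => rfl
  | succ n ih => simp only [ih, listsUpTo]

/-! ### Membership in finitely generated subgroups -/

/-- The index of a signed letter in a table. -/
def letterIdx (x : Fin 2 × Bool) : ℕ := 2 * x.1 + if x.2 then 1 else 0

/-- The entry of a table at a signed letter and a point. -/
def lookup (T : List (List ℕ)) (x : Fin 2 × Bool) (v : ℕ) : ℕ := (T.getD (letterIdx x) []).getD v 0

/-- The point reached from `v` when a word is read according to a table. -/
def readTable (T : List (List ℕ)) (v : ℕ) (w : Word) : ℕ := w.foldl (fun v x => lookup T x v) v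

/-- The letters and their inverses. -/
def letters : List (Fin 2 × Bool) := [(0, false), (0, true), (1, false), (1, true)]

theorem mem_letters (x : Fin 2 × Bool) : x ∈ letters := by
  obtain ⟨c, s⟩ := x
  rcases two_letters c with rfl | rfl <;> cases s <;> simp [letters]

/-- The tables of the right size for `k` points. -/
def tables (k : ℕ) : List (List (List ℕ)) := listsUpTo (listsUpTo (List.range k) k) 4

/-- The table describes an action of `F2` on the numbers less than `k`. -/
def IsTable (k : ℕ) (T : List (List ℕ)) : Prop :=
  ∀ v ∈ List.range k, ∀ x ∈ letters, lookup T x v < k ∧ lookup T (x.1, !x.2) (lookup T x v) = v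

theorem IsTable.exists_hom {k : ℕ} {T : List (List ℕ)} (h : IsTable k T) :
    ∃ ρ : F2 →* Equiv.Perm (Fin k), ∀ (w : Word) (v : Fin k),
      (((ρ (FreeGroup.mk w))⁻¹ v : Fin k) : ℕ) = readTable T v w := by
  have h' : ∀ (x : Fin 2 × Bool) (v : Fin k),
      lookup T x v < k ∧ lookup T (x.1, !x.2) (lookup T x v) = v := fun x v =>
    h v (List.mem_range.2 v.2) x (mem_letters x)
  let σ : Fin 2 → Equiv.Perm (Fin k) := fun c =>
    { toFun := fun v => ⟨lookup T (c, false) v, (h' _ v).1⟩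
      invFun := fun v => ⟨lookup T (c, true) v, (h' _ v).1⟩
      left_inv := fun v => Fin.ext (h' (c, false) v).2
      right_inv := fun v => Fin.ext (h' (c, true) v).2 }
  refine ⟨FreeGroup.lift σ, fun w => ?_⟩
  induction w with
  | nil => intro v; simp [readTable, ← FreeGroup.one_eq_mk]
  | cons x w ih =>
    intro v
    have hx : (((FreeGroup.lift σ (letterVal x))⁻¹ v : Fin k) : ℕ) = lookup T x v := by
      obtain ⟨c, s⟩ := x
      cases s
      · simp [letterVal, σ]
      · simp only [letterVal, if_true, FreeGroup.lift_apply_of]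
        rfl
    rw [mk_cons, map_mul, mul_inv_rev, Equiv.Perm.mul_apply, ih, hx]
    rfl

theorem exists_isTable {k : ℕ} (ρ : F2 →* Equiv.Perm (Fin k)) :
    ∃ T ∈ tables k, IsTable k T ∧ ∀ (w : Word) (v : Fin k),
      readTable T v w = (((ρ (FreeGroup.mk w))⁻¹ v : Fin k) : ℕ) := by
  let T : List (List ℕ) := letters.map fun x =>
    List.ofFn fun v : Fin k => (((ρ (letterVal x))⁻¹ v : Fin k) : ℕ)
  have hl : ∀ (x : Fin 2 × Bool) (v : Fin k),
      lookup T x v = (((ρ (letterVal x))⁻¹ v : Fin k) : ℕ) := by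
    intro x v
    have : T.getD (letterIdx x) [] =
        List.ofFn fun v : Fin k => (((ρ (letterVal x))⁻¹ v : Fin k) : ℕ) := by
      obtain ⟨c, s⟩ := x
      rcases two_letters c with rfl | rfl <;> cases s <;> rfl
    rw [lookup, this, List.getD_eq_getElem _ _ (by simp)]
    simp
  refine ⟨T, ?_, ?_, ?_⟩
  · rw [tables, mem_listsUpTo]
    refine ⟨by simp [T, letters], fun l hl => ?_⟩
    obtain ⟨x, -, rfl⟩ := List.mem_map.1 hl
    rw [mem_listsUpTo]
    refine ⟨by simp, fun n hn => ?_⟩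
    obtain ⟨v, rfl⟩ := List.mem_ofFn.1 hn
    exact List.mem_range.2 (Fin.is_lt _)
  · intro v hv x _
    have h1 := hl x ⟨v, List.mem_range.1 hv⟩
    dsimp only at h1
    rw [h1, hl, letterVal_not]
    exact ⟨Fin.is_lt _, by simp⟩
  · intro w
    induction w with
    | nil => intro v; simp [readTable, ← FreeGroup.one_eq_mk]
    | cons x w ih =>
      intro v
      have h1 : readTable T v (x :: w) = readTable T (lookup T x v) w := rfl
      rw [h1, hl, ih, mk_cons, map_mul, mul_inv_rev, Equiv.Perm.mul_apply]

/-- Membership in a finitely generated subgroup can be tested in the permutation representations on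
few points. -/
theorem mem_fgSubgroup_iff_tables (u : Word) (gens : List Word) :
    FreeGroup.mk u ∈ fgSubgroup gens ↔
      ∀ k ∈ List.range (gens.flatten.length + u.length + 2),
        ∀ T ∈ tables k, IsTable k T → ∀ v ∈ List.range k,
          (∀ w ∈ gens, readTable T v w = v) → readTable T v u = v := by
  constructor
  · intro hu k _ T _ hT v hv hfix
    obtain ⟨ρ, hρ⟩ := hT.exists_hom
    have key : ∀ w : Word, readTable T v w = v ↔
        ρ (FreeGroup.mk w) ⟨v, List.mem_range.1 hv⟩ = ⟨v, List.mem_range.1 hv⟩ := by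
      intro w
      have := hρ w ⟨v, List.mem_range.1 hv⟩
      dsimp only at this
      rw [← this, eq_comm (a := ρ (FreeGroup.mk w) _), ← Equiv.Perm.inv_eq_iff_eq, Fin.ext_iff]
    rw [key]
    refine (fgSubgroup_le_iff (K := (MulAction.stabilizer (Equiv.Perm (Fin k))
      (⟨v, List.mem_range.1 hv⟩ : Fin k)).comap ρ)).2 ?_ hu
    exact fun w hw => (key w).1 (hfix w hw)
  · intro h
    by_contra hu
    obtain ⟨k, hk, ρ, v, hv, hne⟩ := exists_perm_of_notMem hu
    obtain ⟨T, hT, hT', hread⟩ := exists_isTable ρ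
    have key : ∀ w : Word, readTable T v w = v ↔ ρ (FreeGroup.mk w) v = v := by
      intro w
      rw [hread, eq_comm (a := ρ (FreeGroup.mk w) _), ← Equiv.Perm.inv_eq_iff_eq, Fin.ext_iff]
    exact hne ((key u).1 (h k (List.mem_range.2 (by omega)) T hT hT' v (List.mem_range.2 v.2)
      fun w hw => (key w).2 (hv w hw)))

theorem primrec_lookup : Primrec fun t : List (List ℕ) × (Fin 2 × Bool) × ℕ =>
    lookup t.1 t.2.1 t.2.2 := by
  have hidx : Primrec letterIdx := Primrec.dom_finite _
  exact (Primrec.list_getD 0).comp ((Primrec.list_getD []).comp Primrec.fst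
    (hidx.comp (Primrec.fst.comp Primrec.snd))) (Primrec.snd.comp Primrec.snd)

theorem primrec_readTable : Primrec fun t : List (List ℕ) × ℕ × Word =>
    readTable t.1 t.2.1 t.2.2 := by
  refine Primrec.list_foldl (h := fun t (y : ℕ × (Fin 2 × Bool)) => lookup t.1 y.2 y.1)
    (Primrec.snd.comp Primrec.snd) (Primrec.fst.comp Primrec.snd) ?_
  exact primrec_lookup.comp ((Primrec.fst.comp Primrec.fst).pair
    ((Primrec.snd.comp Primrec.snd).pair (Primrec.fst.comp Primrec.snd)))

theorem primrecPred_isTable : PrimrecPred fun t : ℕ × List (List ℕ) => IsTable t.1 t.2 := by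
  refine PrimrecPred.forall_mem (Primrec.list_range.comp Primrec.fst)
    (PrimrecPred.forall_mem (Primrec.const letters) ?_)
  have hT : Primrec fun x : ((ℕ × List (List ℕ)) × ℕ) × (Fin 2 × Bool) => x.1.1.2 :=
    Primrec.snd.comp (Primrec.fst.comp Primrec.fst)
  have hv : Primrec fun x : ((ℕ × List (List ℕ)) × ℕ) × (Fin 2 × Bool) => x.1.2 :=
    Primrec.snd.comp Primrec.fst
  have hl : Primrec fun x : ((ℕ × List (List ℕ)) × ℕ) × (Fin 2 × Bool) =>
      lookup x.1.1.2 x.2 x.1.2 := primrec_lookup.comp (hT.pair (Primrec.snd.pair hv))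
  have hnot : Primrec fun x : ((ℕ × List (List ℕ)) × ℕ) × (Fin 2 × Bool) => (x.2.1, !x.2.2) :=
    (Primrec.dom_finite fun x : Fin 2 × Bool => (x.1, !x.2)).comp Primrec.snd
  exact (Primrec.nat_lt.comp hl (Primrec.fst.comp (Primrec.fst.comp Primrec.fst))).and
    (Primrec.eq.comp (primrec_lookup.comp (hT.pair (hnot.pair hl))) hv)

theorem primrec_tables : Primrec tables :=
  primrec_listsUpTo.comp (primrec_listsUpTo.comp Primrec.list_range Primrec.id) (Primrec.const 4)

/-- The condition that a point is fixed by the generators but not by the element. -/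
theorem primrecPred_fixes : PrimrecPred fun x : List (List ℕ) × ℕ × Word × List Word =>
    (∀ w ∈ x.2.2.2, readTable x.1 x.2.1 w = x.2.1) → readTable x.1 x.2.1 x.2.2.1 = x.2.1 := by
  have hv : Primrec fun x : List (List ℕ) × ℕ × Word × List Word => x.2.1 :=
    Primrec.fst.comp Primrec.snd
  have hread : Primrec fun x : List (List ℕ) × ℕ × Word × List Word =>
      readTable x.1 x.2.1 x.2.2.1 :=
    primrec_readTable.comp (Primrec.fst.pair (hv.pair (Primrec.fst.comp (Primrec.snd.comp
      Primrec.snd))))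
  have hread' : Primrec fun x : (List (List ℕ) × ℕ × Word × List Word) × Word =>
      readTable x.1.1 x.1.2.1 x.2 :=
    primrec_readTable.comp ((Primrec.fst.comp Primrec.fst).pair
      ((hv.comp Primrec.fst).pair Primrec.snd))
  exact PrimrecPred.imp (PrimrecPred.forall_mem (Primrec.snd.comp (Primrec.snd.comp Primrec.snd))
    (Primrec.eq.comp hread' (hv.comp Primrec.fst))) (Primrec.eq.comp hread hv)

theorem primrecPred_mem_tables : PrimrecPred fun x : (Word × List Word) × ℕ =>
    ∀ T ∈ tables x.2, IsTable x.2 T → ∀ v ∈ List.range x.2,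
      (∀ w ∈ x.1.2, readTable T v w = v) → readTable T v x.1.1 = v := by
  have hk : Primrec fun x : ((Word × List Word) × ℕ) × List (List ℕ) => x.1.2 :=
    Primrec.snd.comp Primrec.fst
  have h : Primrec fun x : (((Word × List Word) × ℕ) × List (List ℕ)) × ℕ =>
      (x.1.2, x.2, x.1.1.1) :=
    (Primrec.snd.comp Primrec.fst).pair (Primrec.snd.pair
      (Primrec.fst.comp (Primrec.fst.comp Primrec.fst)))
  exact PrimrecPred.forall_mem (primrec_tables.comp Primrec.snd)
    ((primrecPred_isTable.comp (hk.pair Primrec.snd)).imp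
      (PrimrecPred.forall_mem (Primrec.list_range.comp hk) (primrecPred_fixes.comp h)))

theorem primrecPred_mem : PrimrecPred fun t : Word × List Word =>
    FreeGroup.mk t.1 ∈ fgSubgroup t.2 := by
  have hbound : Primrec fun t : Word × List Word =>
      List.range (t.2.flatten.length + t.1.length + 2) :=
    Primrec.list_range.comp (Primrec.nat_add.comp (Primrec.nat_add.comp
      (Primrec.list_length.comp (Primrec.list_flatten.comp Primrec.snd))
      (Primrec.list_length.comp Primrec.fst)) (Primrec.const 2))
  exact PrimrecPred.of_eq (PrimrecPred.forall_mem hbound primrecPred_mem_tables)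
    fun t => (mem_fgSubgroup_iff_tables t.1 t.2).symm

theorem primrec_invRev : Primrec fun w : Word => FreeGroup.invRev w :=
  Primrec.list_reverse.comp (Primrec.list_map Primrec.id
    ((Primrec.dom_finite fun x : Fin 2 × Bool => (x.1, !x.2)).comp Primrec.snd).to₂)

/-- The word problem of the free group. -/
theorem primrecPred_mk_eq : PrimrecPred fun t : Word × Word =>
    (FreeGroup.mk t.1 : F2) = FreeGroup.mk t.2 := by
  refine (primrecPred_mem.comp ((Primrec.list_append.comp Primrec.fst
    (primrec_invRev.comp Primrec.snd)).pair (Primrec.const []))).of_eq fun t => ?_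
  have : fgSubgroup [] = ⊥ := mk_eq_one_of_fgSubgroup (by simp)
  rw [this, Subgroup.mem_bot, mk_append, ← FreeGroup.inv_mk, mul_inv_eq_one]

/-! ### Substitutions and runs as primitive recursive functions -/

theorem primrec_subst : Primrec fun t : WordPair × Word => t.1.subst t.2 := by
  refine Primrec.list_flatMap Primrec.snd ?_
  have h2 : Primrec fun x : (WordPair × Word) × (Fin 2 × Bool) => x.2.2 :=
    Primrec.snd.comp Primrec.snd
  have h1 : Primrec fun x : (WordPair × Word) × (Fin 2 × Bool) => x.2.1 :=
    Primrec.fst.comp Primrec.snd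
  have hp : Primrec fun x : (WordPair × Word) × (Fin 2 × Bool) => x.1.1 :=
    Primrec.fst.comp Primrec.fst
  have h : Primrec fun x : (WordPair × Word) × (Fin 2 × Bool) =>
      if x.2.1 = 0 then x.1.1.1 else x.1.1.2 :=
    Primrec.ite (Primrec.eq.comp h1 (Primrec.const 0)) (Primrec.fst.comp hp) (Primrec.snd.comp hp)
  exact Primrec.ite (Primrec.eq.comp h2 (Primrec.const true)) h (primrec_invRev.comp h)

theorem primrec_comp : Primrec fun t : WordPair × WordPair => t.1.comp t.2 :=
  (primrec_subst.comp (Primrec.fst.pair (Primrec.fst.comp Primrec.snd))).pair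
    (primrec_subst.comp (Primrec.fst.pair (Primrec.snd.comp Primrec.snd)))

theorem primrec_subsPairs : Primrec subsPairs := by
  have h : Primrec₂ fun (_ : ℕ) (l : List WordPair) =>
      l ++ l.flatMap fun p => stepPairs.map fun q => p.comp q := by
    refine Primrec.list_append.comp Primrec.snd (Primrec.list_flatMap Primrec.snd ?_)
    exact Primrec.list_map (Primrec.const stepPairs)
      (primrec_comp.comp ((Primrec.snd.comp Primrec.fst).pair Primrec.snd)).to₂
  refine (Primrec.nat_rec₁ [WordPair.id, ([(1, true)], [(0, true)])] h).of_eq fun n => ?_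
  induction n with
  | zero => rfl
  | succ n ih => simp only [ih, subsPairs]

/-- It can be tested whether a pair of words names an element of the monoid. -/
theorem primrecPred_valid {M : Submonoid (MulAut F2)} (hM : M = IS ∨ M = IS⁻¹) :
    PrimrecPred fun p : WordPair => ∃ φ ∈ M, Reps p φ := by
  have hbound : Primrec fun p : WordPair => subsPairs (p.1.length + p.2.length) :=
    primrec_subsPairs.comp (Primrec.nat_add.comp (Primrec.list_length.comp Primrec.fst)
      (Primrec.list_length.comp Primrec.snd))
  rcases hM with rfl | rfl
  · refine PrimrecPred.of_eq (PrimrecPred.exists_mem hbound ?_) fun p => (exists_mem_IS_iff p).symm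
    exact (primrecPred_mk_eq.comp ((Primrec.fst.comp Primrec.snd).pair
      (Primrec.fst.comp Primrec.fst))).and (primrecPred_mk_eq.comp
      ((Primrec.snd.comp Primrec.snd).pair (Primrec.snd.comp Primrec.fst)))
  · refine PrimrecPred.of_eq (PrimrecPred.exists_mem hbound ?_)
      fun p => (exists_mem_IS_inv_iff p).symm
    exact (primrecPred_mk_eq.comp ((primrec_subst.comp (Primrec.snd.pair
      (Primrec.fst.comp Primrec.fst))).pair (Primrec.const _))).and
      (primrecPred_mk_eq.comp ((primrec_subst.comp (Primrec.snd.pair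
      (Primrec.snd.comp Primrec.fst))).pair (Primrec.const _)))

theorem primrec_label : Primrec label := by
  refine Primrec.list_foldr (h := fun _ (x : Edge × WordPair) => x.1.2.1.comp x.2) Primrec.id
    (Primrec.const _) ?_
  have h : Primrec fun y : List Edge × Edge × WordPair => y.2.1.2.1 :=
    Primrec.fst.comp (Primrec.snd.comp (Primrec.fst.comp Primrec.snd))
  exact primrec_comp.comp (h.pair (Primrec.snd.comp Primrec.snd))

theorem primrec_runState : Primrec fun t : ℕ × List Edge => runState t.1 t.2 := by
  refine Primrec.list_foldl
    (h := fun _ (x : Option ℕ × Edge) => if x.1 = some x.2.1 then some x.2.2.2 else none)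
    Primrec.snd (Primrec.option_some.comp Primrec.fst) ?_
  have h1 : Primrec fun x : (ℕ × List Edge) × Option ℕ × Edge => x.2.1 :=
    Primrec.fst.comp Primrec.snd
  have h2 : Primrec fun x : (ℕ × List Edge) × Option ℕ × Edge => x.2.2 :=
    Primrec.snd.comp Primrec.snd
  exact Primrec.ite (Primrec.eq.comp h1 (Primrec.option_some.comp (Primrec.fst.comp h2)))
    (Primrec.option_some.comp (Primrec.snd.comp (Primrec.snd.comp h2))) (Primrec.const none)

theorem primrec_cardResidual : Primrec cardResidual := by
  have hrel : Primrec cardRel :=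
    Primrec.nat_pow (Primrec.nat_pow (Primrec.const 2) Primrec.id) Primrec.id
  have hcls : Primrec cardCls :=
    Primrec.nat_pow hrel (Primrec.nat_pow hrel (Primrec.const 2))
  have hadd : ∀ {f g : ℕ → ℕ}, Primrec f → Primrec g → Primrec fun n => f n + g n :=
    fun hf hg => Primrec.nat_add.comp hf hg
  have hmul : ∀ {f g : ℕ → ℕ}, Primrec f → Primrec g → Primrec fun n => f n * g n :=
    fun hf hg => Primrec.nat_mul.comp hf hg
  have hstate : Primrec cardState :=
    Primrec.nat_pow (hadd (Primrec.nat_pow (hadd (hmul (hadd (Primrec.const 2)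
      (hmul hcls (hmul (Primrec.const 2) hcls))) (Primrec.const 2)) (Primrec.const 1)) Primrec.id)
      (Primrec.const 1)) Primrec.id
  exact hmul (Primrec.nat_pow hstate Primrec.id)
    (hmul hstate (Primrec.nat_pow (Primrec.const 2) hstate))

theorem primrec_flatten_length : Primrec fun K : List Word => K.flatten.length :=
  Primrec.list_length.comp Primrec.list_flatten

theorem primrec_sizeBound : Primrec fun t : List Word × List Word => sizeBound t.1 t.2 := by
  have hadd : ∀ {f g : List Word × List Word → ℕ}, Primrec f → Primrec g →
      Primrec fun n => f n + g n := fun hf hg => Primrec.nat_add.comp hf hg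
  exact Primrec.nat_mul.comp (Primrec.const 3) (hadd (hadd (hadd (hadd
    (primrec_flatten_length.comp Primrec.fst) (primrec_flatten_length.comp Primrec.snd))
    (Primrec.list_length.comp Primrec.fst)) (Primrec.list_length.comp Primrec.snd))
    (Primrec.const 1))

/-- The search for an automorphism in a rational subset is bounded, hence computable. -/
theorem computablePred_search {Q : List Word → List Word → MulAut F2 → Prop}
    {T : List Word → List Word → WordPair → Prop}
    (hreg : ∀ K H, Recog (fun w => Q K H (autW w)⁻¹) (Residual (sizeBound K H)))
    (hflip : ∀ K H φ, Q K H (iota * φ * iota) ↔ Q (K.map flipB) (H.map flipB) φ)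
    (hT : ∀ {p μ}, Reps p μ → ∀ K H, Q K H μ ↔ T K H p)
    (hprim : PrimrecPred fun t : (List Word × List Word) × WordPair => T t.1.1 t.1.2 t.2)
    {M : Submonoid (MulAut F2)} (hM : M = IS ∨ M = IS⁻¹) :
    ComputablePred fun t : List Word × List Word × AutomatonCode =>
      ∃ μ ∈ t.2.2.auts M, Q t.1 t.2.1 μ := by
  have key : ∀ t : List Word × List Word × AutomatonCode, (∃ μ ∈ t.2.2.auts M, Q t.1 t.2.1 μ) ↔
      ∃ es ∈ listsUpTo t.2.2.2.2
        (2 * (t.2.2.2.2.length + 1) * cardResidual (sizeBound t.1 t.2.1)),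
        (∀ e ∈ es, ∃ φ ∈ M, Reps e.2.1 φ) ∧ (∃ q ∈ t.2.2.2.1, runState t.2.2.1 es = some q) ∧
          T t.1 t.2.1 (label es) := by
    intro t
    rw [exists_short_run hreg hflip hM]
    refine exists_congr fun es => ?_
    rw [mem_listsUpTo]
    constructor
    · rintro ⟨h1, h2, h3, h4, μ, h5, h6⟩
      exact ⟨⟨h1, h2⟩, h3, h4, (hT h5 _ _).1 h6⟩
    · rintro ⟨⟨h1, h2⟩, h3, h4, h5⟩
      obtain ⟨μ, -, hμ⟩ := reps_label h3
      exact ⟨h1, h2, h3, h4, μ, hμ, (hT hμ _ _).2 h5⟩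
  refine PrimrecPred.computablePred (PrimrecPred.of_eq ?_ fun t => (key t).symm)
  have hKH : Primrec fun t : List Word × List Word × AutomatonCode => (t.1, t.2.1) :=
    Primrec.fst.pair (Primrec.fst.comp Primrec.snd)
  have hA : Primrec fun t : List Word × List Word × AutomatonCode => t.2.2 :=
    Primrec.snd.comp Primrec.snd
  have hE : Primrec fun t : List Word × List Word × AutomatonCode => t.2.2.2.2 :=
    Primrec.snd.comp (Primrec.snd.comp hA)
  refine PrimrecPred.exists_mem (primrec_listsUpTo.comp hE (Primrec.nat_mul.comp
    (Primrec.nat_mul.comp (Primrec.const 2) (Primrec.nat_add.comp (Primrec.list_length.comp hE)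
      (Primrec.const 1))) (primrec_cardResidual.comp (primrec_sizeBound.comp hKH)))) ?_
  refine PrimrecPred.and ?_ (PrimrecPred.and ?_ ?_)
  · exact PrimrecPred.forall_mem Primrec.snd ((primrecPred_valid hM).comp
      (Primrec.fst.comp (Primrec.snd.comp Primrec.snd)))
  · refine PrimrecPred.exists_mem (Primrec.fst.comp (Primrec.snd.comp (hA.comp Primrec.fst))) ?_
    exact Primrec.eq.comp (primrec_runState.comp ((Primrec.fst.comp (hA.comp (Primrec.fst.comp
      Primrec.fst))).pair (Primrec.snd.comp Primrec.fst))) (Primrec.option_some.comp Primrec.snd)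
  · exact hprim.comp ((hKH.comp Primrec.fst).pair (primrec_label.comp Primrec.snd))

/-! ### The five basic decision problems -/

theorem primrec_image : Primrec fun t : (List Word × List Word) × WordPair =>
    t.1.2.map t.2.subst :=
  Primrec.list_map (Primrec.snd.comp Primrec.fst)
    (primrec_subst.comp ((Primrec.snd.comp Primrec.fst).pair Primrec.snd)).to₂

theorem primrec_fst_fst : Primrec fun t : (List Word × List Word) × WordPair => t.1.1 :=
  Primrec.fst.comp Primrec.fst

section

variable {α : Type*} [Primcodable α]

theorem primrec_conjWord {f g : α → Word} (hf : Primrec f) (hg : Primrec g) :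
    Primrec fun a => FreeGroup.invRev (f a) ++ g a ++ f a :=
  Primrec.list_append.comp (Primrec.list_append.comp (primrec_invRev.comp hf) hg) hf

theorem primrec_conjWord' {f g : α → Word} (hf : Primrec f) (hg : Primrec g) :
    Primrec fun a => f a ++ g a ++ FreeGroup.invRev (f a) :=
  Primrec.list_append.comp (Primrec.list_append.comp hf hg) (primrec_invRev.comp hf)

theorem primrecPred_mk_mem {f : α → Word} {g : α → List Word} (hf : Primrec f) (hg : Primrec g) :
    PrimrecPred fun a => FreeGroup.mk (f a) ∈ fgSubgroup (g a) :=
  PrimrecPred.comp (p := fun t : Word × List Word => FreeGroup.mk t.1 ∈ fgSubgroup t.2)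
    (f := fun a => (f a, g a)) primrecPred_mem (hf.pair hg)

end

/-- The candidates for conjugators of `K` into the image of `H`, for the pair `t.1 = (K, H)` and the
endomorphism named by `t.2`. -/
def conjugators (t : (List Word × List Word) × WordPair) : List Word :=
  listsUpTo letters (t.1.1.flatten.length + (t.1.2.map t.2.subst).flatten.length)

theorem mem_conjugators {t : (List Word × List Word) × WordPair} {w : Word} :
    w ∈ conjugators t ↔
      w.length ≤ t.1.1.flatten.length + (t.1.2.map t.2.subst).flatten.length := by
  rw [conjugators, mem_listsUpTo]
  exact and_iff_left fun x _ => mem_letters x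

theorem primrec_conjugators : Primrec conjugators :=
  primrec_listsUpTo.comp (Primrec.const letters) (Primrec.nat_add.comp
    (primrec_flatten_length.comp primrec_fst_fst) (primrec_flatten_length.comp primrec_image))

theorem primrecPred_contains : PrimrecPred fun t : (List Word × List Word) × WordPair =>
    ∀ u ∈ t.1.1, FreeGroup.mk u ∈ fgSubgroup (t.1.2.map t.2.subst) :=
  PrimrecPred.forall_mem primrec_fst_fst
    (primrecPred_mk_mem Primrec.snd (primrec_image.comp Primrec.fst))

theorem primrecPred_contained : PrimrecPred fun t : (List Word × List Word) × WordPair =>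
    ∀ h ∈ t.1.2.map t.2.subst, FreeGroup.mk h ∈ fgSubgroup t.1.1 :=
  PrimrecPred.forall_mem primrec_image
    (primrecPred_mk_mem Primrec.snd (primrec_fst_fst.comp Primrec.fst))

theorem primrecPred_contains_conj :
    PrimrecPred fun t : ((List Word × List Word) × WordPair) × Word =>
    ∀ u ∈ t.1.1.1, FreeGroup.mk (FreeGroup.invRev t.2 ++ u ++ t.2) ∈
      fgSubgroup (t.1.1.2.map t.1.2.subst) :=
  PrimrecPred.forall_mem (primrec_fst_fst.comp Primrec.fst)
    (primrecPred_mk_mem (primrec_conjWord (Primrec.snd.comp Primrec.fst) Primrec.snd)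
      (primrec_image.comp (Primrec.fst.comp Primrec.fst)))

theorem primrecPred_contained_conj :
    PrimrecPred fun t : ((List Word × List Word) × WordPair) × Word =>
    ∀ h ∈ t.1.1.2.map t.1.2.subst,
      FreeGroup.mk (t.2 ++ h ++ FreeGroup.invRev t.2) ∈ fgSubgroup t.1.1.1 :=
  PrimrecPred.forall_mem (primrec_image.comp Primrec.fst)
    (primrecPred_mk_mem (primrec_conjWord' (Primrec.snd.comp Primrec.fst) Primrec.snd)
      (primrec_fst_fst.comp (Primrec.fst.comp Primrec.fst)))

section

variable {M : Submonoid (MulAut F2)}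

theorem computablePred_imageContains (hM : M = IS ∨ M = IS⁻¹) :
    ComputablePred fun t : List Word × List Word × AutomatonCode =>
      ∃ μ ∈ t.2.2.auts M, ImageContains t.1 t.2.1 μ :=
  computablePred_search recog_imageContains imageContains_flip imageContains_iff_words
    primrecPred_contains hM

theorem computablePred_imageEq (hM : M = IS ∨ M = IS⁻¹) :
    ComputablePred fun t : List Word × List Word × AutomatonCode =>
      ∃ μ ∈ t.2.2.auts M, ImageEq t.1 t.2.1 μ :=
  computablePred_search recog_imageEq imageEq_flip imageEq_iff_words
    (primrecPred_contains.and primrecPred_contained) hM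

theorem computablePred_imageContainsConj (hM : M = IS ∨ M = IS⁻¹) :
    ComputablePred fun t : List Word × List Word × AutomatonCode =>
      ∃ μ ∈ t.2.2.auts M, ImageContainsConj t.1 t.2.1 μ := by
  refine computablePred_search recog_imageContainsConj imageContainsConj_flip
    imageContainsConj_iff_words ?_ hM
  refine (PrimrecPred.exists_mem (p := fun t w => ∀ u ∈ t.1.1,
    FreeGroup.mk (FreeGroup.invRev w ++ u ++ w) ∈ fgSubgroup (t.1.2.map t.2.subst))
    primrec_conjugators primrecPred_contains_conj).of_eq fun t => ?_
  simp only [mem_conjugators]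

theorem computablePred_imageEqConj (hM : M = IS ∨ M = IS⁻¹) :
    ComputablePred fun t : List Word × List Word × AutomatonCode =>
      ∃ μ ∈ t.2.2.auts M, ImageEqConj t.1 t.2.1 μ := by
  refine computablePred_search recog_imageEqConj imageEqConj_flip imageEqConj_iff_words ?_ hM
  refine (PrimrecPred.exists_mem (p := fun t w => (∀ u ∈ t.1.1,
    FreeGroup.mk (FreeGroup.invRev w ++ u ++ w) ∈ fgSubgroup (t.1.2.map t.2.subst)) ∧
    ∀ h ∈ t.1.2.map t.2.subst, FreeGroup.mk (w ++ h ++ FreeGroup.invRev w) ∈ fgSubgroup t.1.1)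
    primrec_conjugators
    (primrecPred_contains_conj.and primrecPred_contained_conj)).of_eq fun t => ?_
  simp only [mem_conjugators]

theorem computablePred_imageMeetsConj (hM : M = IS ∨ M = IS⁻¹) :
    ComputablePred fun t : List Word × List Word × AutomatonCode =>
      ∃ μ ∈ t.2.2.auts M, ImageMeetsConj t.1 t.2.1 μ := by
  refine computablePred_search recog_imageMeetsConj imageMeetsConj_flip imageMeetsConj_iff_words
    ?_ hM
  have h : PrimrecPred fun x : (((List Word × List Word) × WordPair) × Word) × Word =>
      FreeGroup.mk (FreeGroup.invRev x.2 ++ x.1.2 ++ x.2) ∈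
        fgSubgroup (x.1.1.1.2.map x.1.1.2.subst) :=
    primrecPred_mk_mem (primrec_conjWord Primrec.snd (Primrec.snd.comp Primrec.fst))
      (primrec_image.comp (Primrec.fst.comp Primrec.fst))
  have h' : PrimrecPred fun x : ((List Word × List Word) × WordPair) × Word =>
      ∃ w ∈ conjugators x.1, FreeGroup.mk (FreeGroup.invRev w ++ x.2 ++ w) ∈
        fgSubgroup (x.1.1.2.map x.1.2.subst) :=
    PrimrecPred.exists_mem (primrec_conjugators.comp Primrec.fst) h
  refine (PrimrecPred.forall_mem (p := fun t u => ∃ w ∈ conjugators t,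
    FreeGroup.mk (FreeGroup.invRev w ++ u ++ w) ∈ fgSubgroup (t.1.2.map t.2.subst))
    primrec_fst_fst h').of_eq fun t => ?_
  simp only [mem_conjugators]

end

/-! ### Orbits, inner automorphisms and primitive elements -/

theorem ComputablePred.comp_primrec {α β : Type*} [Primcodable α] [Primcodable β] {p : β → Prop}
    (hp : ComputablePred p) {f : α → β} (hf : Primrec f) : ComputablePred fun a => p (f a) := by
  obtain ⟨_, hp⟩ := hp
  exact ⟨fun a => inferInstance, hp.comp hf.to_comp⟩

theorem exists_innerAuts_mul {G : Set (MulAut F2)} {P : MulAut F2 → Prop} :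
    (∃ μ ∈ innerAuts * G, P μ) ↔ ∃ μ ∈ G, ∃ w : F2, P (MulAut.conj w⁻¹ * μ) := by
  constructor
  · rintro ⟨_, ⟨l, ⟨w, hl⟩, μ, hμ, rfl⟩, h⟩
    have : l = MulAut.conj w⁻¹ := by
      ext1 x
      rw [hl]; simp
    exact ⟨μ, hμ, w, this ▸ h⟩
  · rintro ⟨μ, hμ, w, h⟩
    exact ⟨_, ⟨_, ⟨w, fun x => by simp⟩, μ, hμ, rfl⟩, h⟩

theorem exists_mem_inv {G : Set (MulAut F2)} {P : MulAut F2 → Prop} :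
    (∃ μ ∈ G⁻¹, P μ) ↔ ∃ μ ∈ G, P μ⁻¹ := by
  constructor
  · rintro ⟨μ, hμ, h⟩
    exact ⟨μ⁻¹, hμ, by rwa [inv_inv]⟩
  · rintro ⟨μ, hμ, h⟩
    exact ⟨μ⁻¹, by simpa using hμ, h⟩

theorem map_conj_mul (w : F2) (μ : MulAut F2) (H : Subgroup F2) :
    H.map (MulAut.conj w⁻¹ * μ).toMonoidHom = conjSubgroup w (H.map μ.toMonoidHom) := by
  rw [conjSubgroup, Subgroup.map_map]
  rfl

theorem conjSubgroup_le_comm {w : F2} {K L : Subgroup F2} :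
    conjSubgroup w K ≤ L ↔ K ≤ conjSubgroup w⁻¹ L := by
  constructor <;> intro h
  · have := conjSubgroup_mono (w := w⁻¹) h
    rwa [← conjSubgroup_mul, mul_inv_cancel, conjSubgroup_of_mem (one_mem _)] at this
  · have := conjSubgroup_mono (w := w) h
    rwa [← conjSubgroup_mul, inv_mul_cancel, conjSubgroup_of_mem (one_mem _)] at this

theorem le_conjSubgroup_comm {w : F2} {K L : Subgroup F2} :
    L ≤ conjSubgroup w K ↔ conjSubgroup w⁻¹ L ≤ K := by
  rw [conjSubgroup_le_comm, inv_inv]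

theorem conjSubgroup_eq_comm {w : F2} {K L : Subgroup F2} :
    conjSubgroup w K = L ↔ K = conjSubgroup w⁻¹ L := by
  rw [le_antisymm_iff, le_antisymm_iff, conjSubgroup_le_comm, le_conjSubgroup_comm (L := L)]

theorem map_aut_inv_le_iff {μ : MulAut F2} {K H : Subgroup F2} :
    K.map (μ⁻¹).toMonoidHom ≤ H ↔ K ≤ H.map μ.toMonoidHom := by
  rw [Subgroup.map_le_iff_le_comap]
  exact forall₂_congr fun x _ => (mem_map_aut (μ := μ)).symm

theorem le_map_aut_inv_iff {μ : MulAut F2} {K H : Subgroup F2} :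
    K ≤ H.map (μ⁻¹).toMonoidHom ↔ K.map μ.toMonoidHom ≤ H := by
  conv_rhs => rw [← inv_inv μ]
  exact map_aut_inv_le_iff.symm

theorem eq_map_aut_inv_iff {μ : MulAut F2} {K H : Subgroup F2} :
    K = H.map (μ⁻¹).toMonoidHom ↔ H = K.map μ.toMonoidHom := by
  rw [le_antisymm_iff, le_antisymm_iff, le_map_aut_inv_iff, map_aut_inv_le_iff, and_comm]

theorem isPrimitive_map_of (μ : MulAut F2) (i : Fin 2) : IsPrimitive (μ (FreeGroup.of i)) := by
  have hinj : Function.Injective fun i : Fin 2 => μ (FreeGroup.of i) :=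
    μ.injective.comp FreeGroup.of_injective
  let e := Equiv.ofInjective _ hinj
  refine ⟨Set.range fun i : Fin 2 => μ (FreeGroup.of i), ?_, i, rfl⟩
  have h : (FreeGroup.lift
      (Subtype.val : Set.range (fun i : Fin 2 => μ (FreeGroup.of i)) → F2)).comp
      (FreeGroup.freeGroupCongr e).toMonoidHom = μ.toMonoidHom := by
    ext i
    simp [e]
  refine (Function.Bijective.of_comp_iff _ (FreeGroup.freeGroupCongr e).bijective).1 ?_
  have h2 := congrArg DFunLike.coe h
  rw [MonoidHom.coe_comp] at h2
  exact h2.symm ▸ μ.bijective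

theorem fgSubgroup_singleton_le {u : Word} {L : Subgroup F2} :
    fgSubgroup [u] ≤ L ↔ FreeGroup.mk u ∈ L := by
  simp [fgSubgroup_le_iff]

theorem conjSubgroup_fgSubgroup_singleton_le {u : Word} {w : F2} {L : Subgroup F2} :
    conjSubgroup w (fgSubgroup [u]) ≤ L ↔ w⁻¹ * FreeGroup.mk u * w ∈ L := by
  simp [conjSubgroup_le_iff]

theorem exists_innerAuts_mul_mem {G : Set (MulAut F2)} {x : F2} {H : Subgroup F2} :
    (∃ μ ∈ innerAuts * G, x ∈ H.map μ.toMonoidHom) ↔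
      ∃ μ ∈ G, ∃ w : F2, w⁻¹ * x * w ∈ H.map μ.toMonoidHom := by
  rw [exists_innerAuts_mul (P := fun μ => x ∈ H.map μ.toMonoidHom)]
  refine exists_congr fun μ => and_congr_right fun _ => ?_
  simp only [map_conj_mul, mem_conjSubgroup]
  rw [(inv_surjective (G := F2)).exists]
  simp only [inv_inv]

theorem elementOrbit_inter_nonempty {G : Set (MulAut F2)} {x : F2} {H : Subgroup F2} :
    (elementOrbit G x ∩ (H : Set F2)).Nonempty ↔ ∃ μ ∈ G, μ x ∈ H := by
  constructor
  · rintro ⟨_, ⟨μ, hμ, rfl⟩, h⟩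
    exact ⟨μ, hμ, h⟩
  · rintro ⟨μ, hμ, h⟩
    exact ⟨_, ⟨μ, hμ, rfl⟩, h⟩

theorem exists_subgroupOrbit {G : Set (MulAut F2)} {K : Subgroup F2} {P : Subgroup F2 → Prop} :
    (∃ L ∈ subgroupOrbit G K, P L) ↔ ∃ μ ∈ G, P (K.map μ.toMonoidHom) := by
  constructor
  · rintro ⟨_, ⟨μ, hμ, rfl⟩, h⟩
    exact ⟨μ, hμ, h⟩
  · rintro ⟨μ, hμ, h⟩
    exact ⟨_, ⟨μ, hμ, rfl⟩, h⟩

/-- A conjugate of `μ⁻¹(K)` is the image under `μ⁻¹` of a conjugate of `K`, so conjugating before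
or after applying `μ⁻¹` makes no difference to an existential statement. -/
theorem exists_conjSubgroup_map_inv {μ : MulAut F2} {K : Subgroup F2} {P : Subgroup F2 → Prop} :
    (∃ w, P (conjSubgroup w (K.map (μ⁻¹).toMonoidHom))) ↔
      ∃ w, P ((conjSubgroup w K).map (μ⁻¹).toMonoidHom) := by
  rw [(μ⁻¹).surjective.exists]
  simp only [conjSubgroup_map]

theorem exists_primitive_iff {G : Set (MulAut F2)} {i : Fin 2} {H : Subgroup F2} :
    (∃ x ∈ H, IsPrimitive x ∧ ∃ μ : MulAut F2, μ⁻¹ ∈ G ∧ x = μ (FreeGroup.of i)) ↔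
      ∃ μ ∈ G, FreeGroup.of i ∈ H.map μ.toMonoidHom := by
  simp only [mem_map_aut]
  constructor
  · rintro ⟨_, hx, -, μ, hμ, rfl⟩
    exact ⟨μ⁻¹, hμ, by rwa [inv_inv]⟩
  · rintro ⟨μ, hμ, h⟩
    exact ⟨_, h, isPrimitive_map_of _ i, μ⁻¹, by rwa [inv_inv], rfl⟩

theorem mainTheorem6 (M : Submonoid (MulAut F2)) (hM : M = IS ∨ M = IS⁻¹) :
    -- an element
    ComputablePred (fun ((u, H, A) : Word × List Word × AutomatonCode) =>
      ∃ μ ∈ A.auts M, FreeGroup.mk u ∈ (fgSubgroup H).map μ.toMonoidHom) ∧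
    ComputablePred (fun ((u, H, A) : Word × List Word × AutomatonCode) =>
      ∃ μ ∈ A.auts M, ∃ w : F2,
        w⁻¹ * FreeGroup.mk u * w ∈ (fgSubgroup H).map μ.toMonoidHom) ∧
    ComputablePred (fun ((u, H, A) : Word × List Word × AutomatonCode) =>
      ∃ μ ∈ innerAuts * A.auts M, FreeGroup.mk u ∈ (fgSubgroup H).map μ.toMonoidHom) ∧
    -- containment of a subgroup
    ComputablePred (fun ((K, H, A) : List Word × List Word × AutomatonCode) =>
      ∃ μ ∈ A.auts M, fgSubgroup K ≤ (fgSubgroup H).map μ.toMonoidHom) ∧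
    ComputablePred (fun ((K, H, A) : List Word × List Word × AutomatonCode) =>
      ∃ μ ∈ A.auts M, ∃ w : F2,
        conjSubgroup w (fgSubgroup K) ≤ (fgSubgroup H).map μ.toMonoidHom) ∧
    ComputablePred (fun ((K, H, A) : List Word × List Word × AutomatonCode) =>
      ∃ μ ∈ innerAuts * A.auts M, fgSubgroup K ≤ (fgSubgroup H).map μ.toMonoidHom) ∧
    -- equality of subgroups
    ComputablePred (fun ((K, H, A) : List Word × List Word × AutomatonCode) =>
      ∃ μ ∈ A.auts M, fgSubgroup K = (fgSubgroup H).map μ.toMonoidHom) ∧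
    ComputablePred (fun ((K, H, A) : List Word × List Word × AutomatonCode) =>
      ∃ μ ∈ A.auts M, ∃ w : F2,
        conjSubgroup w (fgSubgroup K) = (fgSubgroup H).map μ.toMonoidHom) ∧
    ComputablePred (fun ((K, H, A) : List Word × List Word × AutomatonCode) =>
      ∃ μ ∈ innerAuts * A.auts M, fgSubgroup K = (fgSubgroup H).map μ.toMonoidHom) ∧
    -- independent conjugates of finitely many elements
    ComputablePred (fun ((us, H, A) : List Word × List Word × AutomatonCode) =>
      ∃ μ ∈ A.auts M, ∀ u ∈ us, ∃ w : F2,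
        w⁻¹ * FreeGroup.mk u * w ∈ (fgSubgroup H).map μ.toMonoidHom) ∧
    -- orbits of elements
    ComputablePred (fun ((u, H, A) : Word × List Word × AutomatonCode) =>
      (elementOrbit (A.auts M)⁻¹ (FreeGroup.mk u) ∩ (fgSubgroup H : Set F2)).Nonempty) ∧
    ComputablePred (fun ((u, H, A) : Word × List Word × AutomatonCode) =>
      (elementOrbit (innerAuts * (A.auts M)⁻¹) (FreeGroup.mk u) ∩
        (fgSubgroup H : Set F2)).Nonempty) ∧
    -- orbits of subgroups: `H` contains an element of the orbit of `K`
    ComputablePred (fun ((K, H, A) : List Word × List Word × AutomatonCode) =>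
      ∃ L ∈ subgroupOrbit (A.auts M)⁻¹ (fgSubgroup K), L ≤ fgSubgroup H) ∧
    ComputablePred (fun ((K, H, A) : List Word × List Word × AutomatonCode) =>
      ∃ L ∈ subgroupOrbit (innerAuts * (A.auts M)⁻¹) (fgSubgroup K), L ≤ fgSubgroup H) ∧
    -- orbits of subgroups: `H` is contained in an element of the orbit of `K`
    ComputablePred (fun ((K, H, A) : List Word × List Word × AutomatonCode) =>
      ∃ L ∈ subgroupOrbit (A.auts M) (fgSubgroup K), fgSubgroup H ≤ L) ∧
    ComputablePred (fun ((K, H, A) : List Word × List Word × AutomatonCode) =>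
      ∃ L ∈ subgroupOrbit (innerAuts * A.auts M) (fgSubgroup K), fgSubgroup H ≤ L) ∧
    -- orbits of subgroups: `K` is an element of the orbit of `H`
    ComputablePred (fun ((K, H, A) : List Word × List Word × AutomatonCode) =>
      fgSubgroup K ∈ subgroupOrbit (A.auts M) (fgSubgroup H)) ∧
    ComputablePred (fun ((K, H, A) : List Word × List Word × AutomatonCode) =>
      fgSubgroup K ∈ subgroupOrbit (A.auts M)⁻¹ (fgSubgroup H)) ∧
    ComputablePred (fun ((K, H, A) : List Word × List Word × AutomatonCode) =>
      fgSubgroup K ∈ subgroupOrbit (innerAuts * A.auts M) (fgSubgroup H)) ∧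
    ComputablePred (fun ((K, H, A) : List Word × List Word × AutomatonCode) =>
      fgSubgroup K ∈ subgroupOrbit (innerAuts * (A.auts M)⁻¹) (fgSubgroup H)) ∧
    -- primitive elements; the letter `i` is `a` or `b`
    ComputablePred (fun ((i, H, A) : Fin 2 × List Word × AutomatonCode) =>
      ∃ x ∈ fgSubgroup H, IsPrimitive x ∧
        ∃ μ : MulAut F2, μ⁻¹ ∈ A.auts M ∧ x = μ (FreeGroup.of i)) ∧
    ComputablePred (fun ((i, H, A) : Fin 2 × List Word × AutomatonCode) =>
      ∃ x ∈ fgSubgroup H, IsPrimitive x ∧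
        ∃ μ : MulAut F2, μ⁻¹ ∈ innerAuts * A.auts M ∧ x = μ (FreeGroup.of i)) := by
  -- an element or a letter is replaced by the list of generators of a cyclic subgroup; `hsw`
  -- exchanges `K` and `H`
  have hL : Primrec fun t : Word × List Word × AutomatonCode => ([t.1], t.2.1, t.2.2) :=
    (Primrec.list_cons.comp Primrec.fst (Primrec.const [])).pair Primrec.snd
  have hi : Primrec fun t : Fin 2 × List Word × AutomatonCode => ([[(t.1, true)]], t.2.1, t.2.2) :=
    ((Primrec.dom_finite fun i : Fin 2 => ([[(i, true)]] : List Word)).comp Primrec.fst).pair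
      Primrec.snd
  have hsw : Primrec fun t : List Word × List Word × AutomatonCode => (t.2.1, t.1, t.2.2) :=
    (Primrec.fst.comp Primrec.snd).pair (Primrec.fst.pair (Primrec.snd.comp Primrec.snd))
  have D1 := computablePred_imageContains hM
  have D2 := computablePred_imageContainsConj hM
  have D3 := computablePred_imageEq hM
  have D4 := computablePred_imageEqConj hM
  have D5 := computablePred_imageMeetsConj hM
  have E1 := (D1.comp_primrec hL).of_eq
    (q := fun ((u, H, A) : Word × List Word × AutomatonCode) =>
      ∃ μ ∈ A.auts M, FreeGroup.mk u ∈ (fgSubgroup H).map μ.toMonoidHom)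
    fun ⟨u, H, A⟩ => by simp only [ImageContains, fgSubgroup_singleton_le]
  have E2 := (D2.comp_primrec hL).of_eq
    (q := fun ((u, H, A) : Word × List Word × AutomatonCode) =>
      ∃ μ ∈ A.auts M, ∃ w : F2,
        w⁻¹ * FreeGroup.mk u * w ∈ (fgSubgroup H).map μ.toMonoidHom)
    fun ⟨u, H, A⟩ => by simp only [ImageContainsConj, conjSubgroup_fgSubgroup_singleton_le]
  refine ⟨E1, E2, E2.of_eq fun ⟨u, H, A⟩ => ?_, D1, D2, D2.of_eq fun ⟨K, H, A⟩ => ?_, D3, D4,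
    D4.of_eq fun ⟨K, H, A⟩ => ?_, D5, E1.of_eq fun ⟨u, H, A⟩ => ?_, E2.of_eq fun ⟨u, H, A⟩ => ?_,
    D1.of_eq fun ⟨K, H, A⟩ => ?_, D2.of_eq fun ⟨K, H, A⟩ => ?_,
    (D1.comp_primrec hsw).of_eq fun ⟨K, H, A⟩ => ?_,
    (D2.comp_primrec hsw).of_eq fun ⟨K, H, A⟩ => ?_,
    D3.of_eq fun ⟨K, H, A⟩ => ?_, (D3.comp_primrec hsw).of_eq fun ⟨K, H, A⟩ => ?_,
    D4.of_eq fun ⟨K, H, A⟩ => ?_, (D4.comp_primrec hsw).of_eq fun ⟨K, H, A⟩ => ?_,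
    (D1.comp_primrec hi).of_eq fun ⟨i, H, A⟩ => ?_, (D2.comp_primrec hi).of_eq fun ⟨i, H, A⟩ => ?_⟩
  all_goals dsimp only [ImageContains, ImageContainsConj, ImageEq, ImageEqConj]
  · exact exists_innerAuts_mul_mem.symm
  · rw [exists_innerAuts_mul
      (P := fun μ => fgSubgroup K ≤ (fgSubgroup H).map μ.toMonoidHom)]
    refine exists_congr fun μ => and_congr_right fun _ => ?_
    simp only [map_conj_mul, le_conjSubgroup_comm]
    exact inv_surjective.exists
  · rw [exists_innerAuts_mul
      (P := fun μ => fgSubgroup K = (fgSubgroup H).map μ.toMonoidHom)]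
    refine exists_congr fun μ => and_congr_right fun _ => ?_
    simp only [map_conj_mul, conjSubgroup_eq_comm]
    exact ((inv_surjective (G := F2)).exists (p := fun w =>
      fgSubgroup K = conjSubgroup w ((fgSubgroup H).map μ.toMonoidHom))).symm
  · rw [elementOrbit_inter_nonempty, exists_mem_inv (P := fun μ => μ _ ∈ _)]
    simp only [mem_map_aut]
  · rw [elementOrbit_inter_nonempty, exists_innerAuts_mul (P := fun μ => μ _ ∈ _),
      exists_mem_inv (P := fun μ => ∃ w : F2, (MulAut.conj w⁻¹ * μ) _ ∈ _)]
    refine exists_congr fun μ => and_congr_right fun _ => ?_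
    refine Iff.trans ?_ (μ⁻¹).surjective.exists.symm
    simp only [mem_map_aut, map_mul, map_inv, MulAut.mul_apply, MulAut.conj_inv_apply]
  · rw [exists_subgroupOrbit, exists_mem_inv (P := fun μ => Subgroup.map μ.toMonoidHom _ ≤ _)]
    simp only [map_aut_inv_le_iff]
  · rw [exists_subgroupOrbit,
      exists_innerAuts_mul (P := fun μ => Subgroup.map μ.toMonoidHom _ ≤ _),
      exists_mem_inv (P := fun μ => ∃ w : F2,
        Subgroup.map (MulAut.conj w⁻¹ * μ).toMonoidHom _ ≤ _)]
    refine exists_congr fun μ => and_congr_right fun _ => ?_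
    simp only [map_conj_mul]
    rw [exists_conjSubgroup_map_inv (P := fun L => L ≤ fgSubgroup H)]
    simp only [map_aut_inv_le_iff]
  · rw [exists_subgroupOrbit]
  · rw [exists_subgroupOrbit,
      exists_innerAuts_mul (P := fun μ => _ ≤ Subgroup.map μ.toMonoidHom _)]
    refine exists_congr fun μ => and_congr_right fun _ => ?_
    simp only [map_conj_mul, le_conjSubgroup_comm]
    exact inv_surjective.exists
  · rfl
  · refine Iff.trans ?_ (exists_mem_inv (P := fun μ => _ = Subgroup.map μ.toMonoidHom _)).symm
    simp only [eq_map_aut_inv_iff]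
  · refine Iff.trans ?_ (exists_innerAuts_mul (P := fun μ => _ = Subgroup.map μ.toMonoidHom _)).symm
    refine exists_congr fun μ => and_congr_right fun _ => ?_
    simp only [map_conj_mul, conjSubgroup_eq_comm]
    exact ((inv_surjective (G := F2)).exists (p := fun w =>
      fgSubgroup K = conjSubgroup w ((fgSubgroup H).map μ.toMonoidHom))).symm
  · refine Iff.trans ?_ (exists_innerAuts_mul (P := fun μ => _ = Subgroup.map μ.toMonoidHom _)).symm
    rw [exists_mem_inv (P := fun μ => ∃ w : F2,
        _ = Subgroup.map (MulAut.conj w⁻¹ * μ).toMonoidHom _)]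
    refine exists_congr fun μ => and_congr_right fun _ => ?_
    simp only [map_conj_mul]
    rw [exists_conjSubgroup_map_inv (P := fun L => fgSubgroup K = L)]
    simp only [eq_map_aut_inv_iff]
  · rw [exists_primitive_iff]
    simp only [fgSubgroup_singleton_le]
    rfl
  · rw [exists_primitive_iff, exists_innerAuts_mul_mem]
    simp only [conjSubgroup_fgSubgroup_singleton_le]
    rfl
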